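/- Let $n\ge 3$ and let $G$ be the simply connected simple complex algebraic group of type $D_n$ (with $D_3=A_3$), with nodes $I=\{1,\dots,n\}$ of the Dynkin diagram numbered so that $1,2,\dots,n-2$ is a chain and both $n-1$ and $n$ are joined to $n-2$. Let $e_i,f_i$ be the Chevalley generators, $x_i(t)=\exp(te_i)$, $y_i(t)=\exp(tf_i)$, let $U^{\pm}$ be the maximal unipotent subgroups generated by the $x_i(t)$, respectively the $y_i(t)$, let $\alpha_i^\vee(c)$ ($c\in\mathbb C^\times$) be the simple coroot subgroups, $T$ the maximal torus generated by them, $\Lambda_1,\dots,\Lambda_n$ the fundamental weights, $W$ the Weyl group with simple reflections $s_i$ and longest element $w_0$. Put $\overline{s}_i=x_i(-1)y_i(1)x_i(-1)$ and $\overline{w}=\overline{s}_{i_1}\cdots\overline{s}_{i_l}$ for a reduced word $i_1\dots i_l$ of $w\in W$. Let $\Delta_{\Lambda_k}$ be the principal minor, i.e. the unique regular function on $G$ with $\Delta_{\Lambda_k}(u^-tu^+)=\Lambda_k(t)$ for all $u^\pm\in U^\pm$, $t\in T$ (it exists for every $k\in I$), and let $\Delta_{u\Lambda_k,v\Lambda_k}(g)=\Delta_{\Lambda_k}(\overline{u}^{\,-1}g\,\overline{v})$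 for $u,v\in W$ be the generalized minors. The word $\mathbf i_0=(1\,2\cdots n)^{n-1}$ is a reduced word of $w_0$. For $c=(c^{(1)}_1,\dots,c^{(1)}_n,c^{(2)}_1,\dots,c^{(n-1)}_n)\in(\mathbb C^\times)^{n(n-1)}$ let $$\Theta^-_{\mathbf i_0}(c)=\prod_{l=1}^{n-1}\Bigl(\boldsymbol y_1(c^{(l)}_1)\,\boldsymbol y_2(c^{(l)}_2)\cdots\boldsymbol y_n(c^{(l)}_n)\Bigr),\qquad \boldsymbol y_i(a)=y_i(a)\,\alpha_i^\vee(a^{-1}),$$ where the factors $l=1,\dots,n-1$ are ordered from left to right. Then for every such $c$ and every $k\in\{1,\dots,n-2\}$ $$\Delta_{w_0\Lambda_k,s_k\Lambda_k}(\Theta^-_{\mathbf i_0}(c))=c^{(k)}_1+\sum_{j=2}^{n-2}\frac{c^{(k)}_j}{c^{(k+1)}_{j-1}}+\frac{c^{(k)}_{n-1}c^{(k)}_n}{c^{(k+1)}_{n-2}}+\frac{c^{(k+1)}_{n-2}}{c^{(k+1)}_{n-1}c^{(k+1)}_n}+\frac{c^{(k)}_n}{c^{(k+1)}_{n-1}}+\frac{c^{(k)}_{n-1}}{c^{(k+1)}_n}+\sum_{j=k+2}^{n-1}\frac{c^{(j)}_{n-1+k-j}}{c^{(j)}_{n+k-j}},$$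 and for the two spin weights $$\Delta_{w_0\Lambda_{n-1},s_{n-1}\Lambda_{n-1}}(\Theta^-_{\mathbf i_0}(c))=c^{(n-1)}_{n-1},\qquad \Delta_{w_0\Lambda_{n},s_{n}\Lambda_{n}}(\Theta^-_{\mathbf i_0}(c))=c^{(n-1)}_{n}.$$ -/

import Mathlib

/-! The simply connected complex group of type `D_n`, realised as a Chevalley group: the subgroup of
the general linear group of `V(Λ₁) ⊕ V(Λ_{n-1}) ⊕ V(Λ_n)` (vector and two half-spin modules)
generated by the one-parameter subgroups of the Chevalley generators.  The weights of this module
span the whole weight lattice, so the group is the simply connected one.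
Nodes `1, …, n` of the Dynkin diagram are the elements `0, …, n-1` of `Fin n`; the last two are
the spin nodes. -/

noncomputable section

namespace TypeD

/-! ### The module -/

/-- Basis of the vector representation `V(Λ₁)`: `inl i` is `v_{i+1}`, `inr i` is `v_{\overline{i+1}}`. -/
abbrev VecIdx (n : ℕ) := Fin n ⊕ Fin n

/-- Basis of the sum of the two half-spin representations: all sign vectors `(ε₁, …, ε_n)`,
with `true` for `+`.  The vectors with an even (odd) number of minus signs span
`V(Λ_n)` (`V(Λ_{n-1})`). -/
abbrev SpinIdx (n : ℕ) := Fin n → Bool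

/-- Basis of `V(Λ₁) ⊕ V(Λ_{n-1}) ⊕ V(Λ_n)`. -/
abbrev Idx (n : ℕ) := VecIdx n ⊕ SpinIdx n

/-- `VecRaise i b a` says `e_i b = a` for the basis vectors `b`, `a` of `V(Λ₁)`:
`e_i v_{i+1} = v_i` and `e_i v_{\bar i} = v_{\overline{i+1}}` for `i < n`, and
`e_n v_{\overline{n-1}} = v_n`, `e_n v_{\bar n} = v_{n-1}`. -/
def VecRaise {n : ℕ} (i : Fin n) : VecIdx n → VecIdx n → Prop
  | .inl b, .inl a => a = i ∧ b.val = i.val + 1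
  | .inr b, .inr a => b = i ∧ a.val = i.val + 1
  | .inr b, .inl a => i.val + 1 = n ∧ ((b.val + 1 = i.val ∧ a = i) ∨ (b = i ∧ a.val + 1 = i.val))
  | .inl _, .inr _ => False

/-- `SpinRaise i b a` says `e_i b = a` for sign vectors `b`, `a`: for `i < n` the signs
`(ε_i, ε_{i+1}) = (-, +)` become `(+, -)`, and for `i = n` the signs
`(ε_{n-1}, ε_n) = (-, -)` become `(+, +)`. -/
def SpinRaise {n : ℕ} (i : Fin n) (b a : SpinIdx n) : Prop :=
  (∃ j : Fin n, j.val = i.val + 1 ∧ b i = false ∧ b j = true ∧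
      a = Function.update (Function.update b i true) j false) ∨
  (i.val + 1 = n ∧ ∃ j : Fin n, j.val + 1 = i.val ∧ b j = false ∧ b i = false ∧
      a = Function.update (Function.update b j true) i true)

/-- `Raise i b a` says `e_i b = a`; if there is no such `a` then `e_i b = 0`. -/
def Raise {n : ℕ} (i : Fin n) : Idx n → Idx n → Prop
  | .inl b, .inl a => VecRaise i b a
  | .inr b, .inr a => SpinRaise i b a
  | _, _ => False

open scoped Classical in
/-- The Chevalley generator `e_i` acting on the module (columns are images of basis vectors). -/
def e {n : ℕ} (i : Fin n) : Matrix (Idx n) (Idx n) ℂ :=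
  Matrix.of fun a b => if Raise i b a then 1 else 0

open scoped Classical in
/-- The Chevalley generator `f_i`: `f_i a = b` exactly when `e_i b = a`. -/
def f {n : ℕ} (i : Fin n) : Matrix (Idx n) (Idx n) ℂ :=
  Matrix.of fun b a => if Raise i b a then 1 else 0

theorem Raise.not_raise {n : ℕ} {i : Fin n} {a b c : Idx n} (h : Raise i b a) :
    ¬ Raise i a c := by
  intro h'
  rcases b with (b | b) | b <;> rcases a with (a | a) | a <;> rcases c with (c | c) | c <;>
    simp only [Raise, VecRaise] at h h'
  all_goals try (simp only [Fin.ext_iff] at h h'; omega)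
  have ha : a i = true := by
    rcases h with ⟨j, hj, -, -, rfl⟩ | ⟨-, j, -, -, -, rfl⟩
    · have : i ≠ j := by intro hij; rw [← hij] at hj; omega
      simp [Function.update_of_ne this]
    · simp
  rcases h' with ⟨j, -, h1, -⟩ | ⟨-, j, -, -, h1, -⟩ <;> simp [ha] at h1

theorem e_mul_e {n : ℕ} (i : Fin n) : e i * e i = 0 := by
  ext a c
  simp only [e, Matrix.mul_apply, Matrix.of_apply, Matrix.zero_apply]
  refine Finset.sum_eq_zero fun b _ => ?_
  by_cases h : Raise i c b
  · simp [h.not_raise]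
  · simp [h]

theorem f_mul_f {n : ℕ} (i : Fin n) : f i * f i = 0 := by
  ext a c
  simp only [f, Matrix.mul_apply, Matrix.of_apply, Matrix.zero_apply]
  refine Finset.sum_eq_zero fun b _ => ?_
  by_cases h : Raise i a b
  · simp [h.not_raise]
  · simp [h]

/-- For `A² = 0` the invertible matrix `exp (t A) = 1 + t A`. -/
def expUnit {n : ℕ} (A : Matrix (Idx n) (Idx n) ℂ) (hA : A * A = 0) (t : ℂ) :
    (Matrix (Idx n) (Idx n) ℂ)ˣ where
  val := 1 + t • A
  inv := 1 - t • A
  val_inv := by simp [add_mul, mul_sub, hA]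
  inv_val := by simp [sub_mul, mul_add, hA]

theorem expUnit_val {n : ℕ} (A : Matrix (Idx n) (Idx n) ℂ) (hA : A * A = 0) (t : ℂ) :
    ((expUnit A hA t : (Matrix (Idx n) (Idx n) ℂ)ˣ) : Matrix (Idx n) (Idx n) ℂ) =
      IsNilpotent.exp (t • A) := by
  have h : (t • A) ^ 2 = 0 := by simp [pow_two, hA]
  rw [IsNilpotent.exp_eq_sum h]
  simp [expUnit, Finset.sum_range_succ]

/-! ### The group and its subgroups -/

/-- The simply connected group `G` of type `D_n`, generated by `exp (t e_i)` and `exp (t f_i)`. -/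
def G (n : ℕ) : Subgroup (Matrix (Idx n) (Idx n) ℂ)ˣ :=
  Subgroup.closure
    (Set.range (fun p : Fin n × ℂ => expUnit (e p.1) (e_mul_e p.1) p.2) ∪
      Set.range (fun p : Fin n × ℂ => expUnit (f p.1) (f_mul_f p.1) p.2))

/-- `x_i(t) = exp (t e_i)`. -/
def x {n : ℕ} (i : Fin n) (t : ℂ) : G n :=
  ⟨expUnit (e i) (e_mul_e i) t, Subgroup.subset_closure (Or.inl ⟨(i, t), rfl⟩)⟩

/-- `y_i(t) = exp (t f_i)`. -/
def y {n : ℕ} (i : Fin n) (t : ℂ) : G n :=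
  ⟨expUnit (f i) (f_mul_f i) t, Subgroup.subset_closure (Or.inr ⟨(i, t), rfl⟩)⟩

/-- The representative `\bar s_i = x_i(-1) y_i(1) x_i(-1)` of the simple reflection `s_i`. -/
def sBar {n : ℕ} (i : Fin n) : G n := x i (-1) * y i 1 * x i (-1)

/-- The coroot subgroup `α_i^∨(c) = φ_i (diag (c, c⁻¹))`, for `c ≠ 0`, where `φ_i : SL₂ → G` sends
the elementary matrices to `x_i(t)`, `y_i(t)`; in `SL₂` one has
`diag (c, c⁻¹) = (1 c; 0 1) (1 0; -c⁻¹ 1) (1 c; 0 1) · (1 -1; 0 1) (1 0; 1 1) (1 -1; 0 1)`. -/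
def alphaCheck {n : ℕ} (i : Fin n) (c : ℂ) : G n := x i c * y i (-c⁻¹) * x i c * sBar i

/-- The maximal unipotent subgroup `U = U⁺`, generated by the simple root subgroups `x_i(ℂ)`. -/
def Uplus (n : ℕ) : Subgroup (G n) :=
  Subgroup.closure (Set.range fun p : Fin n × ℂ => x p.1 p.2)

/-- The maximal unipotent subgroup `U⁻`, generated by the `y_i(ℂ)`. -/
def Uminus (n : ℕ) : Subgroup (G n) :=
  Subgroup.closure (Set.range fun p : Fin n × ℂ => y p.1 p.2)

/-- The general element `∏ α_i^∨(a_i)` of the maximal torus `T ≅ (ℂ^×)^n`. -/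
def torus {n : ℕ} (a : Fin n → ℂˣ) : G n := (List.ofFn fun i => alphaCheck i (a i : ℂ)).prod

/-! ### The Weyl group -/

/-- The simple root `α_i` as a linear form on the Cartan subalgebra `𝔱 = ⨁ ℂ h_j`, identified with
`Fin n → ℂ` by the basis of simple coroots: `α_i(h_j) = a_{j i}`, the Cartan matrix of type `D_n`. -/
def simpleRoot {n : ℕ} (i : Fin n) : Module.Dual ℂ (Fin n → ℂ) :=
  ∑ j, ((CartanMatrix.D n j i : ℤ) : ℂ) • LinearMap.proj j

theorem simpleRoot_coroot {n : ℕ} (i : Fin n) : simpleRoot i (Pi.single i (1 : ℂ)) = 2 := by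
  rw [simpleRoot, LinearMap.sum_apply, Finset.sum_eq_single i]
  · simp [CartanMatrix.D]
  · intro j _ hj
    simp [Pi.single_eq_of_ne hj]
  · simp

/-- The simple reflection `s_i(h) = h - α_i(h) h_i` of `𝔱`. -/
def simpleReflection {n : ℕ} (i : Fin n) : (Fin n → ℂ) ≃ₗ[ℂ] (Fin n → ℂ) :=
  Module.reflection (simpleRoot_coroot i)

/-- The Weyl group. -/
def weylGroup (n : ℕ) : Subgroup ((Fin n → ℂ) ≃ₗ[ℂ] (Fin n → ℂ)) :=
  Subgroup.closure (Set.range simpleReflection)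

/-- The simple reflection `s_i` as an element of the Weyl group. -/
def s {n : ℕ} (i : Fin n) : weylGroup n :=
  ⟨simpleReflection i, Subgroup.subset_closure ⟨i, rfl⟩⟩

/-- `i₁ … i_l` is a reduced word of `w`: `w = s_{i₁} ⋯ s_{i_l}` with `l` minimal. -/
def IsReducedWord {n : ℕ} (l : List (Fin n)) (w : weylGroup n) : Prop :=
  (l.map s).prod = w ∧ ∀ l' : List (Fin n), (l'.map s).prod = w → l.length ≤ l'.length

theorem exists_word {n : ℕ} (w : weylGroup n) : ∃ l : List (Fin n), (l.map s).prod = w := by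
  have hinv : ∀ i : Fin n, (simpleReflection i)⁻¹ = simpleReflection i := fun i => by
    rw [inv_eq_iff_mul_eq_one]
    ext1 h
    exact Module.involutive_reflection (simpleRoot_coroot i) h
  suffices h : ∀ g ∈ weylGroup n, ∃ l : List (Fin n), (l.map simpleReflection).prod = g by
    obtain ⟨l, hl⟩ := h w.1 w.2
    refine ⟨l, Subtype.ext ?_⟩
    rw [← hl, ← Subgroup.coe_subtype, map_list_prod, List.map_map]
    rfl
  intro g hg
  induction hg using Subgroup.closure_induction with
  | mem g hg => obtain ⟨i, rfl⟩ := hg; exact ⟨[i], by simp⟩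
  | one => exact ⟨[], rfl⟩
  | mul a b _ _ ha hb =>
    obtain ⟨l, rfl⟩ := ha
    obtain ⟨l', rfl⟩ := hb
    exact ⟨l ++ l', by simp⟩
  | inv a _ ha =>
    obtain ⟨l, rfl⟩ := ha
    refine ⟨l.reverse, ?_⟩
    rw [List.prod_inv_reverse, List.map_map, List.map_reverse]
    exact congrArg (fun m => (List.reverse m).prod) (List.map_congr_left fun i _ => (hinv i).symm)

theorem exists_reducedWord {n : ℕ} (w : weylGroup n) :
    ∃ l : List (Fin n), IsReducedWord l w := by
  classical
  have h : ∃ m : ℕ, ∃ l : List (Fin n), (l.map s).prod = w ∧ l.length = m := by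
    obtain ⟨l, hl⟩ := exists_word w
    exact ⟨_, l, hl, rfl⟩
  obtain ⟨l, hl, hm⟩ := Nat.find_spec h
  exact ⟨l, hl, fun l' hl' => hm ▸ Nat.find_min' h ⟨l', hl', rfl⟩⟩

/-- A reduced word of `w`. -/
def reducedWord {n : ℕ} (w : weylGroup n) : List (Fin n) := (exists_reducedWord w).choose

/-- The length `ℓ(w)` of a Weyl group element. -/
def length {n : ℕ} (w : weylGroup n) : ℕ := (reducedWord w).length

/-- The longest element of the Weyl group. -/
def IsLongest {n : ℕ} (w : weylGroup n) : Prop := ∀ w' : weylGroup n, length w' ≤ length w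

/-- The representative `\bar w = \bar s_{i₁} ⋯ \bar s_{i_l}` of `w`, for a reduced word
`i₁ … i_l` of `w`. -/
def lift {n : ℕ} (w : weylGroup n) : G n := ((reducedWord w).map sBar).prod

/-! ### Generalized minors -/

/-- Regular functions on the closed subgroup `G` of the special linear group: the polynomials in
the matrix entries. -/
def IsRegular {n : ℕ} (F : G n → ℂ) : Prop :=
  ∃ P : MvPolynomial (Idx n × Idx n) ℂ,
    ∀ g : G n, F g = MvPolynomial.eval (fun p => (g : (Matrix (Idx n) (Idx n) ℂ)ˣ).val p.1 p.2) P

/-- `F` is the principal minor `Δ_μ` of the dominant weight `μ = ∑ μ_i Λ_i`: the regular function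
on `G` with `Δ_μ(u⁻ t u⁺) = μ(t)` for `u^± ∈ U^±` and `t ∈ T`.  Here
`μ(∏ α_i^∨(a_i)) = ∏ a_i ^ μ_i`, because `Λ_j(h_i) = δ_{i j}`. -/
def IsPrincipalMinor {n : ℕ} (μ : Fin n → ℕ) (F : G n → ℂ) : Prop :=
  IsRegular F ∧
    ∀ u ∈ Uminus n, ∀ a : Fin n → ℂˣ, ∀ u' ∈ Uplus n,
      F (u * torus a * u') = ∏ i, (a i : ℂ) ^ μ i

/-- The principal minor `Δ_μ`. -/
def principalMinor {n : ℕ} (μ : Fin n → ℕ) : G n → ℂ := Classical.epsilon (IsPrincipalMinor μ)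

/-- The generalized minor `Δ_{uμ, vμ}(g) = Δ_μ(\bar u⁻¹ g \bar v)`. -/
def generalizedMinor {n : ℕ} (μ : Fin n → ℕ) (u v : weylGroup n) (g : G n) : ℂ :=
  principalMinor μ ((lift u)⁻¹ * g * lift v)

/-- The fundamental weight `Λ_k`. -/
def fundamentalWeight {n : ℕ} (k : Fin n) : Fin n → ℕ := Pi.single k 1

/-! ### The parametrisation -/

/-- `𝐲_i(c) = y_i(c) α_i^∨(c⁻¹)`. -/
def yBold {n : ℕ} (i : Fin n) (c : ℂ) : G n := y i c * alphaCheck i c⁻¹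

/-- `Θ⁻_𝐢(c₁, …, c_N) = 𝐲_{i₁}(c₁) ⋯ 𝐲_{i_N}(c_N)`, for a word `𝐢 = i₁ … i_N`. -/
def thetaMinus {n : ℕ} (word : List (Fin n)) (c : List ℂ) : G n := (List.zipWith yBold word c).prod

/-- The word `𝐢₀ = (1 2 … n)^{n-1}`. -/
def cyclicWord (n : ℕ) : List (Fin n) := (List.replicate (n - 1) (List.finRange n)).flatten

/-- The list `(c^{(1)}_1, …, c^{(1)}_n, c^{(2)}_1, …, c^{(n-1)}_n)`, where `c l i` stands
for `c^{(l)}_i`. -/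
def cyclicParams (n : ℕ) (c : ℕ → ℕ → ℂ) : List ℂ :=
  (List.range (n - 1)).flatMap fun l => (List.range n).map fun i => c (l + 1) (i + 1)

end TypeD

end

/-!
In `ε`-coordinates the word `1 2 ⋯ n` rotates the first `n - 1` coordinates and changes the sign of
two, so its `(n - 1)`-st power makes every positive root negative on `ρ`. Its length is the number
`n (n - 1)` of positive roots, hence it is a reduced word of `w₀`.

A principal minor is unique because a regular function that vanishes on the big cell `U⁻ T U⁺`
vanishes on `G`: the curve `t ↦ g y_i(t)` through a point `g` of the cell leaves the cell only for
finitely many `t`. It exists as a determinant: `Δ_{Λ_k}` is the `k × k` minor of the vector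
representation on `v_1, …, v_k` for `k ≤ n - 2`, and for a spin weight it is the matrix coefficient
of a highest weight vector. Up to a sign which counts roots, the representative of a Weyl group
element permutes the weight basis, so `Δ_{w₀Λ_k, s_kΛ_k}` is a determinant as well, with rows
`v̄_1, …, v̄_k` and columns `v_1, …, v_{k-1}, v_{k+1}`.

Write `Θ⁻` as a product of `n - 1` blocks. The coordinates at `v̄_a` and `v̄_{a+1}` of the image of
a vector under a block differ, after scaling, by a coordinate of the vector itself. Row operations
with this relation remove the first block, the first row and the first column from the determinant.
What is left after `k - 1` steps is a single coordinate: that at `v̄_1` of the image of `v_{k+1}`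
under the blocks `k, …, n - 1`. In the spin representation, each further block lowers by two the
height below which the image vanishes; its coordinate at a sign vector of the new least height
equals the previous one, and the last block gives the value.
-/

noncomputable section

namespace TypeD

open Matrix

variable {n : ℕ}

/-! ### Simple roots and weights in `ε`-coordinates -/

/-- The index with coefficient `1` in `α_i = ε_i - ε_{i+1}` (`i < n`), and `n - 1` for
`α_n = ε_{n-1} + ε_n`. -/
def rootFst (i : Fin n) : Fin n :=
  ⟨if i.val + 1 = n then i.val - 1 else i.val, by split_ifs <;> omega⟩

/-- The index other than `rootFst i` in the support of `α_i`. -/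
def rootSnd (i : Fin n) : Fin n :=
  ⟨if i.val + 1 = n then i.val else i.val + 1, by split_ifs <;> omega⟩

/-- The coefficient of `ε_{rootSnd i}` in `α_i`. -/
def rootSign (i : Fin n) : ℤ := if i.val + 1 = n then 1 else -1

/-- The simple root `α_i` in `ε`-coordinates. As the roots have square length `2`, this is
also the simple coroot `α_i^∨`. -/
def epsRoot (i : Fin n) : Fin n → ℤ :=
  Pi.single (rootFst i) 1 + Pi.single (rootSnd i) (rootSign i)

/-- Twice the weight of a basis vector, in `ε`-coordinates. The factor makes the weights of the
spin modules integral. -/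
def doubleWeight : Idx n → Fin n → ℤ
  | .inl (.inl a) => Pi.single a 2
  | .inl (.inr a) => Pi.single a (-2)
  | .inr b => fun j => if b j then 1 else -1

theorem rootFst_val (i : Fin n) :
    (rootFst i).val = if i.val + 1 = n then i.val - 1 else i.val := rfl

theorem rootSnd_val (i : Fin n) :
    (rootSnd i).val = if i.val + 1 = n then i.val else i.val + 1 := rfl

theorem rootFst_of_succ {i j : Fin n} (hj : j.val = i.val + 1) : rootFst i = i :=
  Fin.ext (if_neg (by omega))

theorem rootSnd_of_succ {i j : Fin n} (hj : j.val = i.val + 1) : rootSnd i = j :=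
  Fin.ext ((if_neg (by omega)).trans hj.symm)

theorem rootSign_of_succ {i j : Fin n} (hj : j.val = i.val + 1) : rootSign i = -1 :=
  if_neg (by omega)

theorem rootFst_of_last {i j : Fin n} (hi : i.val + 1 = n) (hj : j.val + 1 = i.val) :
    rootFst i = j :=
  Fin.ext ((if_pos hi).trans (by omega))

theorem rootSnd_of_last {i : Fin n} (hi : i.val + 1 = n) : rootSnd i = i :=
  Fin.ext (if_pos hi)

theorem rootSign_of_last {i : Fin n} (hi : i.val + 1 = n) : rootSign i = 1 := if_pos hi

theorem node_cases (hn : 3 ≤ n) (i : Fin n) :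
    (∃ j : Fin n, j.val = i.val + 1) ∨ (i.val + 1 = n ∧ ∃ j : Fin n, j.val + 1 = i.val) := by
  by_cases hi : i.val + 1 = n
  · exact .inr ⟨hi, ⟨i.val - 1, by omega⟩, by simp only; omega⟩
  · exact .inl ⟨⟨i.val + 1, by omega⟩, rfl⟩

theorem epsRoot_of_succ {i j : Fin n} (hj : j.val = i.val + 1) :
    epsRoot i = Pi.single i 1 - Pi.single j 1 := by
  rw [epsRoot, rootFst_of_succ hj, rootSnd_of_succ hj, rootSign_of_succ hj, Pi.single_neg,
    sub_eq_add_neg]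

theorem epsRoot_of_last {i j : Fin n} (hi : i.val + 1 = n) (hj : j.val + 1 = i.val) :
    epsRoot i = Pi.single j 1 + Pi.single i 1 := by
  rw [epsRoot, rootFst_of_last hi hj, rootSnd_of_last hi, rootSign_of_last hi]

theorem rootSign_eq_or (i : Fin n) : rootSign i = 1 ∨ rootSign i = -1 := by
  unfold rootSign; split_ifs <;> simp

theorem rootSign_mul_self (i : Fin n) : rootSign i * rootSign i = 1 := by
  rcases rootSign_eq_or i with h | h <;> rw [h] <;> rfl

theorem rootFst_lt_rootSnd (hn : 3 ≤ n) (i : Fin n) : rootFst i < rootSnd i := by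
  rw [Fin.lt_def, rootFst_val, rootSnd_val]; split_ifs <;> omega

theorem epsRoot_dot (i : Fin n) (v : Fin n → ℤ) :
    epsRoot i ⬝ᵥ v = v (rootFst i) + rootSign i * v (rootSnd i) := by
  simp [epsRoot, add_dotProduct]

theorem epsRoot_rootFst (hn : 3 ≤ n) (i : Fin n) : epsRoot i (rootFst i) = 1 := by
  simp [epsRoot, Pi.single_eq_of_ne (rootFst_lt_rootSnd hn i).ne]

theorem epsRoot_rootSnd (hn : 3 ≤ n) (i : Fin n) : epsRoot i (rootSnd i) = rootSign i := by
  simp [epsRoot, Pi.single_eq_of_ne (rootFst_lt_rootSnd hn i).ne']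

theorem epsRoot_of_ne {i j : Fin n} (h₁ : j ≠ rootFst i) (h₂ : j ≠ rootSnd i) :
    epsRoot i j = 0 := by
  simp [epsRoot, Pi.single_eq_of_ne h₁, Pi.single_eq_of_ne h₂]

theorem epsRoot_dot_self (hn : 3 ≤ n) (i : Fin n) : epsRoot i ⬝ᵥ epsRoot i = 2 := by
  rw [epsRoot_dot, epsRoot_rootFst hn, epsRoot_rootSnd hn, rootSign_mul_self]; rfl

theorem cartanMatrix_eq_epsRoot_dot (hn : 3 ≤ n) (i j : Fin n) :
    CartanMatrix.D n i j = epsRoot i ⬝ᵥ epsRoot j := by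
  have hi := i.2
  have hj := j.2
  rw [epsRoot_dot]
  simp only [CartanMatrix.D, epsRoot, Matrix.of_apply, Pi.add_apply, Pi.single_apply,
    Fin.ext_iff, rootFst_val, rootSnd_val, rootSign]
  by_cases h₁ : i.val + 1 = n <;> by_cases h₂ : j.val + 1 = n <;>
    simp only [h₁, h₂, if_true, if_false, or_true, or_false, and_true] <;> split_ifs <;> omega

theorem epsRoot_dot_of_ne (hn : 3 ≤ n) {i j : Fin n} (h : i ≠ j) :
    epsRoot i ⬝ᵥ epsRoot j = 0 ∨ epsRoot i ⬝ᵥ epsRoot j = -1 := by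
  rw [← cartanMatrix_eq_epsRoot_dot hn]
  simp only [CartanMatrix.D, Matrix.of_apply, h, if_false]
  split_ifs <;> simp

/-! ### The crystal of the module -/

theorem doubleWeight_injective : Function.Injective (doubleWeight : Idx n → Fin n → ℤ) := by
  have vec_ne_spin (i : Fin n) {z : ℤ} (hz : z = 2 ∨ z = -2) (c : SpinIdx n) :
      (Pi.single i z : Fin n → ℤ) ≠ fun j => if c j then 1 else -1 := by
    intro h
    have := congrFun h i
    simp only [Pi.single_eq_same] at this
    split_ifs at this <;> omega
  have single_inj {i j : Fin n} {z w : ℤ} (hz : z ≠ 0)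
      (h : (Pi.single i z : Fin n → ℤ) = Pi.single j w) : i = j ∧ z = w := by
    have := congrFun h i
    simp only [Pi.single_eq_same, Pi.single_apply] at this
    split_ifs at this with hij
    exacts [⟨hij, this⟩, absurd this hz]
  rintro ((a | a) | a) ((b | b) | b) h <;> simp only [doubleWeight] at h
  · rw [(single_inj (by norm_num) h).1]
  · exact absurd (single_inj (by norm_num) h).2 (by norm_num)
  · exact absurd h (vec_ne_spin _ (by simp) _)
  · exact absurd (single_inj (by norm_num) h).2 (by norm_num)
  · rw [(single_inj (by norm_num) h).1]
  · exact absurd h (vec_ne_spin _ (by simp) _)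
  · exact absurd h.symm (vec_ne_spin _ (by simp) _)
  · exact absurd h.symm (vec_ne_spin _ (by simp) _)
  · congr 1
    funext j
    have := congrFun h j
    cases ha : a j <;> cases hb : b j <;> simp [ha, hb] at this ⊢

theorem VecRaise.doubleWeight_eq {i : Fin n} {b a : VecIdx n} (h : VecRaise i b a) :
    doubleWeight (.inl a) = doubleWeight (.inl b) + (2 : ℤ) • epsRoot i := by
  rcases b with b | b <;> rcases a with a | a
  · obtain ⟨rfl, hb⟩ := h
    simp [doubleWeight, epsRoot_of_succ hb, smul_sub, ← Pi.single_smul]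
  · exact h.elim
  · obtain ⟨hi, ⟨hb, rfl⟩ | ⟨rfl, ha⟩⟩ := h
    · simp [doubleWeight, epsRoot_of_last hi hb, Pi.single_neg, ← Pi.single_smul]
    · simp [doubleWeight, epsRoot_of_last hi ha, Pi.single_neg, ← Pi.single_smul, add_comm]
  · obtain ⟨rfl, ha⟩ := h
    simp only [doubleWeight, epsRoot_of_succ ha, Pi.single_neg, smul_sub, ← Pi.single_smul,
      smul_eq_mul, mul_one]
    abel

theorem SpinRaise.doubleWeight_eq {i : Fin n} {b a : SpinIdx n} (h : SpinRaise i b a) :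
    doubleWeight (.inr a) = doubleWeight (.inr b) + (2 : ℤ) • epsRoot i := by
  funext k
  rcases h with ⟨j, hj, hbi, hbj, rfl⟩ | ⟨hi, j, hj, hbj, hbi, rfl⟩
  · have hij : i ≠ j := fun h => by rw [h] at hj; omega
    simp only [doubleWeight, epsRoot_of_succ hj, Pi.add_apply, Pi.smul_apply, Pi.sub_apply,
      Pi.single_apply, Function.update_apply, smul_eq_mul]
    rcases eq_or_ne k j with rfl | hkj
    · simp [hbj, hij.symm]
    · rcases eq_or_ne k i with rfl | hki
      · simp [hbi, hij]
      · simp [hkj, hki]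
  · have hij : i ≠ j := fun h => by rw [h] at hj; omega
    simp only [doubleWeight, epsRoot_of_last hi hj, Pi.add_apply, Pi.smul_apply,
      Pi.single_apply, Function.update_apply, smul_eq_mul]
    rcases eq_or_ne k j with rfl | hkj
    · simp [hbj, hij.symm]
    · rcases eq_or_ne k i with rfl | hki
      · simp [hbi, hij]
      · simp [hkj, hki]

theorem Raise.doubleWeight_eq {i : Fin n} {b a : Idx n} (h : Raise i b a) :
    doubleWeight a = doubleWeight b + (2 : ℤ) • epsRoot i := by
  rcases b with b | b <;> rcases a with a | a
  · exact VecRaise.doubleWeight_eq h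
  · exact h.elim
  · exact h.elim
  · exact SpinRaise.doubleWeight_eq h

/-- The pairing of the weight of a basis vector with `α_i^∨`; the division by `2` is exact. -/
def corootPairing (i : Fin n) (b : Idx n) : ℤ := (epsRoot i ⬝ᵥ doubleWeight b) / 2

theorem epsRoot_dot_doubleWeight_cases (hn : 3 ≤ n) (i : Fin n) (b : Idx n) :
    epsRoot i ⬝ᵥ doubleWeight b = -2 ∨ epsRoot i ⬝ᵥ doubleWeight b = 0 ∨
      epsRoot i ⬝ᵥ doubleWeight b = 2 := by
  rw [epsRoot_dot]
  have hne := (rootFst_lt_rootSnd hn i).ne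
  rcases b with (b | b) | b <;> rcases rootSign_eq_or i with h | h <;> rw [h] <;>
    simp only [doubleWeight, Pi.single_apply] <;> split_ifs <;> simp_all

theorem corootPairing_cases (hn : 3 ≤ n) (i : Fin n) (b : Idx n) :
    corootPairing i b = -1 ∨ corootPairing i b = 0 ∨ corootPairing i b = 1 := by
  unfold corootPairing
  rcases epsRoot_dot_doubleWeight_cases hn i b with h | h | h <;> rw [h] <;> norm_num

theorem epsRoot_dot_doubleWeight (hn : 3 ≤ n) (i : Fin n) (b : Idx n) :
    epsRoot i ⬝ᵥ doubleWeight b = 2 * corootPairing i b := by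
  unfold corootPairing
  rcases epsRoot_dot_doubleWeight_cases hn i b with h | h | h <;> rw [h] <;> norm_num

theorem Raise.corootPairing_eq (hn : 3 ≤ n) {i : Fin n} {b a : Idx n} (h : Raise i b a)
    (j : Fin n) : corootPairing j a = corootPairing j b + epsRoot j ⬝ᵥ epsRoot i := by
  have h₁ := congrArg (epsRoot j ⬝ᵥ ·) h.doubleWeight_eq
  simp only [dotProduct_add, dotProduct_smul, epsRoot_dot_doubleWeight hn, smul_eq_mul] at h₁
  omega

theorem Raise.corootPairing_left (hn : 3 ≤ n) {i : Fin n} {b a : Idx n} (h : Raise i b a) :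
    corootPairing i b = -1 := by
  have h₁ := h.corootPairing_eq hn i
  rw [epsRoot_dot_self hn] at h₁
  have h₂ := corootPairing_cases hn i a
  have h₃ := corootPairing_cases hn i b
  omega

theorem Raise.corootPairing_right (hn : 3 ≤ n) {i : Fin n} {b a : Idx n} (h : Raise i b a) :
    corootPairing i a = 1 := by
  rw [h.corootPairing_eq hn i, epsRoot_dot_self hn, h.corootPairing_left hn]; rfl

theorem Raise.right_unique {i : Fin n} {b a a' : Idx n} (h : Raise i b a) (h' : Raise i b a') :
    a = a' :=
  doubleWeight_injective (by rw [h.doubleWeight_eq, h'.doubleWeight_eq])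

theorem Raise.left_unique {i : Fin n} {b b' a : Idx n} (h : Raise i b a) (h' : Raise i b' a) :
    b = b' :=
  doubleWeight_injective (add_right_cancel (h.doubleWeight_eq.symm.trans h'.doubleWeight_eq))

theorem exists_raise_of_succ {i j : Fin n} (hj : j.val = i.val + 1) {b : Idx n}
    (h : doubleWeight b i - doubleWeight b j = -2) : ∃ a, Raise i b a := by
  have hij : i ≠ j := fun h => by rw [h] at hj; omega
  rcases b with (b | b) | b
  · rcases eq_or_ne b j with rfl | hbj
    · exact ⟨.inl (.inl i), rfl, hj⟩
    · rcases eq_or_ne b i with rfl | hbi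
      · simp [doubleWeight, hij.symm] at h
      · simp [doubleWeight, hbj.symm, hbi.symm] at h
  · rcases eq_or_ne b i with rfl | hbi
    · exact ⟨.inl (.inr j), rfl, hj⟩
    · rcases eq_or_ne b j with rfl | hbj
      · simp [doubleWeight, hij] at h
      · simp [doubleWeight, hbj.symm, hbi.symm] at h
  · refine ⟨.inr (Function.update (Function.update b i true) j false),
      .inl ⟨j, hj, ?_, ?_, rfl⟩⟩ <;>
    · cases hbi : b i <;> cases hbj : b j <;> simp [doubleWeight, hbi, hbj] at h ⊢

theorem exists_raise_of_last {i j : Fin n} (hi : i.val + 1 = n) (hj : j.val + 1 = i.val)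
    {b : Idx n} (h : doubleWeight b j + doubleWeight b i = -2) : ∃ a, Raise i b a := by
  rcases b with (b | b) | b
  · simp only [doubleWeight, Pi.single_apply] at h
    split_ifs at h <;> omega
  · rcases eq_or_ne b i with rfl | hbi
    · exact ⟨.inl (.inl j), hi, .inr ⟨rfl, hj⟩⟩
    · rcases eq_or_ne b j with rfl | hbj
      · exact ⟨.inl (.inl i), hi, .inl ⟨hj, rfl⟩⟩
      · simp [doubleWeight, hbj.symm, hbi.symm] at h
  · refine ⟨.inr (Function.update (Function.update b j true) i true),
      .inr ⟨hi, j, hj, ?_, ?_, rfl⟩⟩ <;>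
    · cases hbi : b i <;> cases hbj : b j <;> simp [doubleWeight, hbi, hbj] at h ⊢

theorem exists_raise (hn : 3 ≤ n) {i : Fin n} {b : Idx n} (h : corootPairing i b = -1) :
    ∃ a, Raise i b a := by
  have h₁ := epsRoot_dot_doubleWeight hn i b
  rw [h, epsRoot_dot] at h₁
  rcases node_cases hn i with ⟨j, hj⟩ | ⟨hi, j, hj⟩
  · rw [rootFst_of_succ hj, rootSnd_of_succ hj, rootSign_of_succ hj] at h₁
    exact exists_raise_of_succ hj (by linarith)
  · rw [rootFst_of_last hi hj, rootSnd_of_last hi, rootSign_of_last hi] at h₁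
    exact exists_raise_of_last hi hj (by linarith)

theorem raise_iff_doubleWeight (hn : 3 ≤ n) {i : Fin n} {b a : Idx n} :
    Raise i b a ↔ doubleWeight a = doubleWeight b + (2 : ℤ) • epsRoot i := by
  refine ⟨fun h => h.doubleWeight_eq, fun h => ?_⟩
  have h₁ := congrArg (epsRoot i ⬝ᵥ ·) h
  simp only [dotProduct_add, dotProduct_smul, epsRoot_dot_doubleWeight hn, smul_eq_mul,
    epsRoot_dot_self hn] at h₁
  have h₂ := corootPairing_cases hn i a
  have h₃ := corootPairing_cases hn i b
  obtain ⟨c, hc⟩ := exists_raise hn (i := i) (b := b) (by omega)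
  rwa [doubleWeight_injective (h.trans hc.doubleWeight_eq.symm)]

/-- The basis vector of opposite weight. -/
def Idx.neg : Idx n → Idx n
  | .inl (.inl a) => .inl (.inr a)
  | .inl (.inr a) => .inl (.inl a)
  | .inr b => .inr fun j => !b j

theorem doubleWeight_neg (b : Idx n) : doubleWeight b.neg = -doubleWeight b := by
  funext j
  rcases b with (b | b) | b <;> simp [Idx.neg, doubleWeight, Pi.single_apply] <;> split_ifs <;>
    simp_all

theorem corootPairing_neg (hn : 3 ≤ n) (i : Fin n) (b : Idx n) :
    corootPairing i b.neg = -corootPairing i b := by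
  have h := epsRoot_dot_doubleWeight hn i b.neg
  rw [doubleWeight_neg, dotProduct_neg, epsRoot_dot_doubleWeight hn] at h
  omega

theorem exists_lower (hn : 3 ≤ n) {i : Fin n} {b : Idx n} (h : corootPairing i b = 1) :
    ∃ c, Raise i c b := by
  obtain ⟨a, ha⟩ := exists_raise hn (i := i) (b := b.neg) (by rw [corootPairing_neg hn, h])
  refine ⟨a.neg, (raise_iff_doubleWeight hn).2 ?_⟩
  rw [doubleWeight_neg, ha.doubleWeight_eq, doubleWeight_neg]
  abel

theorem raise_cases (hn : 3 ≤ n) (i : Fin n) (b : Idx n) :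
    (∃ a, Raise i b a) ∨ (∃ c, Raise i c b) ∨ corootPairing i b = 0 := by
  rcases corootPairing_cases hn i b with h | h | h
  · exact .inl (exists_raise hn h)
  · exact .inr (.inr h)
  · exact .inr (.inl (exists_lower hn h))

theorem exists_raise_raise_of_lower (hn : 3 ≤ n) {i j : Fin n} (hij : i ≠ j) {a b c : Idx n}
    (ha : Raise i c a) (hb : Raise j c b) : ∃ d, Raise j a d ∧ Raise i b d := by
  have hpair : corootPairing j a = -1 := by
    have h₁ := ha.corootPairing_eq hn j
    have h₂ := hb.corootPairing_left hn
    have h₃ := corootPairing_cases hn j a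
    have h₄ := epsRoot_dot_of_ne hn hij.symm
    omega
  obtain ⟨d, hd⟩ := exists_raise hn hpair
  refine ⟨d, hd, (raise_iff_doubleWeight hn).2 ?_⟩
  rw [hd.doubleWeight_eq, ha.doubleWeight_eq, hb.doubleWeight_eq]
  abel

theorem exists_lower_lower_of_raise (hn : 3 ≤ n) {i j : Fin n} (hij : i ≠ j) {a b d : Idx n}
    (ha : Raise j a d) (hb : Raise i b d) : ∃ c, Raise i c a ∧ Raise j c b := by
  have hpair : corootPairing i a = 1 := by
    have h₁ := ha.corootPairing_eq hn i
    have h₂ := hb.corootPairing_right hn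
    have h₃ := corootPairing_cases hn i a
    have h₄ := epsRoot_dot_of_ne hn hij
    omega
  obtain ⟨c, hc⟩ := exists_lower hn hpair
  refine ⟨c, hc, (raise_iff_doubleWeight hn).2 ?_⟩
  rw [← add_left_inj ((2 : ℤ) • epsRoot i), ← hb.doubleWeight_eq, ha.doubleWeight_eq,
    hc.doubleWeight_eq]
  abel

/-! ### The action on the module -/

/-- The action of `G` on the module, in coordinates. -/
def act (g : G n) (φ : Idx n → ℂ) : Idx n → ℂ := (g : (Matrix (Idx n) (Idx n) ℂ)ˣ).val *ᵥ φ

theorem act_mul (g h : G n) (φ : Idx n → ℂ) : act (g * h) φ = act g (act h φ) := by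
  simp [act, mulVec_mulVec]

theorem act_one (φ : Idx n → ℂ) : act 1 φ = φ := by simp [act]

theorem act_single (g : G n) (a b : Idx n) :
    act g (Pi.single b 1) a = (g : (Matrix (Idx n) (Idx n) ℂ)ˣ).val a b := by
  simp [act]

theorem ext_act {g h : G n} (H : ∀ φ a, act g φ a = act h φ a) : g = h := by
  refine Subtype.ext (Units.ext ?_)
  ext a b
  rw [← act_single, ← act_single, H]

theorem e_mulVec_of_raise {i : Fin n} {b a : Idx n} (h : Raise i b a) (φ : Idx n → ℂ) :
    (e i *ᵥ φ) a = φ b := by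
  rw [mulVec, dotProduct, Finset.sum_eq_single b]
  · simp [e, h]
  · intro c _ hc
    simp only [e, of_apply]
    rw [if_neg fun h' => hc (h'.left_unique h), zero_mul]
  · simp

theorem e_mulVec_of_not_raise {i : Fin n} {a : Idx n} (h : ∀ b, ¬Raise i b a) (φ : Idx n → ℂ) :
    (e i *ᵥ φ) a = 0 :=
  Finset.sum_eq_zero fun b _ => by simp [e, h b]

theorem f_mulVec_of_raise {i : Fin n} {b a : Idx n} (h : Raise i b a) (φ : Idx n → ℂ) :
    (f i *ᵥ φ) b = φ a := by
  rw [mulVec, dotProduct, Finset.sum_eq_single a]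
  · simp [f, h]
  · intro c _ hc
    simp only [f, of_apply]
    rw [if_neg fun h' => hc (h'.right_unique h), zero_mul]
  · simp

theorem f_mulVec_of_not_raise {i : Fin n} {b : Idx n} (h : ∀ a, ¬Raise i b a) (φ : Idx n → ℂ) :
    (f i *ᵥ φ) b = 0 :=
  Finset.sum_eq_zero fun a _ => by simp [f, h a]

theorem act_x (i : Fin n) (t : ℂ) (φ : Idx n → ℂ) (a : Idx n) :
    act (x i t) φ a = φ a + t * (e i *ᵥ φ) a := by
  simp [act, x, expUnit, add_mulVec, smul_mulVec]

theorem act_y (i : Fin n) (t : ℂ) (φ : Idx n → ℂ) (a : Idx n) :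
    act (y i t) φ a = φ a + t * (f i *ᵥ φ) a := by
  simp [act, y, expUnit, add_mulVec, smul_mulVec]

theorem act_x_right {i : Fin n} {b a : Idx n} (h : Raise i b a) (t : ℂ) (φ : Idx n → ℂ) :
    act (x i t) φ a = φ a + t * φ b := by
  rw [act_x, e_mulVec_of_raise h]

theorem act_x_of_ne (hn : 3 ≤ n) {i : Fin n} {a : Idx n} (h : corootPairing i a ≠ 1) (t : ℂ)
    (φ : Idx n → ℂ) : act (x i t) φ a = φ a := by
  rw [act_x, e_mulVec_of_not_raise fun b hb => h (hb.corootPairing_right hn), mul_zero, add_zero]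

theorem act_x_left (hn : 3 ≤ n) {i : Fin n} {b a : Idx n} (h : Raise i b a) (t : ℂ)
    (φ : Idx n → ℂ) : act (x i t) φ b = φ b :=
  act_x_of_ne hn (by rw [h.corootPairing_left hn]; decide) t φ

theorem act_x_of_zero (hn : 3 ≤ n) {i : Fin n} {a : Idx n} (h : corootPairing i a = 0) (t : ℂ)
    (φ : Idx n → ℂ) : act (x i t) φ a = φ a :=
  act_x_of_ne hn (by rw [h]; decide) t φ

theorem act_y_left {i : Fin n} {b a : Idx n} (h : Raise i b a) (t : ℂ) (φ : Idx n → ℂ) :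
    act (y i t) φ b = φ b + t * φ a := by
  rw [act_y, f_mulVec_of_raise h]

theorem act_y_of_ne (hn : 3 ≤ n) {i : Fin n} {b : Idx n} (h : corootPairing i b ≠ -1) (t : ℂ)
    (φ : Idx n → ℂ) : act (y i t) φ b = φ b := by
  rw [act_y, f_mulVec_of_not_raise fun a ha => h (ha.corootPairing_left hn), mul_zero, add_zero]

theorem act_y_right (hn : 3 ≤ n) {i : Fin n} {b a : Idx n} (h : Raise i b a) (t : ℂ)
    (φ : Idx n → ℂ) : act (y i t) φ a = φ a :=
  act_y_of_ne hn (by rw [h.corootPairing_right hn]; decide) t φ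

theorem act_y_of_zero (hn : 3 ≤ n) {i : Fin n} {a : Idx n} (h : corootPairing i a = 0) (t : ℂ)
    (φ : Idx n → ℂ) : act (y i t) φ a = φ a :=
  act_y_of_ne hn (by rw [h]; decide) t φ

theorem act_sBar_left (hn : 3 ≤ n) {i : Fin n} {b a : Idx n} (h : Raise i b a) (φ : Idx n → ℂ) :
    act (sBar i) φ b = φ a := by
  simp only [sBar, act_mul, act_x_left hn h, act_x_right h, act_y_left h]
  ring

theorem act_sBar_right (hn : 3 ≤ n) {i : Fin n} {b a : Idx n} (h : Raise i b a)
    (φ : Idx n → ℂ) : act (sBar i) φ a = -φ b := by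
  simp only [sBar, act_mul, act_x_left hn h, act_x_right h, act_y_left h, act_y_right hn h]
  ring

theorem act_sBar_of_zero (hn : 3 ≤ n) {i : Fin n} {a : Idx n} (h : corootPairing i a = 0)
    (φ : Idx n → ℂ) : act (sBar i) φ a = φ a := by
  simp only [sBar, act_mul, act_x_of_zero hn h, act_y_of_zero hn h]

theorem act_alphaCheck (hn : 3 ≤ n) (i : Fin n) {c : ℂ} (hc : c ≠ 0) (φ : Idx n → ℂ)
    (a : Idx n) : act (alphaCheck i c) φ a = c ^ corootPairing i a * φ a := by
  rcases raise_cases hn i a with ⟨b, h⟩ | ⟨b, h⟩ | h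
  · simp only [alphaCheck, act_mul, act_x_left hn h, act_x_right h, act_y_left h,
      act_sBar_left hn h, act_sBar_right hn h, h.corootPairing_left hn, _root_.zpow_neg_one]
    field_simp
    ring
  · simp only [alphaCheck, act_mul, act_x_left hn h, act_x_right h, act_y_left h,
      act_y_right hn h, act_sBar_left hn h, act_sBar_right hn h, h.corootPairing_right hn,
      zpow_one]
    field_simp
    ring
  · simp only [alphaCheck, act_mul, act_x_of_zero hn h, act_y_of_zero hn h,
      act_sBar_of_zero hn h, h, zpow_zero, one_mul]

theorem act_yBold_left (hn : 3 ≤ n) {i : Fin n} {b a : Idx n} (h : Raise i b a) {c : ℂ}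
    (hc : c ≠ 0) (φ : Idx n → ℂ) : act (yBold i c) φ b = c * φ b + φ a := by
  rw [yBold, act_mul, act_y_left h, act_alphaCheck hn i (inv_ne_zero hc),
    act_alphaCheck hn i (inv_ne_zero hc), h.corootPairing_left hn, h.corootPairing_right hn,
    _root_.zpow_neg_one, zpow_one, inv_inv, mul_inv_cancel_left₀ hc]

theorem act_yBold_of_ne (hn : 3 ≤ n) {i : Fin n} {b : Idx n} (h : corootPairing i b ≠ -1) {c : ℂ}
    (hc : c ≠ 0) (φ : Idx n → ℂ) :
    act (yBold i c) φ b = c⁻¹ ^ corootPairing i b * φ b := by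
  rw [yBold, act_mul, act_y_of_ne hn h, act_alphaCheck hn i (inv_ne_zero hc)]

/-! ### The torus and the root subgroups -/

theorem act_prod_alphaCheck (hn : 3 ≤ n) (a : Fin n → ℂˣ) (φ : Idx n → ℂ) (b : Idx n)
    (l : List (Fin n)) : act (l.map fun i => alphaCheck i (a i : ℂ)).prod φ b =
      (l.map fun i => (a i : ℂ) ^ corootPairing i b).prod * φ b := by
  induction l with
  | nil => simp [act_one]
  | cons i l ih =>
    rw [List.map_cons, List.prod_cons, act_mul, act_alphaCheck hn i (a i).ne_zero, ih,
      List.map_cons, List.prod_cons, mul_assoc]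

theorem act_torus (hn : 3 ≤ n) (a : Fin n → ℂˣ) (φ : Idx n → ℂ) (b : Idx n) :
    act (torus a) φ b = (∏ i, (a i : ℂ) ^ corootPairing i b) * φ b := by
  rw [torus, List.ofFn_eq_map, act_prod_alphaCheck hn, ← List.ofFn_eq_map, List.prod_ofFn]

theorem torus_mul (hn : 3 ≤ n) (a b : Fin n → ℂˣ) : torus a * torus b = torus (a * b) := by
  refine ext_act fun φ c => ?_
  rw [act_mul, act_torus hn, act_torus hn, act_torus hn, ← mul_assoc, ← Finset.prod_mul_distrib]
  simp [mul_zpow]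

theorem torus_one (hn : 3 ≤ n) : torus (1 : Fin n → ℂˣ) = 1 :=
  ext_act fun φ c => by simp [act_torus hn, act_one]

theorem alphaCheck_eq_torus (hn : 3 ≤ n) (i : Fin n) (c : ℂˣ) :
    alphaCheck i (c : ℂ) = torus (Pi.mulSingle i c) := by
  refine ext_act fun φ b => ?_
  rw [act_torus hn, act_alphaCheck hn i c.ne_zero, Finset.prod_eq_single i]
  · simp
  · intro j _ hj
    simp [Pi.mulSingle_eq_of_ne hj]
  · simp

/-- The value `∏ a_j ^ ⟨α_i, α_j^∨⟩` of the simple root `α_i` at `torus a`. -/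
def rootChar (i : Fin n) (a : Fin n → ℂˣ) : ℂ := ∏ j, (a j : ℂ) ^ (epsRoot j ⬝ᵥ epsRoot i)

theorem rootChar_ne_zero (i : Fin n) (a : Fin n → ℂˣ) : rootChar i a ≠ 0 :=
  Finset.prod_ne_zero_iff.2 fun j _ => zpow_ne_zero _ (a j).ne_zero

theorem Raise.prod_zpow_corootPairing (hn : 3 ≤ n) (a : Fin n → ℂˣ) {i : Fin n} {b c : Idx n}
    (h : Raise i b c) : (∏ j, (a j : ℂ) ^ corootPairing j c) =
      rootChar i a * ∏ j, (a j : ℂ) ^ corootPairing j b := by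
  rw [rootChar, ← Finset.prod_mul_distrib]
  refine Finset.prod_congr rfl fun j _ => ?_
  rw [h.corootPairing_eq hn j, zpow_add₀ (a j).ne_zero, mul_comm]

theorem x_mul_torus (hn : 3 ≤ n) (a : Fin n → ℂˣ) (i : Fin n) (t : ℂ) :
    x i t * torus a = torus a * x i ((rootChar i a)⁻¹ * t) := by
  have hχ := rootChar_ne_zero i a
  refine ext_act fun φ b => ?_
  rcases raise_cases hn i b with ⟨c, h⟩ | ⟨c, h⟩ | h
  · simp only [act_mul, act_torus hn, act_x_left hn h]
  · simp only [act_mul, act_torus hn, act_x_right h, h.prod_zpow_corootPairing hn a]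
    field_simp
  · simp only [act_mul, act_torus hn, act_x_of_zero hn h]

theorem torus_mul_y (hn : 3 ≤ n) (a : Fin n → ℂˣ) (i : Fin n) (t : ℂ) :
    torus a * y i t = y i ((rootChar i a)⁻¹ * t) * torus a := by
  have hχ := rootChar_ne_zero i a
  refine ext_act fun φ b => ?_
  rcases raise_cases hn i b with ⟨c, h⟩ | ⟨c, h⟩ | h
  · simp only [act_mul, act_torus hn, act_y_left h, h.prod_zpow_corootPairing hn a]
    field_simp
  · simp only [act_mul, act_torus hn, act_y_right hn h]
  · simp only [act_mul, act_torus hn, act_y_of_zero hn h]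

theorem expUnit_inv {A : Matrix (Idx n) (Idx n) ℂ} (hA : A * A = 0) (t : ℂ) :
    (expUnit A hA t)⁻¹ = expUnit A hA (-t) :=
  Units.ext (show 1 - t • A = 1 + -t • A by rw [neg_smul, sub_eq_add_neg])

theorem x_inv (i : Fin n) (t : ℂ) : (x i t)⁻¹ = x i (-t) :=
  Subtype.ext (expUnit_inv (e_mul_e i) t)

theorem y_inv (i : Fin n) (t : ℂ) : (y i t)⁻¹ = y i (-t) :=
  Subtype.ext (expUnit_inv (f_mul_f i) t)

/-- Gauss decomposition in `SL₂`. -/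
theorem x_mul_y (hn : 3 ≤ n) (i : Fin n) {s t : ℂ} (h₀ : 1 + s * t ≠ 0) :
    x i s * y i t =
      y i (t / (1 + s * t)) * alphaCheck i (1 + s * t) * x i (s / (1 + s * t)) := by
  refine ext_act fun φ b => ?_
  rcases raise_cases hn i b with ⟨c, h⟩ | ⟨c, h⟩ | h
  · simp only [act_mul, act_x_left hn h, act_x_right h, act_y_left h, act_alphaCheck hn i h₀,
      h.corootPairing_left hn, h.corootPairing_right hn, _root_.zpow_neg_one, zpow_one,
      div_eq_mul_inv]
    linear_combination -(t * φ c + φ b * t * s * (1 + s * t)⁻¹ + φ b) * mul_inv_cancel₀ h₀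
  · simp only [act_mul, act_x_right h, act_y_left h, act_y_right hn h, act_alphaCheck hn i h₀,
      h.corootPairing_right hn, zpow_one]
    field_simp
    ring
  · simp only [act_mul, act_x_of_zero hn h, act_y_of_zero hn h, act_alphaCheck hn i h₀, h,
      zpow_zero, one_mul]

theorem e_mulVec_f_mulVec (hn : 3 ≤ n) {i j : Fin n} (hij : i ≠ j) (φ : Idx n → ℂ) :
    e i *ᵥ (f j *ᵥ φ) = f j *ᵥ (e i *ᵥ φ) := by
  funext a
  by_cases hc : ∃ c b, Raise i c a ∧ Raise j c b
  · obtain ⟨c, b, hca, hcb⟩ := hc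
    obtain ⟨d, had, hbd⟩ := exists_raise_raise_of_lower hn hij hca hcb
    rw [e_mulVec_of_raise hca, f_mulVec_of_raise hcb, f_mulVec_of_raise had,
      e_mulVec_of_raise hbd]
  · have hleft : (e i *ᵥ (f j *ᵥ φ)) a = 0 := by
      by_cases h : ∃ c, Raise i c a
      · obtain ⟨c, hca⟩ := h
        rw [e_mulVec_of_raise hca, f_mulVec_of_not_raise fun b hcb => hc ⟨c, b, hca, hcb⟩]
      · exact e_mulVec_of_not_raise (not_exists.1 h) _
    have hright : (f j *ᵥ (e i *ᵥ φ)) a = 0 := by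
      by_cases h : ∃ d, Raise j a d
      · obtain ⟨d, had⟩ := h
        refine (f_mulVec_of_raise had _).trans (e_mulVec_of_not_raise (fun b hbd => hc ?_) _)
        obtain ⟨c, hca, hcb⟩ := exists_lower_lower_of_raise hn hij had hbd
        exact ⟨c, b, hca, hcb⟩
      · exact f_mulVec_of_not_raise (not_exists.1 h) _
    rw [hleft, hright]

theorem x_mul_y_of_ne (hn : 3 ≤ n) {i j : Fin n} (hij : i ≠ j) (s t : ℂ) :
    x i s * y j t = y j t * x i s := by
  have hx (φ : Idx n → ℂ) : act (x i s) φ = φ + s • (e i *ᵥ φ) := funext (act_x i s φ)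
  have hy (φ : Idx n → ℂ) : act (y j t) φ = φ + t • (f j *ᵥ φ) := funext (act_y j t φ)
  refine ext_act fun φ a => congrFun ?_ a
  rw [act_mul, act_mul, hx, hy, hx, hy, mulVec_add, mulVec_add, mulVec_smul, mulVec_smul,
    e_mulVec_f_mulVec hn hij, smul_add, smul_add, smul_comm s t]
  abel

/-! ### Regular functions and the big cell -/

theorem x_mem_Uplus (i : Fin n) (t : ℂ) : x i t ∈ Uplus n := Subgroup.subset_closure ⟨(i, t), rfl⟩

theorem y_mem_Uminus (i : Fin n) (t : ℂ) : y i t ∈ Uminus n :=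
  Subgroup.subset_closure ⟨(i, t), rfl⟩

theorem closure_x_y : Subgroup.closure
    (Set.range (fun p : Fin n × ℂ => x p.1 p.2) ∪ Set.range fun p : Fin n × ℂ => y p.1 p.2) =
      ⊤ := by
  refine Eq.trans ?_ (Subgroup.closure_closure_coe_preimage (k :=
    Set.range (fun p : Fin n × ℂ => expUnit (e p.1) (e_mul_e p.1) p.2) ∪
      Set.range (fun p : Fin n × ℂ => expUnit (f p.1) (f_mul_f p.1) p.2)))
  refine congrArg Subgroup.closure (Set.ext fun g => ?_)
  simp only [Set.mem_union, Set.mem_range]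
  exact or_congr (exists_congr fun p => ⟨fun h => h ▸ rfl, fun h => Subtype.ext h⟩)
    (exists_congr fun p => ⟨fun h => h ▸ rfl, fun h => Subtype.ext h⟩)

@[elab_as_elim]
theorem mul_x_mul_y_induction {p : G n → Prop} (one : p 1) (mul_x : ∀ g i t, p g → p (g * x i t))
    (mul_y : ∀ g i t, p g → p (g * y i t)) (g : G n) : p g := by
  have hg : g ∈ Subgroup.closure (Set.range (fun q : Fin n × ℂ => x q.1 q.2) ∪
      Set.range fun q : Fin n × ℂ => y q.1 q.2) := closure_x_y ▸ Subgroup.mem_top g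
  induction hg using Subgroup.closure_induction_right with
  | one => exact one
  | mul_right g _ s hs ih =>
    rcases hs with ⟨q, rfl⟩ | ⟨q, rfl⟩
    exacts [mul_x g _ _ ih, mul_y g _ _ ih]
  | mul_inv_cancel g _ s hs ih =>
    rcases hs with ⟨q, rfl⟩ | ⟨q, rfl⟩
    · rw [x_inv]; exact mul_x g _ _ ih
    · rw [y_inv]; exact mul_y g _ _ ih

theorem eventually_one_add_mul_ne_zero (c : ℂ) : ∀ᶠ t in Filter.cofinite, 1 + c * t ≠ 0 := by
  refine Filter.eventually_cofinite.2 (Set.Subsingleton.finite fun a ha b hb => ?_)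
  simp only [ne_eq, not_not, Set.mem_ofPred_eq] at ha hb
  have hc : c ≠ 0 := by rintro rfl; simp at ha
  exact mul_left_cancel₀ hc (add_left_cancel (ha.trans hb.symm))

theorem x_mul_y_div (hn : 3 ≤ n) (i : Fin n) {s c t : ℂ} (h : 1 + c * t ≠ 0)
    (h' : 1 + (c + s) * t ≠ 0) : ∃ a r, x i s * y i (t / (1 + c * t)) =
      y i (t / (1 + (c + s) * t)) * torus a * x i r := by
  have hsum : 1 + s * (t / (1 + c * t)) = (1 + (c + s) * t) / (1 + c * t) := by
    rw [eq_div_iff h, add_mul, mul_assoc, div_mul_cancel₀ t h]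
    ring
  have h₀ : 1 + s * (t / (1 + c * t)) ≠ 0 := by rw [hsum]; exact div_ne_zero h' h
  refine ⟨Pi.mulSingle i (Units.mk0 _ h₀), s / (1 + s * (t / (1 + c * t))), ?_⟩
  rw [← alphaCheck_eq_torus hn, x_mul_y hn i h₀, Units.val_mk0, hsum, div_div_div_cancel_right₀ h]

/-- Here `c` is the `α_i`-coordinate of `u`. -/
theorem exists_mul_y_eq (hn : 3 ≤ n) (i : Fin n) {u : G n} (hu : u ∈ Uplus n) :
    ∃ c : ℂ, ∀ᶠ t in Filter.cofinite, 1 + c * t ≠ 0 ∧ ∃ a, ∃ v ∈ Uplus n,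
      u * y i t = y i (t / (1 + c * t)) * torus a * v := by
  have mul_x (j : Fin n) (s : ℂ) (u : G n) (ih : ∃ c : ℂ, ∀ᶠ t in Filter.cofinite,
        1 + c * t ≠ 0 ∧ ∃ a, ∃ v ∈ Uplus n, u * y i t = y i (t / (1 + c * t)) * torus a * v) :
      ∃ c : ℂ, ∀ᶠ t in Filter.cofinite, 1 + c * t ≠ 0 ∧ ∃ a, ∃ v ∈ Uplus n,
        x j s * u * y i t = y i (t / (1 + c * t)) * torus a * v := by
    obtain ⟨c, hc⟩ := ih
    rcases eq_or_ne j i with rfl | hji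
    · refine ⟨c + s, ?_⟩
      filter_upwards [hc, eventually_one_add_mul_ne_zero (c + s)] with t ⟨h, a, v, hv, huv⟩ h'
      obtain ⟨b, r, hbr⟩ := x_mul_y_div hn j h h'
      refine ⟨h', b * a, x j ((rootChar j a)⁻¹ * r) * v, mul_mem (x_mem_Uplus _ _) hv, ?_⟩
      rw [mul_assoc, huv, ← mul_assoc, ← mul_assoc, hbr, mul_assoc _ (x j r), x_mul_torus hn,
        ← torus_mul hn]
      simp only [mul_assoc]
    · refine ⟨c, ?_⟩
      filter_upwards [hc] with t ⟨h, a, v, hv, huv⟩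
      refine ⟨h, a, x j ((rootChar j a)⁻¹ * s) * v, mul_mem (x_mem_Uplus _ _) hv, ?_⟩
      rw [mul_assoc, huv, ← mul_assoc, ← mul_assoc, x_mul_y_of_ne hn hji, mul_assoc _ (x j s),
        x_mul_torus hn]
      simp only [mul_assoc]
  induction hu using Subgroup.closure_induction_left with
  | one =>
    exact ⟨0, .of_forall fun t => ⟨by simp, 1, 1, one_mem _, by simp [torus_one hn]⟩⟩
  | mul_left s hs u _ ih =>
    obtain ⟨p, rfl⟩ := hs
    exact mul_x _ _ _ ih
  | inv_mul_cancel s hs u _ ih =>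
    obtain ⟨p, rfl⟩ := hs
    rw [x_inv]
    exact mul_x _ _ _ ih

/-- The big cell `U⁻ T U⁺`. -/
def BigCell (n : ℕ) : Set (G n) :=
  {g | ∃ u ∈ Uminus n, ∃ a : Fin n → ℂˣ, ∃ v ∈ Uplus n, g = u * torus a * v}

theorem one_mem_BigCell (hn : 3 ≤ n) : (1 : G n) ∈ BigCell n :=
  ⟨1, one_mem _, 1, 1, one_mem _, by simp [torus_one hn]⟩

theorem mul_x_mem_BigCell {g : G n} (hg : g ∈ BigCell n) (i : Fin n) (t : ℂ) :
    g * x i t ∈ BigCell n := by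
  obtain ⟨u, hu, a, v, hv, rfl⟩ := hg
  exact ⟨u, hu, a, v * x i t, mul_mem hv (x_mem_Uplus i t), mul_assoc _ _ _⟩

theorem eventually_mul_y_mem_BigCell (hn : 3 ≤ n) {g : G n} (hg : g ∈ BigCell n) (i : Fin n) :
    ∀ᶠ t in Filter.cofinite, g * y i t ∈ BigCell n := by
  obtain ⟨u, hu, a, v, hv, rfl⟩ := hg
  obtain ⟨c, hc⟩ := exists_mul_y_eq hn i hv
  filter_upwards [hc] with t ⟨_, b, w, hw, hvw⟩
  refine ⟨u * y i ((rootChar i a)⁻¹ * (t / (1 + c * t))), mul_mem hu (y_mem_Uminus _ _), a * b, w,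
    hw, ?_⟩
  rw [mul_assoc, hvw, ← mul_assoc, ← mul_assoc, mul_assoc u, torus_mul_y hn, ← torus_mul hn]
  simp only [mul_assoc]

theorem val_mul (g h : G n) : (g * h : G n).1.val = g.1.val * h.1.val := rfl

theorem y_val (i : Fin n) (t : ℂ) : (y i t).1.val = 1 + t • f i := rfl

theorem IsRegular.mul_right {F : G n → ℂ} (hF : IsRegular F) (h : G n) :
    IsRegular fun g => F (g * h) := by
  obtain ⟨P, hP⟩ := hF
  refine ⟨MvPolynomial.bind₁ (fun p : Idx n × Idx n =>
    ∑ q, MvPolynomial.X (p.1, q) * MvPolynomial.C (h.1.val q p.2)) P, fun g => ?_⟩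
  simp only [hP, MvPolynomial.eval]
  rw [MvPolynomial.eval₂Hom_bind₁]
  congr 2
  funext p
  simp [mul_apply]

theorem IsRegular.sub {F F' : G n → ℂ} (hF : IsRegular F) (hF' : IsRegular F') :
    IsRegular fun g => F g - F' g := by
  obtain ⟨P, hP⟩ := hF
  obtain ⟨P', hP'⟩ := hF'
  exact ⟨P - P', fun g => by rw [map_sub, ← hP, ← hP']⟩

theorem IsRegular.exists_polynomial {F : G n → ℂ} (hF : IsRegular F) (g : G n) (i : Fin n) :
    ∃ Q : Polynomial ℂ, ∀ t, Q.eval t = F (g * y i t) := by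
  obtain ⟨P, hP⟩ := hF
  refine ⟨MvPolynomial.eval₂ Polynomial.C (fun p : Idx n × Idx n =>
    Polynomial.C (g.1.val p.1 p.2) + Polynomial.X * Polynomial.C ((g.1.val * f i) p.1 p.2)) P,
    fun t => ?_⟩
  rw [hP, ← Polynomial.coe_evalRingHom, MvPolynomial.hom_eval₂, MvPolynomial.eval,
    MvPolynomial.coe_eval₂Hom]
  congr 1
  · ext z; simp
  · funext p
    rw [val_mul, y_val, mul_add, mul_one, mul_smul_comm]
    simp [mul_comm t]

theorem IsRegular.eq_zero_of_eventually {F : G n → ℂ} (hF : IsRegular F) (g : G n) (i : Fin n)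
    (h : ∀ᶠ t in Filter.cofinite, F (g * y i t) = 0) (t : ℂ) : F (g * y i t) = 0 := by
  obtain ⟨Q, hQ⟩ := hF.exists_polynomial g i
  have hroots : {t | Q.IsRoot t}.Infinite :=
    (Filter.eventually_cofinite.1 h).infinite_compl.mono fun t ht =>
      (hQ t).trans (not_not.1 ht)
  rw [← hQ, Q.eq_zero_of_infinite_isRoot hroots, Polynomial.eval_zero]

theorem IsRegular.eq_zero (hn : 3 ≤ n) {F : G n → ℂ} (hF : IsRegular F)
    (h : ∀ g ∈ BigCell n, F g = 0) (g : G n) : F g = 0 := by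
  induction g using mul_x_mul_y_induction generalizing F with
  | one => exact h 1 (one_mem_BigCell hn)
  | mul_x _ i t ih =>
    exact ih (hF.mul_right _) fun g' hg' => h _ (mul_x_mem_BigCell hg' i t)
  | mul_y _ i t ih =>
    refine ih (hF.mul_right _) fun g' hg' => hF.eq_zero_of_eventually g' i ?_ t
    exact (eventually_mul_y_mem_BigCell hn hg' i).mono fun _ => h _

theorem IsPrincipalMinor.unique (hn : 3 ≤ n) {μ : Fin n → ℕ} {F F' : G n → ℂ}
    (hF : IsPrincipalMinor μ F) (hF' : IsPrincipalMinor μ F') : F = F' := by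
  funext g
  refine sub_eq_zero.1 ((hF.1.sub hF'.1).eq_zero hn ?_ g)
  rintro _ ⟨u, hu, a, v, hv, rfl⟩
  rw [hF.2 u hu a v hv, hF'.2 u hu a v hv, sub_self]

theorem principalMinor_eq (hn : 3 ≤ n) {μ : Fin n → ℕ} {F : G n → ℂ}
    (hF : IsPrincipalMinor μ F) : principalMinor μ = F :=
  IsPrincipalMinor.unique hn (Classical.epsilon_spec ⟨F, hF⟩) hF

/-! ### Determinantal principal minors -/

/-- The minor of `g` with rows and columns indexed by `r`. -/
def minorOf {m : ℕ} (r : Fin m → Idx n) (g : G n) : ℂ := (g.1.val.submatrix r r).det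

/-- The span of the first `k` of the basis vectors `r` is stable under all `e_i`, for each `k`:
then `minorOf r` is a highest weight matrix coefficient of an exterior power of the module. -/
def RaiseStable {m : ℕ} (r : Fin m → Idx n) : Prop :=
  ∀ (i : Fin n) (k : Fin m) (a : Idx n), Raise i (r k) a → ∃ k' < k, a = r k'

theorem minorOf_isRegular {m : ℕ} (r : Fin m → Idx n) : IsRegular (minorOf r) := by
  refine ⟨(Matrix.of fun i j => MvPolynomial.X (r i, r j)).det, fun g => ?_⟩
  rw [minorOf, RingHom.map_det]
  congr 1
  ext i j
  simp

theorem submatrix_mul_of_eq_zero {ι κ R : Type*} [Fintype ι] [Fintype κ]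
    [NonUnitalNonAssocSemiring R] {r : κ → ι} (hr : r.Injective) (M : Matrix ι ι R)
    {A : Matrix ι ι R} (hA : ∀ k, ∀ c ∉ Set.range r, A c (r k) = 0) :
    (M * A).submatrix r r = M.submatrix r r * A.submatrix r r := by
  ext a b
  simp only [submatrix_apply, mul_apply]
  exact (Fintype.sum_of_injective r hr _ _ (fun c hc => by rw [hA b c hc, mul_zero])
    fun k => rfl).symm

theorem det_submatrix_mul_one_add_e {m : ℕ} {r : Fin m → Idx n} (hr : r.Injective)
    (hup : RaiseStable r) (i : Fin n) (t : ℂ) (M : Matrix (Idx n) (Idx n) ℂ) :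
    ((M * (1 + t • e i)).submatrix r r).det = (M.submatrix r r).det := by
  have hdet : ((1 + t • e i).submatrix r r).det = 1 := by
    rw [det_of_isUpperTriangular, Finset.prod_eq_one]
    · intro k _
      have hself : ¬Raise i (r k) (r k) := fun h => h.not_raise h
      simp [e, hself]
    · intro a b (hab : b < a)
      have hraise : ¬Raise i (r b) (r a) := fun h => by
        obtain ⟨k, hk, hak⟩ := hup i b _ h
        exact hk.not_gt (hr hak ▸ hab)
      simp [e, hraise, one_apply_ne (hr.ne hab.ne')]
  rw [submatrix_mul_of_eq_zero hr, det_mul, hdet, mul_one]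
  intro k c hc
  have hraise : ¬Raise i (r k) c := fun h => by
    obtain ⟨k', -, rfl⟩ := hup i k _ h
    exact hc ⟨k', rfl⟩
  simp [e, hraise, one_apply_ne fun h : c = r k => hc ⟨k, h.symm⟩]

theorem transpose_f (i : Fin n) : (f i)ᵀ = e i := rfl

theorem minorOf_mul_x {m : ℕ} {r : Fin m → Idx n} (hr : r.Injective) (hup : RaiseStable r)
    (i : Fin n) (t : ℂ) (g : G n) : minorOf r (g * x i t) = minorOf r g :=
  det_submatrix_mul_one_add_e hr hup i t _

theorem minorOf_y_mul {m : ℕ} {r : Fin m → Idx n} (hr : r.Injective) (hup : RaiseStable r)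
    (i : Fin n) (t : ℂ) (g : G n) : minorOf r (y i t * g) = minorOf r g := by
  rw [minorOf, ← det_transpose, transpose_submatrix, val_mul, transpose_mul, y_val, transpose_add,
    transpose_one, transpose_smul, transpose_f, det_submatrix_mul_one_add_e hr hup,
    ← transpose_submatrix, det_transpose, minorOf]

theorem minorOf_mul_of_mem_Uplus {m : ℕ} {r : Fin m → Idx n} (hr : r.Injective)
    (hup : RaiseStable r) {u : G n} (hu : u ∈ Uplus n) (g : G n) :
    minorOf r (g * u) = minorOf r g := by
  induction hu using Subgroup.closure_induction generalizing g with
  | mem u hu => obtain ⟨p, rfl⟩ := hu; exact minorOf_mul_x hr hup _ _ g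
  | one => rw [mul_one]
  | mul u v _ _ hu hv => rw [← mul_assoc, hv, hu]
  | inv u _ hu => rw [← hu, inv_mul_cancel_right]

theorem minorOf_mul_of_mem_Uminus {m : ℕ} {r : Fin m → Idx n} (hr : r.Injective)
    (hup : RaiseStable r) {u : G n} (hu : u ∈ Uminus n) (g : G n) :
    minorOf r (u * g) = minorOf r g := by
  induction hu using Subgroup.closure_induction generalizing g with
  | mem u hu => obtain ⟨p, rfl⟩ := hu; exact minorOf_y_mul hr hup _ _ g
  | one => rw [one_mul]
  | mul u v _ _ hu hv => rw [mul_assoc, hu, hv]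
  | inv u _ hu => rw [← hu, mul_inv_cancel_left]

theorem prod_zpow_eq_zpow_sum {ι K : Type*} [Semifield K] {a : K} (ha : a ≠ 0) (s : Finset ι)
    (z : ι → ℤ) : ∏ k ∈ s, a ^ z k = a ^ ∑ k ∈ s, z k := by
  induction s using Finset.cons_induction with
  | empty => simp
  | cons k s hk ih => rw [Finset.prod_cons, Finset.sum_cons, ih, zpow_add₀ ha]

theorem minorOf_torus (hn : 3 ≤ n) {m : ℕ} {r : Fin m → Idx n} (hr : r.Injective)
    (a : Fin n → ℂˣ) : minorOf r (torus a) = ∏ i, (a i : ℂ) ^ ∑ k, corootPairing i (r k) := by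
  have hdiag : (torus a).1.val.submatrix r r =
      diagonal fun k => ∏ i, (a i : ℂ) ^ corootPairing i (r k) := by
    ext k l
    rw [submatrix_apply, ← act_single, act_torus hn, diagonal_apply, Pi.single_apply]
    simp only [hr.eq_iff]
    split_ifs <;> simp
  rw [minorOf, hdiag, det_diagonal, Finset.prod_comm]
  refine Finset.prod_congr rfl fun i _ => ?_
  exact prod_zpow_eq_zpow_sum (a i).ne_zero _ _

theorem minorOf_isPrincipalMinor (hn : 3 ≤ n) {m : ℕ} {r : Fin m → Idx n} (hr : r.Injective)
    (hup : RaiseStable r) {μ : Fin n → ℕ} (hμ : ∀ i, ∑ k, corootPairing i (r k) = μ i) :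
    IsPrincipalMinor μ (minorOf r) := by
  refine ⟨minorOf_isRegular r, fun u hu a v hv => ?_⟩
  simp only [minorOf_mul_of_mem_Uplus hr hup hv, minorOf_mul_of_mem_Uminus hr hup hu,
    minorOf_torus hn hr, hμ, zpow_natCast]

/-! ### The Weyl group in `ε`-coordinates -/

/-- The simple reflection `s_i` in `ε`-coordinates. -/
def refl (i : Fin n) : Module.End ℤ (Fin n → ℤ) where
  toFun v := v - (epsRoot i ⬝ᵥ v) • epsRoot i
  map_add' v w := by rw [dotProduct_add, add_smul]; abel
  map_smul' c v := by rw [dotProduct_smul, smul_sub, smul_smul]; rfl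

theorem refl_apply (i : Fin n) (v : Fin n → ℤ) :
    refl i v = v - (epsRoot i ⬝ᵥ v) • epsRoot i := rfl

theorem refl_rootFst (hn : 3 ≤ n) (i : Fin n) (v : Fin n → ℤ) :
    refl i v (rootFst i) = -rootSign i * v (rootSnd i) := by
  simp [refl_apply, epsRoot_rootFst hn, epsRoot_dot]

theorem refl_rootSnd (hn : 3 ≤ n) (i : Fin n) (v : Fin n → ℤ) :
    refl i v (rootSnd i) = -rootSign i * v (rootFst i) := by
  rw [refl_apply, Pi.sub_apply, Pi.smul_apply, epsRoot_rootSnd hn, epsRoot_dot, smul_eq_mul]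
  linear_combination -(v (rootSnd i)) * rootSign_mul_self i

theorem refl_of_ne {i j : Fin n} (h₁ : j ≠ rootFst i) (h₂ : j ≠ rootSnd i) (v : Fin n → ℤ) :
    refl i v j = v j := by
  simp [refl_apply, epsRoot_of_ne h₁ h₂]

theorem epsRoot_dot_refl (hn : 3 ≤ n) (i : Fin n) (v : Fin n → ℤ) :
    epsRoot i ⬝ᵥ refl i v = -(epsRoot i ⬝ᵥ v) := by
  rw [refl_apply, dotProduct_sub, dotProduct_smul, epsRoot_dot_self hn, smul_eq_mul]
  ring

theorem refl_refl (hn : 3 ≤ n) (i : Fin n) (v : Fin n → ℤ) : refl i (refl i v) = v := by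
  rw [refl_apply i (refl i v), epsRoot_dot_refl hn, refl_apply]
  module

theorem refl_epsRoot (hn : 3 ≤ n) (i : Fin n) : refl i (epsRoot i) = -epsRoot i := by
  rw [refl_apply, epsRoot_dot_self hn]
  module

theorem dot_refl (i : Fin n) (v w : Fin n → ℤ) : v ⬝ᵥ refl i w = refl i v ⬝ᵥ w := by
  rw [refl_apply, refl_apply, dotProduct_sub, sub_dotProduct, dotProduct_smul, smul_dotProduct,
    dotProduct_comm v (epsRoot i), smul_eq_mul, smul_eq_mul, mul_comm]

theorem prod_refl (hn : 3 ≤ n) (i : Fin n) (v : Fin n → ℤ) : ∏ j, refl i v j = ∏ j, v j := by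
  have hne := (rootFst_lt_rootSnd hn i).ne
  have hcoord (j : Fin n) : refl i v j =
      (if j = rootFst i ∨ j = rootSnd i then -rootSign i else 1) *
        v (Equiv.swap (rootFst i) (rootSnd i) j) := by
    by_cases h₁ : j = rootFst i
    · subst h₁; simp [refl_rootFst hn]
    by_cases h₂ : j = rootSnd i
    · subst h₂; simp [refl_rootSnd hn]
    rw [refl_of_ne h₁ h₂, Equiv.swap_apply_of_ne_of_ne h₁ h₂, if_neg (by tauto), one_mul]
  simp only [hcoord]
  rw [Finset.prod_mul_distrib, Equiv.prod_comp (Equiv.swap (rootFst i) (rootSnd i)) v,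
    Fintype.prod_eq_mul _ _ hne fun j hj => if_neg (by tauto)]
  simp [rootSign_mul_self]

theorem exists_refl_single (hn : 3 ≤ n) (i j : Fin n) :
    ∃ (k : Fin n) (t : ℤ), (t = 1 ∨ t = -1) ∧
      refl i (Pi.single j 1) = Pi.single k t := by
  have hsign : -rootSign i = 1 ∨ -rootSign i = -1 := by
    rcases rootSign_eq_or i with h | h <;> simp [h]
  by_cases h₁ : j = rootFst i
  · refine ⟨rootSnd i, _, hsign, ?_⟩
    rw [h₁, refl_apply, dotProduct_single_one, epsRoot_rootFst hn, epsRoot, Pi.single_neg]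
    module
  by_cases h₂ : j = rootSnd i
  · refine ⟨rootFst i, _, hsign, ?_⟩
    rw [h₂, refl_apply, dotProduct_single_one, epsRoot_rootSnd hn, epsRoot, smul_add,
      ← Pi.single_smul, ← Pi.single_smul, smul_eq_mul, smul_eq_mul, rootSign_mul_self, mul_one,
      Pi.single_neg]
    abel
  exact ⟨j, 1, .inl rfl, by rw [refl_apply, dotProduct_single, epsRoot_of_ne h₁ h₂]; simp⟩

/-- The composite `s_{i₁} ⋯ s_{i_l}` of the simple reflections of a word, in
`ε`-coordinates. -/
def wact (l : List (Fin n)) : Module.End ℤ (Fin n → ℤ) := (l.map refl).prod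

theorem wact_nil (v : Fin n → ℤ) : wact [] v = v := rfl

theorem wact_cons (i : Fin n) (l : List (Fin n)) (v : Fin n → ℤ) :
    wact (i :: l) v = refl i (wact l v) := by
  simp [wact]

theorem wact_append (l l' : List (Fin n)) (v : Fin n → ℤ) :
    wact (l ++ l') v = wact l (wact l' v) := by
  simp [wact]

theorem wact_reverse_wact (hn : 3 ≤ n) (l : List (Fin n)) (v : Fin n → ℤ) :
    wact l.reverse (wact l v) = v := by
  induction l generalizing v with
  | nil => rfl
  | cons i l ih =>
    rw [List.reverse_cons, wact_append, wact_cons, wact_cons, wact_nil, refl_refl hn, ih]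

theorem wact_wact_reverse (hn : 3 ≤ n) (l : List (Fin n)) (v : Fin n → ℤ) :
    wact l (wact l.reverse v) = v := by
  simpa using wact_reverse_wact hn l.reverse v

theorem dot_wact (l : List (Fin n)) (v w : Fin n → ℤ) :
    v ⬝ᵥ wact l w = wact l.reverse v ⬝ᵥ w := by
  induction l generalizing v with
  | nil => rfl
  | cons i l ih => rw [wact_cons, dot_refl, ih, List.reverse_cons, wact_append, wact_cons, wact_nil]

theorem wact_dot_wact (hn : 3 ≤ n) (l : List (Fin n)) (v w : Fin n → ℤ) :
    wact l v ⬝ᵥ wact l w = v ⬝ᵥ w := by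
  rw [dot_wact, wact_reverse_wact hn]

theorem prod_wact (hn : 3 ≤ n) (l : List (Fin n)) (v : Fin n → ℤ) :
    ∏ j, wact l v j = ∏ j, v j := by
  induction l with
  | nil => rfl
  | cons i l ih => rw [wact_cons, prod_refl hn, ih]

theorem exists_wact_single (hn : 3 ≤ n) (l : List (Fin n)) (j : Fin n) :
    ∃ (k : Fin n) (t : ℤ), (t = 1 ∨ t = -1) ∧ wact l (Pi.single j 1) = Pi.single k t := by
  induction l with
  | nil => exact ⟨j, 1, .inl rfl, rfl⟩
  | cons i l ih =>
    obtain ⟨k, t, ht, hk⟩ := ih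
    obtain ⟨m, u, hu, hm⟩ := exists_refl_single hn i k
    refine ⟨m, t * u, by rcases ht with rfl | rfl <;> rcases hu with rfl | rfl <;> simp, ?_⟩
    have hsmul : (Pi.single k t : Fin n → ℤ) = t • Pi.single k 1 := by simp [← Pi.single_smul]
    rw [wact_cons, hk, hsmul, map_smul, hm, ← Pi.single_smul, smul_eq_mul]

/-- The pairing of a weight with an element of the Cartan subalgebra, whose coordinates refer to
the basis of simple coroots. -/
def pairing (v : Fin n → ℤ) (h : Fin n → ℂ) : ℂ := ∑ j, ((epsRoot j ⬝ᵥ v : ℤ) : ℂ) * h j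

theorem pairing_refl (hn : 3 ≤ n) (i : Fin n) (v : Fin n → ℤ) (h : Fin n → ℂ) :
    pairing (refl i v) h = pairing v (simpleReflection i h) := by
  have hroot : simpleRoot i h = ∑ j, ((epsRoot j ⬝ᵥ epsRoot i : ℤ) : ℂ) * h j := by
    simp [simpleRoot, LinearMap.sum_apply, cartanMatrix_eq_epsRoot_dot hn]
  have hcoroot : pairing v (Pi.single i 1) = ((epsRoot i ⬝ᵥ v : ℤ) : ℂ) := by
    simp [pairing, Pi.single_apply]
  have hlin : pairing v (simpleReflection i h) =
      pairing v h - simpleRoot i h * pairing v (Pi.single i 1) := by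
    rw [simpleReflection, Module.reflection_apply]
    simp only [pairing, Pi.sub_apply, Pi.smul_apply, smul_eq_mul, mul_sub,
      Finset.sum_sub_distrib, Finset.mul_sum]
    exact congrArg _ (Finset.sum_congr rfl fun j _ => by ring)
  rw [hlin, hcoroot, hroot, pairing, pairing, Finset.sum_mul, ← Finset.sum_sub_distrib]
  refine Finset.sum_congr rfl fun j _ => ?_
  rw [refl_apply, dotProduct_sub, dotProduct_smul, smul_eq_mul]
  push_cast
  ring

theorem pairing_wact (hn : 3 ≤ n) (l : List (Fin n)) (v : Fin n → ℤ) (h : Fin n → ℂ) :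
    pairing (wact l v) ((l.map s).prod.1 h) = pairing v h := by
  induction l with
  | nil => rfl
  | cons i l ih =>
    have hcons : ((i :: l).map s).prod.1 h = simpleReflection i ((l.map s).prod.1 h) := by
      rw [List.map_cons, List.prod_cons]; rfl
    rw [hcons, wact_cons, pairing_refl hn, simpleReflection,
      Module.involutive_reflection (simpleRoot_coroot i), ih]

/-- The matrix whose rows are the simple roots. -/
def epsRootMatrix (n : ℕ) : Matrix (Fin n) (Fin n) ℂ := Matrix.of fun i j => (epsRoot i j : ℂ)

theorem epsRootMatrix_mulVec (hn : 3 ≤ n) (u : Fin n → ℂ) (i : Fin n) :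
    (epsRootMatrix n *ᵥ u) i = u (rootFst i) + rootSign i * u (rootSnd i) := by
  rw [mulVec, dotProduct, Fintype.sum_eq_add _ _ (rootFst_lt_rootSnd hn i).ne]
  · simp [epsRootMatrix, epsRoot_rootFst hn, epsRoot_rootSnd hn]
  · rintro j ⟨h₁, h₂⟩
    simp [epsRootMatrix, epsRoot_of_ne h₁ h₂]

theorem isUnit_epsRootMatrix (hn : 3 ≤ n) : IsUnit (epsRootMatrix n) := by
  rw [← mulVec_injective_iff_isUnit]
  refine (injective_iff_map_eq_zero (epsRootMatrix n).mulVecLin).2 fun u hu => ?_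
  have hsucc {i j : Fin n} (hj : j.val = i.val + 1) : u i = u j := by
    have h : (epsRootMatrix n *ᵥ u) i = 0 := congrFun hu i
    rw [epsRootMatrix_mulVec hn, rootFst_of_succ hj, rootSnd_of_succ hj,
      rootSign_of_succ hj] at h
    linear_combination h
  have hlast {i : Fin n} (hi : i.val + 1 = n) : u i = 0 := by
    obtain ⟨j, hj⟩ : ∃ j : Fin n, j.val + 1 = i.val := ⟨⟨i.val - 1, by omega⟩, by simp only; omega⟩
    have h : (epsRootMatrix n *ᵥ u) i = 0 := congrFun hu i
    rw [epsRootMatrix_mulVec hn, rootFst_of_last hi hj, rootSnd_of_last hi, rootSign_of_last hi,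
      hsucc hj.symm] at h
    linear_combination h / 2
  have hall (d : ℕ) : ∀ j : Fin n, j.val + d + 1 = n → u j = 0 := by
    induction d with
    | zero => exact fun j hj => hlast hj
    | succ d ih =>
      intro j hj
      exact (hsucc (j := ⟨j.val + 1, by omega⟩) rfl).trans (ih _ (by simp only; omega))
  exact funext fun j => hall (n - 1 - j.val) j (by omega)

theorem eq_of_forall_pairing_right (hn : 3 ≤ n) {h h' : Fin n → ℂ}
    (H : ∀ v : Fin n → ℤ, pairing v h = pairing v h') : h = h' := by
  refine vecMul_injective_iff_isUnit.2 (isUnit_epsRootMatrix hn) (funext fun j => ?_)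
  have h := H (Pi.single j 1)
  simp only [pairing, dotProduct_single_one] at h
  simpa [vecMul, dotProduct, epsRootMatrix, mul_comm] using h

theorem eq_of_forall_pairing_left (hn : 3 ≤ n) {v v' : Fin n → ℤ}
    (H : ∀ h : Fin n → ℂ, pairing v h = pairing v' h) : v = v' := by
  have hcast : (fun j => (v j : ℂ)) = fun j => (v' j : ℂ) := by
    refine mulVec_injective_iff_isUnit.2 (isUnit_epsRootMatrix hn) (funext fun i => ?_)
    simpa [pairing, mulVec, dotProduct, epsRootMatrix, Pi.single_apply] using H (Pi.single i 1)
  exact funext fun j => by exact_mod_cast congrFun hcast j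

theorem prod_s_eq_iff (hn : 3 ≤ n) (l l' : List (Fin n)) :
    (l.map s).prod = (l'.map s).prod ↔ wact l = wact l' := by
  constructor
  · intro h
    refine LinearMap.ext fun v => eq_of_forall_pairing_left hn fun u => ?_
    obtain ⟨u, rfl⟩ := (l.map s).prod.1.surjective u
    rw [pairing_wact hn, h, pairing_wact hn]
  · intro h
    refine Subtype.ext (LinearEquiv.ext fun u => eq_of_forall_pairing_right hn fun v => ?_)
    rw [← wact_wact_reverse hn l v, pairing_wact hn, h, pairing_wact hn]

/-! ### Positive roots and lengths -/

/-- The positive roots `ε_a ± ε_b`, `a < b`. -/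
def posRoots (n : ℕ) : Finset (Fin n → ℤ) :=
  ((Finset.univ.filter fun p : Fin n × Fin n => p.1 < p.2) ×ˢ ({1, -1} : Finset ℤ)).image
    fun p => Pi.single p.1.1 1 + Pi.single p.1.2 p.2

theorem mem_posRoots {γ : Fin n → ℤ} : γ ∈ posRoots n ↔
    ∃ a b : Fin n, ∃ t : ℤ, a < b ∧ (t = 1 ∨ t = -1) ∧ γ = Pi.single a 1 + Pi.single b t := by
  simp only [posRoots, Finset.mem_image, Finset.mem_product, Finset.mem_filter, Finset.mem_univ,
    true_and, Finset.mem_insert, Finset.mem_singleton, Prod.exists, and_assoc, eq_comm]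

theorem epsRoot_mem_posRoots (hn : 3 ≤ n) (i : Fin n) : epsRoot i ∈ posRoots n :=
  mem_posRoots.2 ⟨_, _, _, rootFst_lt_rootSnd hn i, rootSign_eq_or i, rfl⟩

theorem mul_pred_le_card_posRoots : n * (n - 1) ≤ (posRoots n).card := by
  have hcard : (Finset.univ : Finset (Fin n)).offDiag.card = n * (n - 1) := by
    rw [Finset.offDiag_card]; simp [Nat.mul_sub]
  rw [← hcard]
  refine Finset.card_le_card_of_injOn
    (fun p => Pi.single p.2 1 + Pi.single p.1 (if p.1 < p.2 then 1 else -1)) ?_ ?_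
  · rintro ⟨a, b⟩ hab
    have hne : a ≠ b := (Finset.mem_offDiag.1 hab).2.2
    rcases lt_or_gt_of_ne hne with h | h
    · exact mem_posRoots.2 ⟨a, b, 1, h, .inl rfl, by simp [h, add_comm]⟩
    · exact mem_posRoots.2 ⟨b, a, -1, h, .inr rfl, by simp [h.asymm]⟩
  · rintro ⟨a, b⟩ hab ⟨c, d⟩ hcd h
    have hab : a ≠ b := (Finset.mem_offDiag.1 hab).2.2
    have hcd : c ≠ d := (Finset.mem_offDiag.1 hcd).2.2
    have ha := congrFun h a
    have hb := congrFun h b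
    have hc := congrFun h c
    simp only [Pi.add_apply, Pi.single_apply] at ha hb hc
    grind

theorem single_add_single_dot (a b : Fin n) (s t : ℤ) (v : Fin n → ℤ) :
    (Pi.single a s + Pi.single b t : Fin n → ℤ) ⬝ᵥ v = s * v a + t * v b := by
  simp [add_dotProduct]

theorem single_add_single_mem_posRoots_or {a b : Fin n} (hab : a ≠ b) {s t : ℤ}
    (hs : s = 1 ∨ s = -1) (ht : t = 1 ∨ t = -1) :
    (Pi.single a s + Pi.single b t : Fin n → ℤ) ∈ posRoots n ∨
      -(Pi.single a s + Pi.single b t : Fin n → ℤ) ∈ posRoots n := by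
  wlog hlt : a < b generalizing a b s t
  · rw [add_comm]
    exact this hab.symm ht hs (lt_of_le_of_ne (not_lt.1 hlt) hab.symm)
  rcases hs with rfl | rfl
  · exact .inl (mem_posRoots.2 ⟨a, b, t, hlt, ht, rfl⟩)
  · refine .inr (mem_posRoots.2 ⟨a, b, -t, hlt, by omega, ?_⟩)
    rw [neg_add, Pi.single_neg, neg_neg, Pi.single_neg]

theorem wact_mem_posRoots_or (hn : 3 ≤ n) (l : List (Fin n)) {γ : Fin n → ℤ}
    (hγ : γ ∈ posRoots n) : wact l γ ∈ posRoots n ∨ -wact l γ ∈ posRoots n := by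
  obtain ⟨a, b, t, hab, ht, rfl⟩ := mem_posRoots.1 hγ
  obtain ⟨c, s, hs, hc⟩ := exists_wact_single hn l a
  obtain ⟨d, u, hu, hd⟩ := exists_wact_single hn l b
  have hcd : c ≠ d := by
    rintro rfl
    have h := wact_dot_wact hn l (Pi.single a 1) (Pi.single b 1)
    rw [hc, hd, single_dotProduct, single_dotProduct, Pi.single_eq_same,
      Pi.single_eq_of_ne hab.ne] at h
    rcases hs with rfl | rfl <;> rcases hu with rfl | rfl <;> simp at h
  have hsmul : (Pi.single b t : Fin n → ℤ) = t • Pi.single b 1 := by simp [← Pi.single_smul]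
  rw [map_add, hsmul, map_smul, hc, hd, ← Pi.single_smul]
  refine single_add_single_mem_posRoots_or hcd hs ?_
  rcases ht with rfl | rfl <;> rcases hu with rfl | rfl <;> simp

theorem antitone_of_dominant {v : Fin n → ℤ} (hv : ∀ i, 0 ≤ epsRoot i ⬝ᵥ v) : Antitone v := by
  have hstep (i j : Fin n) (hj : j.val = i.val + 1) : v j ≤ v i := by
    have h := hv i
    rw [epsRoot_dot, rootFst_of_succ hj, rootSnd_of_succ hj, rootSign_of_succ hj] at h
    omega
  intro a b hab
  suffices ∀ m, a.val ≤ m → ∀ hm : m < n, v ⟨m, hm⟩ ≤ v a from this b (Fin.le_def.1 hab) b.2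
  refine Nat.le_induction (fun _ => le_rfl) fun m _ ih hm => ?_
  exact (hstep ⟨m, by omega⟩ _ rfl).trans (ih (by omega))

theorem dot_nonneg_of_dominant (hn : 3 ≤ n) {v : Fin n → ℤ} (hv : ∀ i, 0 ≤ epsRoot i ⬝ᵥ v)
    {γ : Fin n → ℤ} (hγ : γ ∈ posRoots n) : 0 ≤ γ ⬝ᵥ v := by
  obtain ⟨a, b, t, hab, ht, rfl⟩ := mem_posRoots.1 hγ
  rw [single_add_single_dot]
  have hanti := antitone_of_dominant hv
  have hlast := hv ⟨n - 1, by omega⟩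
  rw [epsRoot_dot, rootFst_of_last (j := ⟨n - 2, by omega⟩) (by simp only; omega)
    (by simp only; omega), rootSnd_of_last (by simp only; omega),
    rootSign_of_last (by simp only; omega)] at hlast
  have := Fin.lt_def.1 hab
  have ha : v ⟨n - 2, by omega⟩ ≤ v a := hanti (Fin.le_def.2 (by simp only; omega))
  have hb : v ⟨n - 1, by omega⟩ ≤ v b := hanti (Fin.le_def.2 (by simp only; omega))
  have hab := hanti hab.le
  rcases ht with rfl | rfl <;> omega

/-- Half the sum of the positive roots, `ρ = (n - 1, …, 1, 0)`. -/
def rho (n : ℕ) : Fin n → ℤ := fun j => (n : ℤ) - 1 - j.val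

theorem epsRoot_dot_rho (hn : 3 ≤ n) (i : Fin n) : epsRoot i ⬝ᵥ rho n = 1 := by
  rw [epsRoot_dot]
  rcases node_cases hn i with ⟨j, hj⟩ | ⟨hi, j, hj⟩
  · rw [rootFst_of_succ hj, rootSnd_of_succ hj, rootSign_of_succ hj, rho, rho]
    omega
  · rw [rootFst_of_last hi hj, rootSnd_of_last hi, rootSign_of_last hi, rho, rho]
    omega

theorem posRoots_dot_rho_pos {γ : Fin n → ℤ} (hγ : γ ∈ posRoots n) : 0 < γ ⬝ᵥ rho n := by
  obtain ⟨a, b, t, hab, ht, rfl⟩ := mem_posRoots.1 hγ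
  rw [single_add_single_dot, rho, rho]
  have := Fin.lt_def.1 hab
  rcases ht with rfl | rfl <;> omega

theorem posRoots_dot_self {γ : Fin n → ℤ} (hγ : γ ∈ posRoots n) : γ ⬝ᵥ γ = 2 := by
  obtain ⟨a, b, t, hab, ht, rfl⟩ := mem_posRoots.1 hγ
  rw [single_add_single_dot]
  rcases ht with rfl | rfl <;> simp [hab.ne, hab.ne']

/- By Cauchy–Schwarz `γ · α_i ≤ 1`, so `s_i γ` has height at least `0` and hence is positive. -/
theorem refl_mem_posRoots (hn : 3 ≤ n) (i : Fin n) {γ : Fin n → ℤ} (hγ : γ ∈ posRoots n)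
    (hne : γ ≠ epsRoot i) : refl i γ ∈ posRoots n := by
  refine (wact_mem_posRoots_or hn [i] hγ).resolve_right fun hneg => ?_
  have hsq : 0 < (γ - epsRoot i) ⬝ᵥ (γ - epsRoot i) :=
    lt_of_le_of_ne (Finset.sum_nonneg fun j _ => mul_self_nonneg _) fun h =>
      hne (sub_eq_zero.1 (dotProduct_self_eq_zero.1 h.symm))
  have hheight := posRoots_dot_rho_pos hneg
  rw [wact_cons, wact_nil, neg_dotProduct, ← dot_refl, refl_apply, dotProduct_sub,
    dotProduct_smul, epsRoot_dot_rho hn, one_smul] at hheight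
  rw [sub_dotProduct, dotProduct_sub, dotProduct_sub, posRoots_dot_self hγ,
    epsRoot_dot_self hn, dotProduct_comm (epsRoot i)] at hsq
  have := posRoots_dot_rho_pos hγ
  omega

theorem refl_mem_posRoots_erase (hn : 3 ≤ n) (i : Fin n) {γ : Fin n → ℤ}
    (hγ : γ ∈ (posRoots n).erase (epsRoot i)) : refl i γ ∈ (posRoots n).erase (epsRoot i) := by
  obtain ⟨hne, hpos⟩ := Finset.mem_erase.1 hγ
  refine Finset.mem_erase.2 ⟨fun h => ?_, refl_mem_posRoots hn i hpos hne⟩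
  have hneg : γ = -epsRoot i := by rw [← refl_refl hn i γ, h, refl_epsRoot hn]
  have hheight := posRoots_dot_rho_pos hpos
  rw [hneg, neg_dotProduct, epsRoot_dot_rho hn] at hheight
  omega

theorem card_filter_refl (hn : 3 ≤ n) (i : Fin n) (P : (Fin n → ℤ) → Prop) [DecidablePred P] :
    (((posRoots n).erase (epsRoot i)).filter fun γ => P (refl i γ)).card =
      (((posRoots n).erase (epsRoot i)).filter P).card := by
  refine Finset.card_bij' (fun γ _ => refl i γ) (fun γ _ => refl i γ) (fun γ hγ => ?_)
    (fun γ hγ => ?_) (fun γ _ => refl_refl hn i γ) fun γ _ => refl_refl hn i γ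
  · rw [Finset.mem_filter] at hγ ⊢
    exact ⟨refl_mem_posRoots_erase hn i hγ.1, hγ.2⟩
  · rw [Finset.mem_filter] at hγ ⊢
    exact ⟨refl_mem_posRoots_erase hn i hγ.1, by rw [refl_refl hn]; exact hγ.2⟩

theorem card_filter_posRoots (hn : 3 ≤ n) (i : Fin n) (P : (Fin n → ℤ) → Prop)
    [DecidablePred P] :
    ((posRoots n).filter P).card =
      (((posRoots n).erase (epsRoot i)).filter P).card + if P (epsRoot i) then 1 else 0 := by
  conv_lhs => rw [← Finset.insert_erase (epsRoot_mem_posRoots hn i), Finset.filter_insert]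
  split_ifs
  · rw [Finset.card_insert_of_notMem (by simp)]
  · rfl

/-- The number of positive roots that are negative on `v`. At `v = wρ` this is the length
of `w`. -/
def inversions (v : Fin n → ℤ) : ℕ := ((posRoots n).filter fun γ => γ ⬝ᵥ v < 0).card

theorem inversions_eq_zero_iff {v : Fin n → ℤ} :
    inversions v = 0 ↔ ∀ γ ∈ posRoots n, 0 ≤ γ ⬝ᵥ v := by
  simp [inversions, Finset.filter_eq_empty_iff]

theorem inversions_eq_card_iff {v : Fin n → ℤ} :
    inversions v = (posRoots n).card ↔ ∀ γ ∈ posRoots n, γ ⬝ᵥ v < 0 :=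
  Finset.card_filter_eq_iff

theorem inversions_refl (hn : 3 ≤ n) (i : Fin n) (v : Fin n → ℤ) :
    inversions (refl i v) + (if epsRoot i ⬝ᵥ v < 0 then 1 else 0) =
      inversions v + if 0 < epsRoot i ⬝ᵥ v then 1 else 0 := by
  have hv := card_filter_posRoots hn i fun γ => γ ⬝ᵥ v < 0
  have hrefl := card_filter_posRoots hn i fun γ => γ ⬝ᵥ refl i v < 0
  have hrest := card_filter_refl hn i fun γ => γ ⬝ᵥ v < 0
  simp only [← dot_refl] at hrest
  simp only [epsRoot_dot_refl hn, neg_lt_zero] at hrefl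
  rw [inversions, inversions, hrefl, hrest, hv]
  omega

theorem inversions_rho : inversions (rho n) = 0 :=
  inversions_eq_zero_iff.2 fun _ hγ => (posRoots_dot_rho_pos hγ).le

theorem inversions_wact_rho_le (hn : 3 ≤ n) (l : List (Fin n)) :
    inversions (wact l (rho n)) ≤ l.length := by
  induction l with
  | nil => rw [wact_nil, inversions_rho]; exact Nat.zero_le _
  | cons i l ih =>
    have := inversions_refl hn i (wact l (rho n))
    rw [wact_cons, List.length_cons]
    split_ifs at this <;> omega

theorem posRoots_dot_wact_rho_ne_zero (hn : 3 ≤ n) (l : List (Fin n)) {γ : Fin n → ℤ}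
    (hγ : γ ∈ posRoots n) : γ ⬝ᵥ wact l (rho n) ≠ 0 := by
  rw [dot_wact]
  rcases wact_mem_posRoots_or hn l.reverse hγ with h | h
  · exact (posRoots_dot_rho_pos h).ne'
  · have := posRoots_dot_rho_pos h
    rw [neg_dotProduct] at this
    omega

theorem rho_dot_nonneg_of_dominant (hn : 3 ≤ n) {v : Fin n → ℤ}
    (hv : ∀ i, 0 ≤ epsRoot i ⬝ᵥ v) : 0 ≤ rho n ⬝ᵥ v := by
  refine Finset.sum_nonneg fun j _ => ?_
  rcases (show 0 ≤ (n : ℤ) - 1 - j.val by omega).eq_or_lt with hj | hj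
  · rw [rho, ← hj, zero_mul]
  let m : Fin n := ⟨n - 1, by omega⟩
  have hjm : j < m := Fin.lt_def.2 (by simp only [m]; omega)
  have hroot (t : ℤ) (ht : t = 1 ∨ t = -1) : 0 ≤ 1 * v j + t * v m := by
    rw [← single_add_single_dot]
    exact dot_nonneg_of_dominant hn hv (mem_posRoots.2 ⟨j, m, t, hjm, ht, rfl⟩)
  have hadd := hroot 1 (.inl rfl)
  have hsub := hroot (-1) (.inr rfl)
  exact mul_nonneg hj.le (by omega)

theorem wact_rho_eq_of_inversions_eq_zero (hn : 3 ≤ n) {l : List (Fin n)}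
    (h : inversions (wact l (rho n)) = 0) : wact l (rho n) = rho n := by
  set v := wact l (rho n)
  have hdom (i : Fin n) : 0 ≤ epsRoot i ⬝ᵥ (v - rho n) := by
    have hroot := epsRoot_mem_posRoots hn i
    have hnonneg := inversions_eq_zero_iff.1 h _ hroot
    have hne : epsRoot i ⬝ᵥ v ≠ 0 := posRoots_dot_wact_rho_ne_zero hn l hroot
    rw [dotProduct_sub, epsRoot_dot_rho hn]
    omega
  have hρ := rho_dot_nonneg_of_dominant hn hdom
  have hnorm : v ⬝ᵥ v = rho n ⬝ᵥ rho n := wact_dot_wact hn l _ _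
  have hsq : 0 ≤ (v - rho n) ⬝ᵥ (v - rho n) := Finset.sum_nonneg fun j _ => mul_self_nonneg _
  rw [dotProduct_sub] at hρ
  refine sub_eq_zero.1 (dotProduct_self_eq_zero.1 (le_antisymm ?_ hsq))
  rw [sub_dotProduct, dotProduct_sub, dotProduct_sub, hnorm, dotProduct_comm v (rho n)]
  omega

theorem exists_wact_single_of_wact_rho_eq (hn : 3 ≤ n) {l : List (Fin n)}
    (h : wact l (rho n) = rho n) (j : Fin n) :
    ∃ t : ℤ, (t = 1 ∨ t = -1) ∧ wact l (Pi.single j 1) = Pi.single j t ∧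
      (j.val + 1 ≠ n → t = 1) := by
  obtain ⟨k, t, ht, hk⟩ := exists_wact_single hn l j
  have hρ := wact_dot_wact hn l (Pi.single j 1) (rho n)
  rw [h, hk, single_dotProduct, single_one_dotProduct, rho, rho] at hρ
  obtain rfl : k = j := Fin.ext (by rcases ht with rfl | rfl <;> omega)
  exact ⟨t, ht, hk, fun hj => by rcases ht with rfl | rfl <;> omega⟩

/- The stabilizer of `ρ` in the signed permutations is generated by the sign change of the last
coordinate, which is excluded by `prod_wact`. -/
theorem wact_eq_one (hn : 3 ≤ n) {l : List (Fin n)} (h : inversions (wact l (rho n)) = 0) :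
    wact l = 1 := by
  choose t ht hwact hlast using
    exists_wact_single_of_wact_rho_eq hn (wact_rho_eq_of_inversions_eq_zero hn h)
  have hones (j : Fin n) : wact l 1 j = t j := by
    have h := wact_dot_wact hn l (Pi.single j 1) 1
    rw [hwact, single_dotProduct, single_dotProduct] at h
    rcases ht j with ht | ht <;> rw [ht] at h ⊢ <;> simp at h <;> omega
  have hprod : t ⟨n - 1, by omega⟩ = 1 := by
    have h := prod_wact hn l 1
    rw [Fintype.prod_eq_single ⟨n - 1, by omega⟩ fun j hj => by
      rw [hones, hlast j fun h => hj (Fin.ext (by simp only; omega))], hones] at h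
    simpa using h
  refine LinearMap.pi_ext' fun j => LinearMap.ext_ring ?_
  suffices t j = 1 by simpa [this] using hwact j
  by_cases hj : j.val + 1 = n
  · rwa [show j = ⟨n - 1, by omega⟩ from Fin.ext (by simp only; omega)]
  · exact hlast j hj

theorem exists_epsRoot_dot_neg (hn : 3 ≤ n) {v : Fin n → ℤ} (h : inversions v ≠ 0) :
    ∃ i, epsRoot i ⬝ᵥ v < 0 := by
  by_contra! hc
  exact h (inversions_eq_zero_iff.2 fun γ hγ => dot_nonneg_of_dominant hn hc hγ)

theorem exists_word_length_eq_inversions (hn : 3 ≤ n) (l : List (Fin n)) :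
    ∃ l', wact l' = wact l ∧ l'.length = inversions (wact l (rho n)) := by
  generalize hm : inversions (wact l (rho n)) = m
  induction m generalizing l with
  | zero => exact ⟨[], (wact_eq_one hn hm).symm, rfl⟩
  | succ m ih =>
    obtain ⟨i, hi⟩ := exists_epsRoot_dot_neg hn (v := wact l (rho n)) (by omega)
    have hdrop := inversions_refl hn i (wact l (rho n))
    rw [if_pos hi, if_neg hi.asymm] at hdrop
    obtain ⟨l', hl', hlen⟩ := ih (i :: l) (by rw [wact_cons]; omega)
    refine ⟨i :: l', LinearMap.ext fun v => ?_, by rw [List.length_cons, hlen]⟩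
    rw [wact_cons, hl', wact_cons, refl_refl hn]

theorem isReducedWord_iff (hn : 3 ≤ n) {l : List (Fin n)} {w : weylGroup n} :
    IsReducedWord l w ↔ (l.map s).prod = w ∧ l.length = inversions (wact l (rho n)) := by
  constructor
  · rintro ⟨rfl, hmin⟩
    obtain ⟨l', hl', hlen⟩ := exists_word_length_eq_inversions hn l
    refine ⟨rfl, le_antisymm ?_ (inversions_wact_rho_le hn l)⟩
    exact hlen ▸ hmin l' ((prod_s_eq_iff hn _ _).2 hl')
  · rintro ⟨rfl, hlen⟩
    refine ⟨rfl, fun l' hl' => ?_⟩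
    rw [hlen, ← (prod_s_eq_iff hn _ _).1 hl']
    exact inversions_wact_rho_le hn l'

theorem isReducedWord_reducedWord (w : weylGroup n) : IsReducedWord (reducedWord w) w :=
  (exists_reducedWord w).choose_spec

theorem length_prod_s (hn : 3 ≤ n) (l : List (Fin n)) :
    length (l.map s).prod = inversions (wact l (rho n)) := by
  have h := (isReducedWord_iff hn).1 (isReducedWord_reducedWord (l.map s).prod)
  rw [length, h.2, (prod_s_eq_iff hn _ _).1 h.1]

theorem wact_eq_of_antidominant (hn : 3 ≤ n) {l l' : List (Fin n)}
    (h : ∀ γ ∈ posRoots n, γ ⬝ᵥ wact l (rho n) < 0)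
    (h' : ∀ γ ∈ posRoots n, γ ⬝ᵥ wact l' (rho n) < 0) : wact l = wact l' := by
  have hone : wact (l.reverse ++ l') = 1 := by
    refine wact_eq_one hn (inversions_eq_zero_iff.2 fun γ hγ => ?_)
    rw [wact_append, dot_wact, List.reverse_reverse]
    rcases wact_mem_posRoots_or hn l hγ with hl | hl
    · have hneg := h _ hl
      rw [wact_dot_wact hn] at hneg
      exact absurd (posRoots_dot_rho_pos hγ) hneg.asymm
    · have hneg := h' _ hl
      rw [neg_dotProduct] at hneg
      omega
  refine LinearMap.ext fun v => ?_
  have hv := wact_wact_reverse hn l (wact l' v)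
  rwa [← wact_append l.reverse, hone, Module.End.one_apply] at hv

theorem isReducedWord_of_antidominant (hn : 3 ≤ n) {w₀ : weylGroup n} (hw₀ : IsLongest w₀)
    {l : List (Fin n)} (hlen : l.length ≤ (posRoots n).card)
    (hl : ∀ γ ∈ posRoots n, γ ⬝ᵥ wact l (rho n) < 0) : IsReducedWord l w₀ := by
  obtain ⟨l₀, rfl⟩ := exists_word w₀
  have hmax := hw₀ (l.map s).prod
  rw [length_prod_s hn, length_prod_s hn, inversions_eq_card_iff.2 hl] at hmax
  have hl₀ := inversions_eq_card_iff.1 (le_antisymm (Finset.card_filter_le _ _) hmax)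
  refine (isReducedWord_iff hn).2 ⟨(prod_s_eq_iff hn _ _).2 (wact_eq_of_antidominant hn hl hl₀),
    le_antisymm ?_ (inversions_wact_rho_le hn l)⟩
  rwa [inversions_eq_card_iff.2 hl]

/-! ### Representatives of Weyl group elements -/

/-- The number of positive roots that are negative on `y` and pair to `1` with half of `v`. For
`y = wρ` and `v` twice a weight of `V`, this is the exponent of the sign with which `w̄` maps into
the weight space of `v / 2`. -/
def signExp (v y : Fin n → ℤ) : ℕ :=
  ((posRoots n).filter fun γ => γ ⬝ᵥ y < 0 ∧ γ ⬝ᵥ v = 2).card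

theorem signExp_refl (hn : 3 ≤ n) (i : Fin n) (v : Fin n → ℤ) {y : Fin n → ℤ}
    (hy : 0 < epsRoot i ⬝ᵥ y) :
    signExp (refl i v) (refl i y) = signExp v y + if epsRoot i ⬝ᵥ v = -2 then 1 else 0 := by
  have hv := card_filter_posRoots hn i fun γ => γ ⬝ᵥ y < 0 ∧ γ ⬝ᵥ v = 2
  have hrefl := card_filter_posRoots hn i fun γ => γ ⬝ᵥ refl i y < 0 ∧ γ ⬝ᵥ refl i v = 2
  have hrest := card_filter_refl hn i fun γ => γ ⬝ᵥ y < 0 ∧ γ ⬝ᵥ v = 2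
  have hroot : (epsRoot i ⬝ᵥ refl i y < 0 ∧ epsRoot i ⬝ᵥ refl i v = 2) ↔
      epsRoot i ⬝ᵥ v = -2 := by
    rw [epsRoot_dot_refl hn, epsRoot_dot_refl hn]
    omega
  simp only [← dot_refl] at hrest
  simp only [hroot] at hrefl
  rw [if_neg fun h => hy.asymm h.1] at hv
  rw [signExp, signExp, hrefl, hrest, hv, add_zero]

theorem signExp_rho (v : Fin n → ℤ) : signExp v (rho n) = 0 := by
  rw [signExp, Finset.card_eq_zero, Finset.filter_eq_empty_iff]
  exact fun γ hγ h => (posRoots_dot_rho_pos hγ).asymm h.1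

theorem exists_act_sBar (hn : 3 ≤ n) (i : Fin n) (b' : Idx n) :
    ∃ b, doubleWeight b' = refl i (doubleWeight b) ∧
      ∀ φ, act (sBar i) φ b' = (if corootPairing i b = -1 then -1 else 1) * φ b := by
  rcases raise_cases hn i b' with ⟨a, h⟩ | ⟨c, h⟩ | h
  · refine ⟨a, ?_, fun φ => ?_⟩
    · rw [refl_apply, epsRoot_dot_doubleWeight hn, h.corootPairing_right hn, h.doubleWeight_eq]
      module
    · rw [act_sBar_left hn h, h.corootPairing_right hn]
      simp
  · refine ⟨c, ?_, fun φ => ?_⟩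
    · rw [refl_apply, epsRoot_dot_doubleWeight hn, h.corootPairing_left hn, h.doubleWeight_eq]
      module
    · rw [act_sBar_right hn h, h.corootPairing_left hn]
      simp
  · refine ⟨b', ?_, fun φ => ?_⟩
    · rw [refl_apply, epsRoot_dot_doubleWeight hn, h]
      module
    · rw [act_sBar_of_zero hn h, h]
      simp

theorem epsRoot_dot_pos_of_cons (hn : 3 ≤ n) {i : Fin n} {l : List (Fin n)}
    (hl : (i :: l).length = inversions (wact (i :: l) (rho n))) :
    0 < epsRoot i ⬝ᵥ wact l (rho n) ∧ l.length = inversions (wact l (rho n)) := by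
  have hrefl := inversions_refl hn i (wact l (rho n))
  have hle := inversions_wact_rho_le hn l
  rw [wact_cons, List.length_cons] at hl
  split_ifs at hrefl <;> omega

theorem exists_act_prod_sBar (hn : 3 ≤ n) {l : List (Fin n)}
    (hl : l.length = inversions (wact l (rho n))) (b' : Idx n) :
    ∃ b, doubleWeight b' = wact l (doubleWeight b) ∧ ∀ φ, act (l.map sBar).prod φ b' =
      (-1) ^ signExp (doubleWeight b') (wact l (rho n)) * φ b := by
  induction l generalizing b' with
  | nil => exact ⟨b', rfl, fun φ => by simp [act_one, wact_nil, signExp_rho]⟩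
  | cons i l ih =>
    obtain ⟨hpos, hlen⟩ := epsRoot_dot_pos_of_cons hn hl
    obtain ⟨c, hc, hact⟩ := exists_act_sBar hn i b'
    obtain ⟨b, hb, hprod⟩ := ih hlen c
    refine ⟨b, by rw [wact_cons, ← hb, hc], fun φ => ?_⟩
    have hsign : (epsRoot i ⬝ᵥ doubleWeight c = -2) ↔ corootPairing i c = -1 := by
      rw [epsRoot_dot_doubleWeight hn]
      omega
    rw [List.map_cons, List.prod_cons, act_mul, hact, hprod, hc, wact_cons,
      signExp_refl hn i _ hpos, pow_add]
    simp only [hsign]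
    split_ifs <;> ring

theorem act_lift (hn : 3 ≤ n) {l : List (Fin n)} {w : weylGroup n} (hl : IsReducedWord l w)
    {b b' : Idx n} (hb : doubleWeight b' = wact l (doubleWeight b)) (φ : Idx n → ℂ) :
    act (lift w) φ b' = (-1) ^ signExp (doubleWeight b') (wact l (rho n)) * φ b := by
  have hw := (isReducedWord_iff hn).1 (isReducedWord_reducedWord w)
  have hwact : wact (reducedWord w) = wact l := (prod_s_eq_iff hn _ _).1 (hw.1.trans hl.1.symm)
  obtain ⟨c, hc, hact⟩ := exists_act_prod_sBar hn hw.2 b'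
  have hbc : b = c := doubleWeight_injective
    ((Function.LeftInverse.injective (wact_reverse_wact hn l)) (by rw [← hb, hc, hwact]))
  rw [lift, hact, hwact, hbc]

theorem lift_s (hn : 3 ≤ n) (k : Fin n) : lift (s k) = sBar k := by
  have hlen : [k].length = inversions (wact [k] (rho n)) := by
    have h := inversions_refl hn k (rho n)
    rw [epsRoot_dot_rho hn, inversions_rho] at h
    simpa [wact_cons, wact_nil] using h.symm
  have hk : IsReducedWord [k] (s k) := (isReducedWord_iff hn).2 ⟨by simp, hlen⟩
  refine ext_act fun φ b' => ?_
  obtain ⟨b, hb, hact⟩ := exists_act_prod_sBar hn hlen b'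
  rw [act_lift hn hk hb, ← hact]
  simp

theorem act_sBar_single_of_raise (hn : 3 ≤ n) {k : Fin n} {b a : Idx n} (h : Raise k b a) :
    act (sBar k) (Pi.single a 1) = Pi.single b 1 := by
  funext d
  rcases raise_cases hn k d with ⟨c, hc⟩ | ⟨c, hc⟩ | hc
  · have hiff : c = a ↔ d = b :=
      ⟨fun hca => hc.left_unique (hca ▸ h), fun hdb => (hdb ▸ hc).right_unique h⟩
    simp [act_sBar_left hn hc, Pi.single_apply, hiff]
  · have hca : c ≠ a := by rintro rfl; exact h.not_raise hc
    have hdb : d ≠ b := by rintro rfl; exact hc.not_raise h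
    simp [act_sBar_right hn hc, hca, hdb]
  · have hda : d ≠ a := by rintro rfl; simp [h.corootPairing_right hn] at hc
    have hdb : d ≠ b := by rintro rfl; simp [h.corootPairing_left hn] at hc
    simp [act_sBar_of_zero hn hc, hda, hdb]

theorem act_sBar_single_of_zero (hn : 3 ≤ n) {k : Fin n} {b : Idx n}
    (h : corootPairing k b = 0) : act (sBar k) (Pi.single b 1) = Pi.single b 1 := by
  have hleft {c d : Idx n} (hcd : Raise k c d) : c ≠ b := by
    rintro rfl; simp [hcd.corootPairing_left hn] at h
  have hright {c d : Idx n} (hcd : Raise k c d) : d ≠ b := by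
    rintro rfl; simp [hcd.corootPairing_right hn] at h
  funext d
  rcases raise_cases hn k d with ⟨c, hc⟩ | ⟨c, hc⟩ | hc
  · simp [act_sBar_left hn hc, hleft hc, hright hc]
  · simp [act_sBar_right hn hc, hleft hc, hright hc]
  · rw [act_sBar_of_zero hn hc]

/-! ### The cyclic word -/

theorem refl_of_succ (hn : 3 ≤ n) {i j : Fin n} (hj : j.val = i.val + 1) (v : Fin n → ℤ)
    (k : Fin n) : refl i v k = if k = i then v j else if k = j then v i else v k := by
  have hfst := refl_rootFst hn i v
  have hsnd := refl_rootSnd hn i v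
  rw [rootFst_of_succ hj, rootSnd_of_succ hj, rootSign_of_succ hj, neg_neg, one_mul] at hfst hsnd
  split_ifs with hi hj'
  · rw [hi, hfst]
  · rw [hj', hsnd]
  · exact refl_of_ne (by rwa [rootFst_of_succ hj]) (by rwa [rootSnd_of_succ hj]) v

theorem refl_of_last (hn : 3 ≤ n) {i j : Fin n} (hi : i.val + 1 = n) (hj : j.val + 1 = i.val)
    (v : Fin n → ℤ) (k : Fin n) :
    refl i v k = if k = i then -v j else if k = j then -v i else v k := by
  have hfst := refl_rootFst hn i v
  have hsnd := refl_rootSnd hn i v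
  rw [rootFst_of_last hi hj, rootSnd_of_last hi, rootSign_of_last hi, neg_one_mul] at hfst hsnd
  split_ifs with hi' hj'
  · rw [hi', hsnd]
  · rw [hj', hfst]
  · exact refl_of_ne (by rwa [rootFst_of_last hi hj]) (by rwa [rootSnd_of_last hi]) v

theorem drop_finRange {i : ℕ} (hi : i < n) :
    (List.finRange n).drop i = ⟨i, hi⟩ :: (List.finRange n).drop (i + 1) := by
  rw [List.drop_eq_getElem_cons (by simpa using hi)]
  simp

theorem wact_drop_finRange (hn : 3 ≤ n) (v : Fin n → ℤ) (d i : ℕ) (hd : i + d + 2 = n)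
    (j : Fin n) : wact ((List.finRange n).drop i) v j =
      if j.val + 1 = n then -v j else if j.val < i then v j else
        if j.val = i then -v ⟨n - 2, Nat.sub_lt j.pos two_pos⟩ else v ⟨j.val - 1, by omega⟩ := by
  induction d generalizing i j with
  | zero =>
    have hnil : (List.finRange n).drop (i + 1 + 1) = [] :=
      List.drop_eq_nil_of_le (by simp only [List.length_finRange]; omega)
    rw [drop_finRange (by omega), drop_finRange (by omega), hnil, wact_cons, wact_cons, wact_nil,
      refl_of_succ hn (j := ⟨i + 1, by omega⟩) rfl]
    simp only [refl_of_last hn (i := ⟨i + 1, by omega⟩) (j := ⟨i, by omega⟩) (by simp only; omega)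
      rfl, Fin.ext_iff]
    have := j.2
    grind
  | succ d ih =>
    rw [drop_finRange (by omega), wact_cons, refl_of_succ hn (j := ⟨i + 1, by omega⟩) rfl]
    simp only [ih (i + 1) (by omega), Fin.ext_iff]
    grind

theorem wact_finRange (hn : 3 ≤ n) (v : Fin n → ℤ) (j : Fin n) :
    wact (List.finRange n) v j =
      if j.val + 1 = n then -v j else
        if j.val = 0 then -v ⟨n - 2, Nat.sub_lt j.pos two_pos⟩ else v ⟨j.val - 1, by omega⟩ := by
  simpa using wact_drop_finRange hn v (n - 2) 0 (by omega) j

theorem wact_replicate_finRange (hn : 3 ≤ n) (v : Fin n → ℤ) {m : ℕ} (hm : m < n) (j : Fin n) :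
    wact (List.replicate m (List.finRange n)).flatten v j =
      if j.val + 1 = n then (-1) ^ m * v j else
        if hj : j.val < m then -v ⟨n - 1 + j.val - m, by omega⟩ else v ⟨j.val - m, by omega⟩ := by
  induction m generalizing j with
  | zero => simp [wact_nil]
  | succ m ih =>
    rw [List.replicate_succ, List.flatten_cons, wact_append, wact_finRange hn]
    simp only [ih (by omega)]
    clear ih
    by_cases hlast : j.val + 1 = n
    · rw [if_pos hlast, if_pos hlast, if_pos hlast, pow_succ']
      ring
    by_cases hj : j.val = 0
    · rw [if_neg hlast, if_pos hj, if_neg (by omega), dif_neg (by omega), if_neg hlast,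
        dif_pos (by omega)]
      congr 3
      omega
    rw [if_neg hlast, if_neg hj, if_neg (by omega), if_neg hlast]
    split_ifs
    · congr 3
      omega
    · omega
    · omega
    · congr 2
      omega

theorem wact_cyclicWord (hn : 3 ≤ n) (v : Fin n → ℤ) (j : Fin n) :
    wact (cyclicWord n) v j = (if j.val + 1 = n then (-1) ^ (n - 1) else -1) * v j := by
  rw [cyclicWord, wact_replicate_finRange hn v (by omega)]
  grind

theorem posRoots_dot_wact_cyclicWord_rho_neg (hn : 3 ≤ n) {γ : Fin n → ℤ}
    (hγ : γ ∈ posRoots n) : γ ⬝ᵥ wact (cyclicWord n) (rho n) < 0 := by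
  obtain ⟨a, b, t, hab, ht, rfl⟩ := mem_posRoots.1 hγ
  rw [single_add_single_dot, wact_cyclicWord hn, wact_cyclicWord hn, if_neg (by omega), rho, rho]
  split_ifs with hb
  · rw [show (n : ℤ) - 1 - b.val = 0 by omega]
    omega
  · rcases ht with rfl | rfl <;> omega

theorem isReducedWord_cyclicWord (hn : 3 ≤ n) {w₀ : weylGroup n} (hw₀ : IsLongest w₀) :
    IsReducedWord (cyclicWord n) w₀ := by
  refine isReducedWord_of_antidominant hn hw₀ (le_trans (le_of_eq ?_) mul_pred_le_card_posRoots)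
    fun γ hγ => posRoots_dot_wact_cyclicWord_rho_neg hn hγ
  simp [cyclicWord, mul_comm]

theorem signExp_cyclicWord (hn : 3 ≤ n) (v : Fin n → ℤ) :
    signExp v (wact (cyclicWord n) (rho n)) = ((posRoots n).filter fun γ => γ ⬝ᵥ v = 2).card :=
  congrArg _ (Finset.filter_congr fun γ hγ => by
    simp [posRoots_dot_wact_cyclicWord_rho_neg hn hγ])

theorem act_lift_longest (hn : 3 ≤ n) {w₀ : weylGroup n} (hw₀ : IsLongest w₀) {b b' : Idx n}
    (hb : ∀ j, doubleWeight b' j =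
      (if j.val + 1 = n then (-1) ^ (n - 1) else -1) * doubleWeight b j) (φ : Idx n → ℂ) :
    act (lift w₀) φ b' =
      (-1) ^ ((posRoots n).filter fun γ => γ ⬝ᵥ doubleWeight b' = 2).card * φ b := by
  rw [act_lift hn (isReducedWord_cyclicWord hn hw₀), signExp_cyclicWord hn]
  exact funext fun j => (hb j).trans (wact_cyclicWord hn _ j).symm

theorem filter_posRoots_dot_single (a : Fin n) :
    ((posRoots n).filter fun γ => γ ⬝ᵥ Pi.single a (-2) = 2) =
      (Finset.Iio a).image fun c => Pi.single c 1 + Pi.single a (-1) := by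
  ext γ
  simp only [Finset.mem_filter, Finset.mem_image, Finset.mem_Iio]
  constructor
  · rintro ⟨hγ, hdot⟩
    obtain ⟨c, b, t, hcb, ht, rfl⟩ := mem_posRoots.1 hγ
    rw [single_add_single_dot, Pi.single_apply, Pi.single_apply] at hdot
    obtain rfl : b = a := by grind
    rw [if_neg hcb.ne, if_pos rfl] at hdot
    obtain rfl : t = -1 := by omega
    exact ⟨c, hcb, rfl⟩
  · rintro ⟨c, hc, rfl⟩
    refine ⟨mem_posRoots.2 ⟨c, a, -1, hc, .inr rfl, rfl⟩, ?_⟩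
    rw [single_add_single_dot]
    simp [hc.ne]

theorem act_lift_longest_vec (hn : 3 ≤ n) {w₀ : weylGroup n} (hw₀ : IsLongest w₀) {a : Fin n}
    (ha : a.val + 1 < n) (φ : Idx n → ℂ) :
    act (lift w₀) φ (.inl (.inr a)) = (-1) ^ a.val * φ (.inl (.inl a)) := by
  have hinj : Function.Injective fun c : Fin n => (Pi.single c 1 + Pi.single a (-1) : Fin n → ℤ) :=
    fun c d h => by
      have h := congrFun (add_right_cancel h) c
      by_contra hcd
      simp [Pi.single_eq_of_ne hcd] at h
  rw [act_lift_longest hn hw₀ (b := .inl (.inl a)), doubleWeight, filter_posRoots_dot_single,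
    Finset.card_image_of_injective _ hinj, Fin.card_Iio]
  intro j
  by_cases hj : j = a
  · rw [hj, if_neg ha.ne]
    simp [doubleWeight]
  · simp [doubleWeight, hj]

/-- The basis vector of the spin modules with last sign `ε` and all other signs `δ`. For
`δ = true` it is a highest weight vector, for `δ = false` a lowest weight vector. -/
def spinVec (δ ε : Bool) : Idx n := .inr fun j => if j.val + 1 = n then ε else δ

theorem doubleWeight_spinVec (δ ε : Bool) (j : Fin n) : doubleWeight (spinVec δ ε) j =
    if j.val + 1 = n then if ε then 1 else -1 else if δ then 1 else -1 := by
  simp only [doubleWeight, spinVec]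
  split_ifs <;> rfl

theorem act_lift_longest_spin (hn : 3 ≤ n) {w₀ : weylGroup n} (hw₀ : IsLongest w₀) (ε : Bool)
    (φ : Idx n → ℂ) : act (lift w₀) φ (spinVec false (if Even (n - 1) then ε else !ε)) =
      φ (spinVec true ε) := by
  have hempty (ε' : Bool) : (posRoots n).filter
      (fun γ => γ ⬝ᵥ doubleWeight (spinVec false ε') = 2) = ∅ := by
    refine Finset.filter_eq_empty_iff.2 fun γ hγ => ?_
    obtain ⟨a, b, t, hab, ht, rfl⟩ := mem_posRoots.1 hγ
    rw [single_add_single_dot, doubleWeight_spinVec, doubleWeight_spinVec,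
      if_neg (show ¬ a.val + 1 = n by omega)]
    rcases ht with rfl | rfl <;> split_ifs <;> simp_all
  rw [act_lift_longest hn hw₀ (b := spinVec true ε), hempty, Finset.card_empty, pow_zero, one_mul]
  intro j
  rw [doubleWeight_spinVec, doubleWeight_spinVec]
  by_cases hj : j.val + 1 = n
  · by_cases he : Even (n - 1)
    · simp [hj, he]
    · cases ε <;> simp [hj, he, (Nat.not_even_iff_odd.1 he).neg_one_pow]
  · simp [hj]

theorem act_inv_eq_of_act_eq {g : G n} {a b : Idx n} {c : ℂ}
    (h : ∀ φ, act g φ b = c * φ a) (hc : c * c = 1) (φ : Idx n → ℂ) :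
    act g⁻¹ φ a = c * φ b := by
  have hφ := h (act g⁻¹ φ)
  rw [← act_mul, mul_inv_cancel, act_one] at hφ
  rw [hφ, ← mul_assoc, hc, one_mul]

/-! ### Generalized minors as determinants -/

theorem corootPairing_vec (hn : 3 ≤ n) (i a : Fin n) :
    corootPairing i (.inl (.inl a)) = epsRoot i a := by
  have h := epsRoot_dot_doubleWeight hn i (.inl (.inl a))
  simp only [doubleWeight, dotProduct_single] at h
  omega

theorem sum_single_castLE {m : ℕ} (hm : m ≤ n) (p : Fin n) :
    ∑ a : Fin m, (Pi.single p 1 : Fin n → ℤ) (a.castLE hm) = if p.val < m then 1 else 0 := by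
  split_ifs with hp
  · have hcast (a : Fin m) : a.castLE hm = p ↔ a = ⟨p.val, hp⟩ := by simp [Fin.ext_iff]
    simp [Pi.single_apply, hcast]
  · refine Finset.sum_eq_zero fun b _ => Pi.single_eq_of_ne (Fin.ne_of_val_ne ?_) _
    simp only [Fin.val_castLE]
    omega

/-- The first `m` vectors `v_1, …, v_m` of the basis of `V(Λ₁)`; their exterior product is a
highest weight vector of weight `Λ_m` for `m ≤ n - 2`. -/
def vecTop {m : ℕ} (hm : m ≤ n) (a : Fin m) : Idx n := .inl (.inl (a.castLE hm))

theorem raiseStable_vecTop {m : ℕ} (hm : m ≤ n) : RaiseStable (vecTop hm) := by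
  rintro i a ((c | c) | c) h
  · obtain ⟨rfl, ha⟩ : c = i ∧ a.val = i.val + 1 := h
    exact ⟨⟨c.val, by omega⟩, Fin.lt_def.2 (by simp only; omega), rfl⟩
  all_goals exact h.elim

theorem vecTop_isPrincipalMinor (hn : 3 ≤ n) (k : Fin n) (hk : k.val + 2 < n) :
    IsPrincipalMinor (fundamentalWeight k) (minorOf (vecTop (Nat.succ_le_of_lt k.2))) := by
  refine minorOf_isPrincipalMinor hn (fun a b h => ?_) (raiseStable_vecTop _) fun i => ?_
  · simpa [vecTop, Fin.ext_iff] using h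
  · simp only [vecTop, corootPairing_vec hn, fundamentalWeight, Pi.single_apply, Fin.ext_iff]
    obtain ⟨j, hj⟩ | ⟨hi, j, hj⟩ := node_cases hn i
    · simp only [epsRoot_of_succ hj, Pi.sub_apply, Finset.sum_sub_distrib, sum_single_castLE]
      split_ifs <;> omega
    · simp only [epsRoot_of_last hi hj, Pi.add_apply, Finset.sum_add_distrib, sum_single_castLE]
      split_ifs <;> omega

/-- The coefficient of `v_a` in a vector of the module, extended by `0` to all `a : ℕ`. -/
def vecCoord (φ : Idx n → ℂ) (a : ℕ) : ℂ :=
  if h : 1 ≤ a ∧ a ≤ n then φ (.inl (.inl ⟨a - 1, by omega⟩)) else 0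

/-- The coefficient of `v_{\bar a}` in a vector of the module, extended by `0` to all `a : ℕ`. -/
def barCoord (φ : Idx n → ℂ) (a : ℕ) : ℂ :=
  if h : 1 ≤ a ∧ a ≤ n then φ (.inl (.inr ⟨a - 1, by omega⟩)) else 0

/-- The basis vector `v_p`, with `p` in `1, …, n`. -/
def vecBasis (n p : ℕ) : Idx n → ℂ
  | .inl (.inl a) => if a.val + 1 = p then 1 else 0
  | _ => 0

theorem vecCoord_succ (φ : Idx n → ℂ) {a : ℕ} (ha : a < n) :
    vecCoord φ (a + 1) = φ (.inl (.inl ⟨a, ha⟩)) :=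
  dif_pos ⟨by omega, ha⟩

theorem barCoord_succ (φ : Idx n → ℂ) {a : ℕ} (ha : a < n) :
    barCoord φ (a + 1) = φ (.inl (.inr ⟨a, ha⟩)) :=
  dif_pos ⟨by omega, ha⟩

theorem vecBasis_succ {p : ℕ} (hp : p < n) :
    vecBasis n (p + 1) = Pi.single (.inl (.inl ⟨p, hp⟩)) 1 := by
  funext b
  rcases b with (b | b) | b <;> simp [vecBasis, Pi.single_apply, Fin.ext_iff]

theorem act_sBar_vecTop (hn : 3 ≤ n) (k : Fin n) (hk : k.val + 2 < n) (b : Fin (k.val + 1)) :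
    act (sBar k) (Pi.single (vecTop (Nat.succ_le_of_lt k.2) b) 1) =
      vecBasis n (if b.val = k.val then b.val + 2 else b.val + 1) := by
  split_ifs with h
  · rw [vecBasis_succ (by omega : b.val + 1 < n)]
    exact act_sBar_single_of_raise hn ⟨Fin.ext h, congrArg (· + 1) h⟩
  · rw [vecBasis_succ (by omega : b.val < n), vecTop]
    refine act_sBar_single_of_zero hn ?_
    rw [corootPairing_vec hn, epsRoot_of_succ (j := ⟨k.val + 1, by omega⟩) rfl]
    simp only [Pi.sub_apply, Pi.single_apply, Fin.ext_iff, Fin.val_castLE]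
    rw [if_neg h, if_neg (by omega), sub_zero]

theorem generalizedMinor_vec (hn : 3 ≤ n) {w₀ : weylGroup n} (hw₀ : IsLongest w₀) (k : Fin n)
    (hk : k.val + 2 < n) (g : G n) :
    generalizedMinor (fundamentalWeight k) w₀ (s k) g =
      (of fun a b : Fin (k.val + 1) => (-1 : ℂ) ^ a.val *
        barCoord (act g (vecBasis n (if b.val = k.val then b.val + 2 else b.val + 1)))
          (a.val + 1)).det := by
  rw [generalizedMinor, principalMinor_eq hn (vecTop_isPrincipalMinor hn k hk), lift_s hn, minorOf]
  congr 1
  ext a b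
  rw [submatrix_apply, ← act_single, act_mul, act_mul, of_apply, act_sBar_vecTop hn k hk,
    barCoord_succ _ (by omega : a.val < n)]
  refine act_inv_eq_of_act_eq (act_lift_longest_vec hn hw₀ (a := a.castLE _) ?_) ?_ _
  · simp only [Fin.val_castLE]
    omega
  · rw [← mul_pow]
    simp

/-- The spin node `n` for `ε = true` and `n - 1` for `ε = false`: the fundamental module of
this node has highest weight vector `spinVec true ε`. -/
def spinNode (hn : 3 ≤ n) (ε : Bool) : Fin n :=
  ⟨if ε then n - 1 else n - 2, by grind⟩

/-- The image of the highest weight vector `spinVec true ε` under its simple reflection. -/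
def spinTarget (ε : Bool) : Idx n :=
  .inr fun j => if j.val + 1 = n then !ε else if j.val + 2 = n then false else true

theorem corootPairing_spinVec (hn : 3 ≤ n) (i : Fin n) (ε : Bool) :
    corootPairing i (spinVec true ε) = fundamentalWeight (spinNode hn ε) i := by
  have h := epsRoot_dot_doubleWeight hn i (spinVec true ε)
  simp only [fundamentalWeight, spinNode, Pi.single_apply, Fin.ext_iff]
  obtain ⟨j, hj⟩ | ⟨hi, j, hj⟩ := node_cases hn i
  · simp only [epsRoot_of_succ hj, sub_dotProduct, single_one_dotProduct, doubleWeight_spinVec] at h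
    cases ε <;> simp at h ⊢ <;> split_ifs at h ⊢ <;> omega
  · simp only [epsRoot_of_last hi hj, add_dotProduct, single_one_dotProduct,
      doubleWeight_spinVec] at h
    cases ε <;> simp at h ⊢ <;> split_ifs at h ⊢ <;> omega

theorem spin_isPrincipalMinor (hn : 3 ≤ n) (ε : Bool) :
    IsPrincipalMinor (fundamentalWeight (spinNode hn ε))
      (minorOf fun _ : Fin 1 => (spinVec true ε : Idx n)) := by
  refine minorOf_isPrincipalMinor hn (Function.injective_of_subsingleton _) (fun i a c h => ?_)
    fun i => ?_
  · have := h.corootPairing_left hn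
    rw [corootPairing_spinVec hn] at this
    omega
  · simp [corootPairing_spinVec hn]

theorem raise_spinTarget (hn : 3 ≤ n) (ε : Bool) :
    Raise (spinNode hn ε) (spinTarget ε) (spinVec true ε) := by
  cases ε
  · refine .inl ⟨⟨n - 1, by omega⟩, ?_, ?_, ?_, funext fun j => ?_⟩ <;>
      simp [spinNode, Function.update_apply, Fin.ext_iff] <;> grind
  · refine .inr ⟨?_, ⟨n - 2, by omega⟩, ?_, ?_, ?_, funext fun j => ?_⟩ <;>
      simp [spinNode, Function.update_apply, Fin.ext_iff] <;> grind

theorem generalizedMinor_spin (hn : 3 ≤ n) {w₀ : weylGroup n} (hw₀ : IsLongest w₀)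
    (ε : Bool) (g : G n) :
    generalizedMinor (fundamentalWeight (spinNode hn ε)) w₀ (s (spinNode hn ε)) g =
      act g (Pi.single (spinTarget ε) 1) (spinVec false (if Even (n - 1) then ε else !ε)) := by
  rw [generalizedMinor, principalMinor_eq hn (spin_isPrincipalMinor hn ε), lift_s hn, minorOf,
    det_unique, submatrix_apply, ← act_single, act_mul, act_mul,
    act_sBar_single_of_raise hn (raise_spinTarget hn ε)]
  simpa using act_inv_eq_of_act_eq (c := 1) (a := spinVec true ε)
    (fun φ => by rw [act_lift_longest_spin hn hw₀, one_mul]) (one_mul 1) _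

theorem exists_isPrincipalMinor (hn : 3 ≤ n) (k : Fin n) :
    ∃ F : G n → ℂ, IsPrincipalMinor (fundamentalWeight k) F := by
  obtain hk | rfl | rfl : k.val + 2 < n ∨ k = spinNode hn true ∨ k = spinNode hn false := by
    simp only [spinNode, Fin.ext_iff, if_true, Bool.false_eq_true, if_false]
    omega
  · exact ⟨_, vecTop_isPrincipalMinor hn k hk⟩
  · exact ⟨_, spin_isPrincipalMinor hn true⟩
  · exact ⟨_, spin_isPrincipalMinor hn false⟩

/-! ### Blocks of the factorization -/

/-- The product `𝐲_{i+1}(d_{i+1}) ⋯ 𝐲_n(d_n)`. -/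
def blockFrom (n : ℕ) (d : ℕ → ℂ) (i : ℕ) : G n :=
  (((List.finRange n).drop i).map fun j => yBold j (d (j.val + 1))).prod

theorem blockFrom_eq_mul (d : ℕ → ℂ) (i : Fin n) :
    blockFrom n d i = yBold i (d (i.val + 1)) * blockFrom n d (i.val + 1) := by
  rw [blockFrom, drop_finRange i.2, List.map_cons, List.prod_cons, blockFrom]

theorem blockFrom_self (d : ℕ → ℂ) : blockFrom n d n = 1 := by
  rw [blockFrom, List.drop_eq_nil_of_le (by simp), List.map_nil, List.prod_nil]

/-- The product of the blocks with superscripts `t + 1, …, n - 1`. -/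
def thetaTail (n : ℕ) (c : ℕ → ℕ → ℂ) (t : ℕ) : G n :=
  (((List.range (n - 1)).drop t).map fun l => blockFrom n (c (l + 1)) 0).prod

theorem thetaTail_eq_mul (c : ℕ → ℕ → ℂ) {t : ℕ} (ht : t + 1 < n) :
    thetaTail n c t = blockFrom n (c (t + 1)) 0 * thetaTail n c (t + 1) := by
  rw [thetaTail, List.drop_eq_getElem_cons (by simp only [List.length_range]; omega), List.map_cons,
    List.prod_cons, List.getElem_range, thetaTail]

theorem thetaTail_pred (c : ℕ → ℕ → ℂ) : thetaTail n c (n - 1) = 1 := by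
  rw [thetaTail, List.drop_eq_nil_of_le (by simp), List.map_nil, List.prod_nil]

theorem thetaMinus_flatMap (c : ℕ → ℕ → ℂ) (L : List ℕ) :
    thetaMinus (List.replicate L.length (List.finRange n)).flatten
      (L.flatMap fun l => (List.range n).map fun i => c (l + 1) (i + 1)) =
      (L.map fun l => blockFrom n (c (l + 1)) 0).prod := by
  induction L with
  | nil => rfl
  | cons l L ih =>
    rw [List.length_cons, List.replicate_succ, List.flatten_cons, List.flatMap_cons, thetaMinus,
      List.zipWith_append (by simp), List.prod_append, List.map_cons, List.prod_cons, ← ih]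
    congr 1
    rw [blockFrom, List.drop_zero, ← List.map_coe_finRange_eq_range, List.map_map,
      List.zipWith_map_right, List.zipWith_self]
    rfl

theorem thetaMinus_cyclicWord (c : ℕ → ℕ → ℂ) :
    thetaMinus (cyclicWord n) (cyclicParams n c) = thetaTail n c 0 := by
  have h := thetaMinus_flatMap (n := n) c (List.range (n - 1))
  rwa [List.length_range] at h

section Block

variable (hn : 3 ≤ n) {d : ℕ → ℂ} (hd : ∀ i, d i ≠ 0) (φ : Idx n → ℂ)

include hn hd

theorem act_blockFrom_left {i : Fin n} {b a : Idx n} (h : Raise i b a) :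
    act (blockFrom n d i) φ b =
      d (i.val + 1) * act (blockFrom n d (i.val + 1)) φ b +
        act (blockFrom n d (i.val + 1)) φ a := by
  rw [blockFrom_eq_mul, act_mul, act_yBold_left hn h (hd _)]

theorem act_blockFrom_of_ne {i : Fin n} {b : Idx n} (h : corootPairing i b ≠ -1) :
    act (blockFrom n d i) φ b = (d (i.val + 1))⁻¹ ^ corootPairing i b *
      act (blockFrom n d (i.val + 1)) φ b := by
  rw [blockFrom_eq_mul, act_mul, act_yBold_of_ne hn h (hd _)]

theorem act_blockFrom_of_one {i : Fin n} {b : Idx n} (h : corootPairing i b = 1) :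
    act (blockFrom n d i) φ b =
      (d (i.val + 1))⁻¹ * act (blockFrom n d (i.val + 1)) φ b := by
  rw [act_blockFrom_of_ne hn hd φ (by rw [h]; decide), h, zpow_one]

theorem act_blockFrom_skip {b : Idx n} {i j : ℕ} (hij : i ≤ j) (hj : j ≤ n)
    (h : ∀ m : Fin n, i ≤ m.val → m.val < j → corootPairing m b = 0) :
    act (blockFrom n d i) φ b = act (blockFrom n d j) φ b := by
  induction j, hij using Nat.le_induction with
  | base => rfl
  | succ j hij ih =>
    have h0 : corootPairing ⟨j, hj⟩ b = 0 := h ⟨j, hj⟩ hij (Nat.lt_succ_self j)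
    rw [ih (by omega) fun m hm hmj => h m hm (by omega),
      act_blockFrom_of_ne hn hd φ (i := ⟨j, hj⟩) (by rw [h0]; decide), h0, zpow_zero, one_mul]

theorem act_blockFrom_eq_self {b : Idx n} {i : ℕ} (hi : i ≤ n)
    (h : ∀ m : Fin n, i ≤ m.val → corootPairing m b = 0) :
    act (blockFrom n d i) φ b = φ b := by
  rw [act_blockFrom_skip hn hd φ hi le_rfl fun m hm _ => h m hm, blockFrom_self, act_one]

end Block

/-! ### Action of a block on the vector representation -/

theorem corootPairing_vec_eq_ite (hn : 3 ≤ n) (i a : Fin n) : corootPairing i (.inl (.inl a)) =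
    if i.val + 1 = n then if n ≤ a.val + 2 then 1 else 0 else if a.val = i.val then 1 else
      if a.val = i.val + 1 then -1 else 0 := by
  rw [corootPairing_vec hn, epsRoot, Pi.add_apply, Pi.single_apply, Pi.single_apply, rootSign]
  simp only [Fin.ext_iff, rootFst_val, rootSnd_val]
  split_ifs <;> omega

theorem corootPairing_bar (hn : 3 ≤ n) (i a : Fin n) :
    corootPairing i (.inl (.inr a)) = -corootPairing i (.inl (.inl a)) :=
  corootPairing_neg hn i (.inl (.inl a))

theorem vecCoord_val_succ (φ : Idx n → ℂ) (a : Fin n) :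
    vecCoord φ (a.val + 1) = φ (.inl (.inl a)) :=
  vecCoord_succ φ a.2

theorem barCoord_val_succ (φ : Idx n → ℂ) (a : Fin n) :
    barCoord φ (a.val + 1) = φ (.inl (.inr a)) :=
  barCoord_succ φ a.2

section BlockVec

variable (hn : 3 ≤ n) {d : ℕ → ℂ} (hd : ∀ i, d i ≠ 0) (φ : Idx n → ℂ)

include hn hd

theorem act_blockFrom_succ_vec {a : Fin n} (ha : a.val + 2 < n) :
    act (blockFrom n d (a.val + 1)) φ (.inl (.inl a)) = φ (.inl (.inl a)) :=
  act_blockFrom_eq_self hn hd φ a.2 fun m hm => by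
    rw [corootPairing_vec_eq_ite hn]; split_ifs <;> omega

theorem act_blockFrom_vec_self {a : Fin n} (ha : a.val + 2 < n) :
    act (blockFrom n d a) φ (.inl (.inl a)) = (d (a.val + 1))⁻¹ * φ (.inl (.inl a)) := by
  rw [act_blockFrom_of_one hn hd φ, act_blockFrom_succ_vec hn hd φ ha]
  rw [corootPairing_vec_eq_ite hn, if_neg (by omega), if_pos rfl]

theorem act_blockFrom_vec_last {i a : Fin n} (hi : i.val + 1 = n) (ha : n ≤ a.val + 2) :
    act (blockFrom n d i) φ (.inl (.inl a)) = (d n)⁻¹ * φ (.inl (.inl a)) := by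
  rw [act_blockFrom_of_one hn hd φ, hi, blockFrom_self, act_one]
  rw [corootPairing_vec_eq_ite hn, if_pos hi, if_pos ha]

theorem act_block_vec {a b : Fin n} (hb : b.val = a.val + 1) :
    act (blockFrom n d 0) φ (.inl (.inl b)) =
      d b.val * act (blockFrom n d b) φ (.inl (.inl b)) +
        act (blockFrom n d b) φ (.inl (.inl a)) := by
  have hraise : Raise a (.inl (.inl b)) (.inl (.inl a)) := ⟨rfl, hb⟩
  rw [act_blockFrom_skip hn hd φ (Nat.zero_le a.val) a.2.le fun m _ hm => by
    rw [corootPairing_vec_eq_ite hn]; split_ifs <;> omega, act_blockFrom_left hn hd φ hraise, hb]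

theorem vecCoord_block {a : ℕ} (ha : 1 ≤ a) (han : a + 3 ≤ n) :
    vecCoord (act (blockFrom n d 0) φ) (a + 1) =
      d a / d (a + 1) * vecCoord φ (a + 1) + vecCoord φ a := by
  obtain ⟨a, rfl⟩ := Nat.exists_eq_add_of_le' ha
  have h := act_block_vec hn hd φ (a := ⟨a, by omega⟩) (b := ⟨a + 1, by omega⟩) rfl
  have hself := act_blockFrom_vec_self hn hd φ (a := ⟨a + 1, by omega⟩) (by simp only; omega)
  have hpred := act_blockFrom_succ_vec hn hd φ (a := ⟨a, by omega⟩) (by simp only; omega)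
  simp only [← vecCoord_val_succ] at h hself hpred
  rw [hself, hpred] at h
  rw [h]
  ring

theorem vecCoord_block_pred : vecCoord (act (blockFrom n d 0) φ) (n - 1) =
    d (n - 2) / (d (n - 1) * d n) * vecCoord φ (n - 1) + vecCoord φ (n - 2) := by
  obtain ⟨m, rfl⟩ := Nat.exists_eq_add_of_le' hn
  have h := act_block_vec hn hd φ (a := ⟨m, by omega⟩) (b := ⟨m + 1, by omega⟩) rfl
  rw [act_blockFrom_of_one hn hd φ (i := ⟨m + 1, by omega⟩) (by
      rw [corootPairing_vec_eq_ite hn, if_neg (by simp), if_pos rfl]),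
    act_blockFrom_vec_last hn hd φ (i := ⟨m + 2, by omega⟩) rfl (by simp)] at h
  have hpred := act_blockFrom_succ_vec hn hd φ (a := ⟨m, by omega⟩) (by simp)
  simp only [← vecCoord_val_succ] at h hpred
  rw [hpred] at h
  simp only [show m + 3 - 1 = m + 2 by omega, show m + 3 - 2 = m + 1 by omega]
  rw [h, div_eq_mul_inv, mul_inv]
  ring

theorem vecCoord_block_last : vecCoord (act (blockFrom n d 0) φ) n =
    d (n - 1) / d n * vecCoord φ n + (d n)⁻¹ * vecCoord φ (n - 1) := by
  obtain ⟨m, rfl⟩ := Nat.exists_eq_add_of_le' hn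
  have h := act_block_vec hn hd φ (a := ⟨m + 1, by omega⟩) (b := ⟨m + 2, by omega⟩) rfl
  rw [act_blockFrom_vec_last hn hd φ rfl (by simp),
    act_blockFrom_vec_last hn hd φ rfl (by simp)] at h
  simp only [← vecCoord_val_succ] at h
  simp only [show m + 3 - 1 = m + 2 by omega]
  rw [h]
  ring

theorem act_blockFrom_succ_bar {a : Fin n} (ha : a.val + 2 < n) :
    act (blockFrom n d (a.val + 1)) φ (.inl (.inr a)) = φ (.inl (.inr a)) :=
  act_blockFrom_eq_self hn hd φ a.2 fun m hm => by
    rw [corootPairing_bar hn, corootPairing_vec_eq_ite hn]; split_ifs <;> omega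

theorem mul_act_block_bar (hd₀ : d 0 = 1) (a : Fin n) :
    d a.val * act (blockFrom n d 0) φ (.inl (.inr a)) =
      act (blockFrom n d a) φ (.inl (.inr a)) := by
  obtain ha | ⟨b, hb⟩ : a.val = 0 ∨ ∃ b : Fin n, a.val = b.val + 1 :=
    (Nat.eq_zero_or_pos a.val).imp_right fun h => ⟨⟨a.val - 1, by omega⟩, by simp only; omega⟩
  · rw [ha, hd₀, one_mul]
  · rw [act_blockFrom_skip hn hd φ (Nat.zero_le b.val) b.2.le fun m _ hm => by
        rw [corootPairing_bar hn, corootPairing_vec_eq_ite hn]; split_ifs <;> omega,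
      act_blockFrom_of_one hn hd φ (by
        rw [corootPairing_bar hn, corootPairing_vec_eq_ite hn]; split_ifs <;> omega),
      hb, mul_inv_cancel_left₀ (hd _)]

theorem mul_barCoord_block (hd₀ : d 0 = 1) {a : ℕ} (ha : a + 2 < n) :
    d a * barCoord (act (blockFrom n d 0) φ) (a + 1) =
      d (a + 1) * barCoord φ (a + 1) +
        d (a + 1) * barCoord (act (blockFrom n d 0) φ) (a + 2) := by
  have hraise : Raise (⟨a, by omega⟩ : Fin n) (.inl (.inr ⟨a, by omega⟩))
    (.inl (.inr ⟨a + 1, by omega⟩)) := ⟨rfl, rfl⟩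
  have h := mul_act_block_bar hn hd φ hd₀ ⟨a, by omega⟩
  have h' := mul_act_block_bar hn hd φ hd₀ ⟨a + 1, by omega⟩
  have hself := act_blockFrom_succ_bar hn hd φ (a := ⟨a, by omega⟩) ha
  rw [act_blockFrom_left hn hd φ hraise] at h
  simp only [← barCoord_val_succ] at h h' hself
  rw [h, hself, ← h']

theorem mul_barCoord_block_pred (hd₀ : d 0 = 1) :
    d (n - 2) * barCoord (act (blockFrom n d 0) φ) (n - 1) =
      d (n - 1) * d n * barCoord φ (n - 1) + d (n - 1) * vecCoord φ n + d n * barCoord φ n +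
        vecCoord φ (n - 1) := by
  obtain ⟨m, rfl⟩ := Nat.exists_eq_add_of_le' hn
  have hraise : Raise (⟨m + 1, by omega⟩ : Fin (m + 3)) (.inl (.inr ⟨m + 1, by omega⟩))
    (.inl (.inr ⟨m + 2, by omega⟩)) := ⟨rfl, rfl⟩
  have hraise' : Raise (⟨m + 2, by omega⟩ : Fin (m + 3)) (.inl (.inr ⟨m + 1, by omega⟩))
    (.inl (.inl ⟨m + 2, by omega⟩)) := ⟨rfl, .inl ⟨rfl, rfl⟩⟩
  have hraise'' : Raise (⟨m + 2, by omega⟩ : Fin (m + 3)) (.inl (.inr ⟨m + 2, by omega⟩))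
    (.inl (.inl ⟨m + 1, by omega⟩)) := ⟨rfl, .inr ⟨rfl, rfl⟩⟩
  have h := mul_act_block_bar hn hd φ hd₀ ⟨m + 1, by omega⟩
  rw [act_blockFrom_left hn hd φ hraise, act_blockFrom_left hn hd φ hraise',
    act_blockFrom_left hn hd φ hraise'', blockFrom_self, act_one] at h
  simp only [← barCoord_val_succ, ← vecCoord_val_succ] at h
  simp only [show m + 3 - 1 = m + 2 by omega, show m + 3 - 2 = m + 1 by omega]
  rw [h]
  ring

theorem mul_barCoord_block_last (hd₀ : d 0 = 1) :
    d (n - 1) * barCoord (act (blockFrom n d 0) φ) n =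
      d n * barCoord φ n + vecCoord φ (n - 1) := by
  obtain ⟨m, rfl⟩ := Nat.exists_eq_add_of_le' hn
  have hraise : Raise (⟨m + 2, by omega⟩ : Fin (m + 3)) (.inl (.inr ⟨m + 2, by omega⟩))
    (.inl (.inl ⟨m + 1, by omega⟩)) := ⟨rfl, .inr ⟨rfl, rfl⟩⟩
  have h := mul_act_block_bar hn hd φ hd₀ ⟨m + 2, by omega⟩
  rw [act_blockFrom_left hn hd φ hraise, blockFrom_self, act_one] at h
  simp only [← barCoord_val_succ, ← vecCoord_val_succ] at h
  exact h

theorem barCoord_block_one (hd₀ : d 0 = 1) :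
    barCoord (act (blockFrom n d 0) φ) 1 =
      ∑ j ∈ Finset.range (n - 2), d (j + 1) * barCoord φ (j + 1) +
        (d (n - 1) * d n * barCoord φ (n - 1) + d (n - 1) * vecCoord φ n + d n * barCoord φ n +
          vecCoord φ (n - 1)) := by
  have htel := Finset.sum_range_sub'
    (fun j => d j * barCoord (act (blockFrom n d 0) φ) (j + 1)) (n - 2)
  rw [Finset.sum_congr rfl fun j hj => sub_eq_of_eq_add
    (mul_barCoord_block hn hd φ hd₀ (Nat.add_lt_of_lt_sub (Finset.mem_range.1 hj))), hd₀,
    show n - 2 + 1 = n - 1 by omega, mul_barCoord_block_pred hn hd φ hd₀] at htel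
  rw [htel]
  ring

end BlockVec

/-! ### Columns of the factorization in the vector representation -/

/-- The function `φ` on the weight basis has leading vector `v_p` with coefficient `1`: its
coordinates at `v_{p+1}, …, v_n` and at all the `v̄_a` vanish. -/
structure IsMonic (p : ℕ) (φ : Idx n → ℂ) : Prop where
  vecCoord_eq_one : vecCoord φ p = 1
  vecCoord_eq_zero : ∀ a, p < a → vecCoord φ a = 0
  barCoord_eq_zero : ∀ a, barCoord φ a = 0

theorem isMonic_vecBasis {p : ℕ} (hp : 1 ≤ p) (hpn : p ≤ n) : IsMonic p (vecBasis n p) := by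
  obtain ⟨p, rfl⟩ := Nat.exists_eq_add_of_le' hp
  refine ⟨?_, fun a ha => ?_, fun a => ?_⟩
  · rw [vecCoord_succ _ hpn, vecBasis_succ hpn, Pi.single_eq_same]
  · simp only [vecCoord, vecBasis]
    split_ifs <;> first | rfl | omega
  · simp only [barCoord, vecBasis]
    split_ifs <;> rfl

section MonicBlock

variable (hn : 3 ≤ n) {d : ℕ → ℂ} (hd : ∀ i, d i ≠ 0)

include hn hd

theorem mul_barCoord_block_of_barCoord_eq_zero (hd₀ : d 0 = 1) {φ : Idx n → ℂ}
    (hφ : ∀ a, barCoord φ a = 0) {a : ℕ} (ha : a + 2 ≤ n) :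
    d a * barCoord (act (blockFrom n d 0) φ) (a + 1) =
      d (n - 1) * vecCoord φ n + vecCoord φ (n - 1) := by
  have ha' : a ≤ n - 2 := Nat.le_sub_of_add_le ha
  induction ha' using Nat.decreasingInduction with
  | self =>
    rw [show n - 2 + 1 = n - 1 by omega, mul_barCoord_block_pred hn hd φ hd₀, hφ, hφ]
    ring
  | of_succ a han ih =>
    rw [mul_barCoord_block hn hd φ hd₀ (by omega), hφ, mul_zero, zero_add, ih (by omega)]

theorem IsMonic.act_block (hd₀ : d 0 = 1) {p : ℕ} {φ : Idx n → ℂ} (hφ : IsMonic p φ)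
    (hp : 1 ≤ p) (hpn : p + 2 ≤ n) : IsMonic (p + 1) (act (blockFrom n d 0) φ) := by
  have hpred : vecCoord φ (n - 1) = 0 := hφ.vecCoord_eq_zero _ (by omega)
  have hlast : vecCoord φ n = 0 := hφ.vecCoord_eq_zero _ (by omega)
  refine ⟨?_, fun a ha => ?_, fun a => ?_⟩
  · obtain hp3 | hp3 : p + 3 ≤ n ∨ p + 1 = n - 1 := by omega
    · rw [vecCoord_block hn hd φ hp hp3, hφ.vecCoord_eq_zero _ p.lt_succ_self, mul_zero, zero_add,
        hφ.vecCoord_eq_one]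
    · rw [hp3, vecCoord_block_pred hn hd φ, hpred, mul_zero, zero_add, show n - 2 = p by omega,
        hφ.vecCoord_eq_one]
  · obtain ⟨a, rfl⟩ : ∃ b, a = b + 1 := ⟨a - 1, by omega⟩
    obtain han | han | han | han : a + 3 ≤ n ∨ a + 1 = n - 1 ∨ a + 1 = n ∨ n < a + 1 := by omega
    · rw [vecCoord_block hn hd φ (by omega) han, hφ.vecCoord_eq_zero _ (by omega),
        hφ.vecCoord_eq_zero _ (by omega), mul_zero, add_zero]
    · rw [han, vecCoord_block_pred hn hd φ, hpred, hφ.vecCoord_eq_zero _ (by omega), mul_zero,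
        add_zero]
    · rw [han, vecCoord_block_last hn hd φ, hpred, hlast, mul_zero, mul_zero, add_zero]
    · exact dif_neg (by omega)
  · obtain rfl | ⟨a, rfl⟩ : a = 0 ∨ ∃ b, a = b + 1 := by
      rcases a with _ | a <;> simp
    · exact dif_neg (by omega)
    obtain han | han | han : a + 2 ≤ n ∨ a + 1 = n ∨ n < a + 1 := by omega
    · refine (mul_eq_zero.1 ?_).resolve_left (hd a)
      rw [mul_barCoord_block_of_barCoord_eq_zero hn hd hd₀ hφ.barCoord_eq_zero han, hpred, hlast,
        mul_zero, add_zero]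
    · refine (mul_eq_zero.1 ?_).resolve_left (hd (n - 1))
      rw [han, mul_barCoord_block_last hn hd φ hd₀, hφ.barCoord_eq_zero, hpred, mul_zero, add_zero]
    · exact dif_neg (by omega)

theorem IsMonic.mul_barCoord_block (hd₀ : d 0 = 1) {φ : Idx n → ℂ} (hφ : IsMonic (n - 1) φ)
    {a : ℕ} (ha : a + 2 ≤ n) : d a * barCoord (act (blockFrom n d 0) φ) (a + 1) = 1 := by
  rw [mul_barCoord_block_of_barCoord_eq_zero hn hd hd₀ hφ.barCoord_eq_zero ha,
    hφ.vecCoord_eq_zero n (by omega), hφ.vecCoord_eq_one, mul_zero, zero_add]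

theorem IsMonic.barCoord_block_block (hd₀ : d 0 = 1) {e : ℕ → ℂ} (he : ∀ i, e i ≠ 0)
    (he₀ : e 0 = 1) {φ : Idx n → ℂ} (hφ : IsMonic (n - 1) φ) :
    barCoord (act (blockFrom n e 0) (act (blockFrom n d 0) φ)) 1 =
      ∑ j ∈ Finset.range (n - 2), e (j + 1) / d j +
        (e (n - 1) * e n / d (n - 2) + e (n - 1) / d n + e n / d (n - 1) +
          (d (n - 2) / (d (n - 1) * d n) + vecCoord φ (n - 2))) := by
  have hbar {a : ℕ} (ha : a + 2 ≤ n) : barCoord (act (blockFrom n d 0) φ) (a + 1) = (d a)⁻¹ :=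
    eq_inv_of_mul_eq_one_right (hφ.mul_barCoord_block hn hd hd₀ ha)
  have hbarpred : barCoord (act (blockFrom n d 0) φ) (n - 1) = (d (n - 2))⁻¹ := by
    rw [← hbar (a := n - 2) (by omega), show n - 2 + 1 = n - 1 by omega]
  have hbarlast : barCoord (act (blockFrom n d 0) φ) n = (d (n - 1))⁻¹ := by
    refine eq_inv_of_mul_eq_one_right ?_
    rw [mul_barCoord_block_last hn hd φ hd₀, hφ.barCoord_eq_zero, hφ.vecCoord_eq_one, mul_zero,
      zero_add]
  rw [barCoord_block_one hn he _ he₀, hbarpred, hbarlast, vecCoord_block_last hn hd φ,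
    vecCoord_block_pred hn hd φ, hφ.vecCoord_eq_one, hφ.vecCoord_eq_zero n (by omega),
    Finset.sum_congr rfl fun j hj => by
      rw [hbar (show j + 2 ≤ n by have := Finset.mem_range.1 hj; omega), ← div_eq_mul_inv]]
  ring

end MonicBlock

/-- The column with index `v_p` of the product of the blocks with superscripts
`t + 1, …, n - 1`. -/
def column (n : ℕ) (c : ℕ → ℕ → ℂ) (p t : ℕ) : Idx n → ℂ := act (thetaTail n c t) (vecBasis n p)

theorem column_eq_act_block (c : ℕ → ℕ → ℂ) (p : ℕ) {t : ℕ} (ht : t + 1 < n) :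
    column n c p t = act (blockFrom n (c (t + 1)) 0) (column n c p (t + 1)) := by
  rw [column, thetaTail_eq_mul c ht, act_mul, column]

theorem column_pred (c : ℕ → ℕ → ℂ) (p : ℕ) : column n c p (n - 1) = vecBasis n p := by
  rw [column, thetaTail_pred, act_one]

section Column

variable (hn : 3 ≤ n) {c : ℕ → ℕ → ℂ} (hc : ∀ l i, c l i ≠ 0) (hc₀ : ∀ l, c l 0 = 1)

include hn hc hc₀

theorem isMonic_column {p t m : ℕ} (hp : 1 ≤ p) (hpt : p ≤ t) (htm : t + m + 1 = n) :
    IsMonic (p + m) (column n c p t) := by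
  induction m generalizing t with
  | zero =>
    rw [show t = n - 1 by omega, column_pred]
    exact isMonic_vecBasis hp (by omega)
  | succ m ih =>
    rw [column_eq_act_block c p (by omega)]
    exact (ih (t := t + 1) (by omega) (by omega)).act_block hn (hc _) (hc₀ _) (by omega) (by omega)

theorem vecCoord_column {k t m : ℕ} (hk : 1 ≤ k) (hkt : k < t) (htm : t + m + 1 = n) :
    vecCoord (column n c (k + 1) t) (k + m) =
      ∑ j ∈ Finset.Icc (t + 1) (n - 1), c j (n - 1 + k - j) / c j (n + k - j) := by
  induction m generalizing t with
  | zero =>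
    rw [show t = n - 1 by omega, column_pred, Finset.Icc_eq_empty (by omega), Finset.sum_empty]
    simp only [vecCoord, vecBasis]
    split_ifs <;> first | rfl | omega
  | succ m ih =>
    have hmonic := isMonic_column hn hc hc₀ (p := k + 1) (t := t + 1) (m := m) (by omega)
      (by omega) (by omega)
    rw [column_eq_act_block c _ (by omega), ← add_assoc, vecCoord_block hn (hc _) _ (by omega)
      (by omega), ih (by omega) (by omega), add_right_comm k m 1, hmonic.vecCoord_eq_one, mul_one,
      ← Finset.add_sum_Ioc_eq_sum_Icc (a := t + 1) (by omega), ← Finset.Icc_add_one_left_eq_Ioc,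
      show n - 1 + k - (t + 1) = k + m by omega, show n + k - (t + 1) = k + 1 + m by omega]

theorem barCoord_column_one {k : ℕ} (hk : 1 ≤ k) (hkn : k + 2 ≤ n) :
    barCoord (column n c (k + 1) (k - 1)) 1 =
      c k 1 + ∑ j ∈ Finset.Icc 2 (n - 2), c k j / c (k + 1) (j - 1)
        + c k (n - 1) * c k n / c (k + 1) (n - 2)
        + c (k + 1) (n - 2) / (c (k + 1) (n - 1) * c (k + 1) n)
        + c k n / c (k + 1) (n - 1)
        + c k (n - 1) / c (k + 1) n
        + ∑ j ∈ Finset.Icc (k + 2) (n - 1), c j (n - 1 + k - j) / c j (n + k - j) := by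
  have hmonic : IsMonic (n - 1) (column n c (k + 1) (k + 1)) := by
    have h := isMonic_column hn hc hc₀ (p := k + 1) (t := k + 1) (m := n - 2 - k) (by omega) le_rfl
      (by omega)
    rwa [show k + 1 + (n - 2 - k) = n - 1 by omega] at h
  have hslack := vecCoord_column hn hc hc₀ (t := k + 1) (m := n - 2 - k) hk k.lt_succ_self
    (by omega)
  rw [show k + (n - 2 - k) = n - 2 by omega] at hslack
  have hfirst : ∑ j ∈ Finset.range (n - 2), c k (j + 1) / c (k + 1) j =
      c k 1 + ∑ j ∈ Finset.Icc 2 (n - 2), c k j / c (k + 1) (j - 1) := by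
    rw [Finset.range_eq_Ico, Finset.sum_eq_sum_Ico_succ_bot (by omega), hc₀, div_one,
      ← Finset.Ico_add_one_right_eq_Icc,
      ← Finset.sum_Ico_add' (fun j => c k j / c (k + 1) (j - 1)) 1 (n - 2) 1]
    rfl
  rw [column_eq_act_block c _ (by omega), Nat.sub_add_cancel hk, column_eq_act_block c _ (by omega),
    hmonic.barCoord_block_block hn (hc _) (hc₀ _) (hc _) (hc₀ _), hslack, hfirst]
  ring

end Column

/-! ### The minors of the vector representation -/

theorem det_eq_of_row_eq_add_mul_succ {R : Type*} [CommRing R] {K : ℕ}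
    {E : Matrix (Fin (K + 1)) (Fin (K + 1)) R} {N : Matrix (Fin K) (Fin (K + 1)) R} (r : R)
    (h : ∀ a b, E a.castSucc b = N a b + r * E a.succ b) (h₀ : ∀ a, N a 0 = 0) :
    E.det = (-1) ^ K * E (Fin.last K) 0 * (N.submatrix id Fin.succ).det := by
  let B : Matrix (Fin (K + 1)) (Fin (K + 1)) R :=
    of fun a b => Fin.lastCases (E (Fin.last K) b) (fun a => N a b) a
  have hB_last (b) : B (Fin.last K) b = E (Fin.last K) b := by simp [B]
  have hB_castSucc (a b) : B (Fin.castSucc a) b = N a b := by simp [B]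
  have hEB : E.det = B.det := by
    rw [← det_submatrix_equiv_self Fin.revPerm E, ← det_submatrix_equiv_self Fin.revPerm B]
    refine det_eq_of_forall_row_eq_smul_add_pred (fun _ => r) (fun b => ?_) fun a b => ?_
    · simp only [submatrix_apply, Fin.revPerm_apply, Fin.rev_zero, hB_last]
    · simp only [submatrix_apply, Fin.revPerm_apply, Fin.rev_succ, Fin.rev_castSucc, hB_castSucc, h]
  rw [hEB, det_succ_column_zero, Fin.sum_univ_castSucc, Finset.sum_eq_zero, zero_add, hB_last,
    Fin.val_last]
  · congr 2
    ext a b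
    rw [submatrix_apply, Fin.succAbove_last, hB_castSucc, submatrix_apply, id]
  · intro a _
    rw [hB_castSucc, h₀, mul_zero, zero_mul]

theorem det_eq_of_mul_row_eq_add_mul_succ {R : Type*} [CommRing R] [IsDomain R] {K : ℕ}
    {M : Matrix (Fin (K + 1)) (Fin (K + 1)) R} {N : Matrix (Fin K) (Fin (K + 1)) R} {δ : ℕ → R}
    (hδ : ∀ a, δ a ≠ 0) (hδ₀ : δ 0 = 1) (r : R)
    (h : ∀ a b, δ a.val * M a.castSucc b =
      δ (a.val + 1) * N a b + r * (δ (a.val + 1) * M a.succ b))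
    (h₀ : ∀ a, N a 0 = 0) (hlast : (-1) ^ K * (δ K * M (Fin.last K) 0) = 1) :
    M.det = (N.submatrix id Fin.succ).det := by
  have hdet := det_eq_of_row_eq_add_mul_succ (E := of fun a b => δ a.val * M a b)
    (N := of fun a b => δ (a.val + 1) * N a b) r h fun a => by rw [of_apply, h₀, mul_zero]
  have hprod : ∏ a : Fin (K + 1), δ a.val = ∏ a : Fin K, δ (a.val + 1) := by
    rw [Fin.prod_univ_succ, Fin.val_zero, hδ₀, one_mul]
    rfl
  have hrhs : ((of fun a b => δ (a.val + 1) * N a b).submatrix id Fin.succ).det =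
      (∏ a : Fin K, δ (a.val + 1)) * (N.submatrix id Fin.succ).det :=
    det_mul_column (fun a : Fin K => δ (a.val + 1)) (N.submatrix id Fin.succ)
  rw [det_mul_column (fun a : Fin (K + 1) => δ a.val) M, hprod, hrhs, of_apply, Fin.val_last, hlast,
    one_mul] at hdet
  exact mul_left_cancel₀ (Finset.prod_ne_zero_iff.2 fun a _ => hδ _) hdet

/-- The relation between consecutive rows clears the first column, whose block `t + 1` starts from
the monic column of `v_{t+1}`, and leaves the same determinant for the remaining blocks. -/
theorem det_barCoord_column (hn : 3 ≤ n) {c : ℕ → ℕ → ℂ} (hc : ∀ l i, c l i ≠ 0)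
    (hc₀ : ∀ l, c l 0 = 1) {t K : ℕ} (hK : t + K + 2 < n) :
    (of fun a b : Fin (K + 1) => (-1 : ℂ) ^ a.val *
      barCoord (column n c (t + if b.val = K then b.val + 2 else b.val + 1) t) (a.val + 1)).det =
      barCoord (column n c (t + K + 2) (t + K)) 1 := by
  induction K generalizing t with
  | zero => simp
  | succ K ih =>
    have hmonic : IsMonic (n - 1) (column n c (t + 1) (t + 1)) := by
      have h := isMonic_column hn hc hc₀ (p := t + 1) (t := t + 1) (m := n - 2 - t) (by omega)
        le_rfl (by omega)
      rwa [show t + 1 + (n - 2 - t) = n - 1 by omega] at h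
    have hcol (p) := column_eq_act_block c p (show t + 1 < n by omega)
    rw [show t + (K + 1) = t + 1 + K by omega, ← ih (by omega)]
    refine (det_eq_of_mul_row_eq_add_mul_succ (hc (t + 1)) (hc₀ (t + 1)) (-1)
      (N := of fun a b => (-1) ^ a.val * barCoord (column n c
        (t + if b.val = K + 1 then b.val + 2 else b.val + 1) (t + 1)) (a.val + 1))
      (fun a b => ?_) (fun a => ?_) ?_).trans ?_
    · have h := mul_barCoord_block hn (hc (t + 1)) (column n c
        (t + if b.val = K + 1 then b.val + 2 else b.val + 1) (t + 1)) (hc₀ _)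
        (show a.val + 2 < n by omega)
      rw [← hcol] at h
      simp only [of_apply, Fin.val_castSucc, Fin.val_succ]
      linear_combination (-1) ^ a.val * h
    · simp [hmonic.barCoord_eq_zero]
    · have h := hmonic.mul_barCoord_block hn (hc (t + 1)) (hc₀ _) (show K + 1 + 2 ≤ n by omega)
      rw [← hcol] at h
      simp only [of_apply, Fin.val_last, Fin.val_zero, if_neg K.succ_ne_zero.symm, zero_add]
      rw [mul_left_comm (c (t + 1) (K + 1)), h, mul_one, ← mul_pow, neg_one_mul, neg_neg, one_pow]
    · congr 1
      ext a b
      simp only [submatrix_apply, of_apply, id, Fin.val_succ, add_left_inj]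
      congr 3
      split_ifs <;> omega

/-! ### The minors of the spin representations -/

theorem Raise.exists_spin {i : Fin n} {S : SpinIdx n} {a : Idx n} (h : Raise i (.inr S) a) :
    ∃ S' : SpinIdx n, a = .inr S' := by
  obtain a | S' := a
  · exact h.elim
  · exact ⟨S', rfl⟩

theorem corootPairing_spin_of_succ (hn : 3 ≤ n) {i j : Fin n} (hj : j.val = i.val + 1)
    (S : SpinIdx n) : corootPairing i (.inr S) =
      if S i then if S j then 0 else 1 else if S j then -1 else 0 := by
  have h := epsRoot_dot_doubleWeight hn i (.inr S)
  simp only [epsRoot_of_succ hj, sub_dotProduct, single_one_dotProduct, doubleWeight] at h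
  split_ifs at h ⊢ <;> omega

theorem corootPairing_spin_of_last (hn : 3 ≤ n) {i j : Fin n} (hi : i.val + 1 = n)
    (hj : j.val + 1 = i.val) (S : SpinIdx n) : corootPairing i (.inr S) =
      if S i then if S j then 1 else 0 else if S j then 0 else -1 := by
  have h := epsRoot_dot_doubleWeight hn i (.inr S)
  simp only [epsRoot_of_last hi hj, add_dotProduct, single_one_dotProduct, doubleWeight] at h
  split_ifs at h ⊢ <;> omega

/-- The value of twice the weight of a basis vector on `ε_1 + ⋯ + ε_{n-1}`. On sign vectors it
counts the plus signs, minus the minus signs, among the first `n - 1` signs. -/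
def forkHeight (b : Idx n) : ℤ :=
  (fun j : Fin n => if j.val + 1 = n then 0 else 1) ⬝ᵥ doubleWeight b

theorem Raise.forkHeight_eq (hn : 3 ≤ n) {i : Fin n} {b a : Idx n} (h : Raise i b a) :
    forkHeight a = forkHeight b + if n ≤ i.val + 2 then 2 else 0 := by
  rw [forkHeight, h.doubleWeight_eq, dotProduct_add, dotProduct_smul, forkHeight]
  obtain ⟨j, hj⟩ | ⟨hi, j, hj⟩ := node_cases hn i
  · rw [epsRoot_of_succ hj, dotProduct_sub, dotProduct_single_one, dotProduct_single_one]
    split_ifs <;> simp <;> omega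
  · rw [epsRoot_of_last hi hj, dotProduct_add, dotProduct_single_one, dotProduct_single_one]
    split_ifs <;> simp <;> omega

/-- The sign vector whose last sign is `ε` and whose other minus signs are the first `m` signs and
the sign with the (0-based) index `i`. For `n ≤ i` there is no further minus sign. -/
def signs (n m i : ℕ) (ε : Bool) : SpinIdx n := fun j =>
  if j.val + 1 = n then ε else !decide (j.val < m ∨ j.val = i)

theorem signs_self (m : ℕ) (ε : Bool) : signs n m m ε = signs n (m + 1) n ε := by
  funext j
  have := j.2
  simp only [signs]
  congr 2
  exact decide_eq_decide.2 (by omega)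

theorem spinTarget_eq (ε : Bool) : (spinTarget ε : Idx n) = .inr (signs n 0 (n - 2) (!ε)) := by
  refine congrArg _ (funext fun j => ?_)
  have := j.2
  simp only [signs]
  split_ifs <;> simp <;> omega

theorem spinVec_false_eq (ε : Bool) : (spinVec false ε : Idx n) = .inr (signs n (n - 1) n ε) := by
  refine congrArg _ (funext fun j => ?_)
  have := j.2
  simp only [signs]
  split_ifs <;> simp
  omega

theorem raise_signs {i : Fin n} {m : ℕ} (ε : Bool) (hm : m ≤ i.val) (hi : i.val + 2 < n) :
    Raise i (.inr (signs n m i ε)) (.inr (signs n m (i + 1) ε)) := by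
  refine .inl ⟨⟨i.val + 1, by omega⟩, rfl, ?_, ?_, funext fun j => ?_⟩ <;>
    simp [signs, Function.update_apply, Fin.ext_iff] <;> grind

theorem raise_signs_true {i : Fin n} {m : ℕ} (hm : m ≤ i.val) (hi : i.val + 2 = n) :
    Raise i (.inr (signs n m i true)) (.inr (signs n m n false)) := by
  refine .inl ⟨⟨i.val + 1, by omega⟩, rfl, ?_, ?_, funext fun j => ?_⟩ <;>
    simp [signs, Function.update_apply, Fin.ext_iff] <;> grind

theorem raise_signs_false {i j : Fin n} {m : ℕ} (hm : m ≤ j.val) (hj : j.val + 1 = i.val)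
    (hi : i.val + 1 = n) : Raise i (.inr (signs n m j false)) (.inr (signs n m n true)) := by
  refine .inr ⟨hi, j, hj, ?_, ?_, funext fun l => ?_⟩ <;>
    simp [signs, Function.update_apply, Fin.ext_iff] <;> grind

theorem forkHeight_signs_last (m i : ℕ) (ε ε' : Bool) :
    forkHeight (.inr (signs n m i ε)) = forkHeight (.inr (signs n m i ε')) := by
  unfold forkHeight dotProduct
  refine Finset.sum_congr rfl fun j _ => ?_
  simp only [doubleWeight, signs]
  split_ifs <;> simp

theorem forkHeight_signs (hn : 3 ≤ n) {m i : ℕ} (hm : m ≤ i) (hi : i + 2 ≤ n) (ε ε' : Bool) :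
    forkHeight (.inr (signs n m i ε)) + 2 = forkHeight (.inr (signs n m n ε')) := by
  obtain ⟨d, hd⟩ := Nat.exists_eq_add_of_le' hi
  induction d generalizing i with
  | zero =>
    rw [forkHeight_signs_last m i ε true, forkHeight_signs_last m n ε' false,
      (raise_signs_true (i := ⟨i, by omega⟩) hm (by simp only; omega)).forkHeight_eq hn,
      if_pos (by simp only; omega)]
  | succ d ih =>
    rw [← ih (i := i + 1) (by omega) (by omega) (by omega),
      (raise_signs (i := ⟨i, by omega⟩) ε hm (by simp only; omega)).forkHeight_eq hn,
      if_neg (by simp only; omega), add_zero]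

section BlockSpin

variable (hn : 3 ≤ n) {d : ℕ → ℂ} (hd : ∀ i, d i ≠ 0) {φ : Idx n → ℂ}

include hn hd

theorem act_blockFrom_eq_zero {b : Idx n} {i : ℕ} (hi : i ≤ n) (hb : φ b = 0)
    (h : ∀ m : Fin n, i ≤ m.val → corootPairing m b ≠ -1) : act (blockFrom n d i) φ b = 0 := by
  induction hi using Nat.decreasingInduction with
  | self => rw [blockFrom_self, act_one, hb]
  | of_succ i hi ih =>
    rw [act_blockFrom_of_ne hn hd φ (i := ⟨i, hi⟩) (h _ le_rfl),
      ih fun m hm => h m (Nat.le_of_succ_le hm), mul_zero]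

theorem act_blockFrom_left_eq_zero {i : Fin n} {b a : Idx n} (h : Raise i b a) (hb : φ b = 0)
    (ha : φ a = 0)
    (hpair : ∀ m : Fin n, i < m → corootPairing m b ≠ -1 ∧ corootPairing m a ≠ -1) :
    act (blockFrom n d i) φ b = 0 := by
  rw [act_blockFrom_left hn hd φ h,
    act_blockFrom_eq_zero hn hd i.2 hb fun m hm => (hpair m hm).1,
    act_blockFrom_eq_zero hn hd i.2 ha fun m hm => (hpair m hm).2, mul_zero, add_zero]

theorem act_blockFrom_fork_eq_zero {i j : Fin n} (hi : i.val + 1 = j.val) (hj : j.val + 1 = n)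
    {S : SpinIdx n} (hS : φ (.inr S) = 0)
    (h : ∀ S' : SpinIdx n, S' i = true →
      forkHeight (.inr S' : Idx n) = forkHeight (.inr S : Idx n) + 2 → φ (.inr S') = 0) :
    act (blockFrom n d i) φ (.inr S) = 0 := by
  have hpair_i (T : SpinIdx n) := corootPairing_spin_of_succ hn hi.symm T
  have hpair_j (T : SpinIdx n) := corootPairing_spin_of_last hn hj hi T
  have eq_or_eq {m : Fin n} (hm : i ≤ m) : m = i ∨ m = j := by omega
  have zero_of_raise {m : Fin n} {S' : SpinIdx n} (hm : i ≤ m)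
      (hraise : Raise m (.inr S) (.inr S')) : φ (.inr S') = 0 := by
    refine h S' ?_ ?_
    · have hpair := hraise.corootPairing_right hn
      rcases eq_or_eq hm with rfl | rfl <;> grind
    · rw [hraise.forkHeight_eq hn, if_pos (by omega)]
  by_cases hSi : corootPairing i (.inr S) = -1
  · obtain ⟨a, ha⟩ := exists_raise hn hSi
    obtain ⟨S', rfl⟩ := ha.exists_spin
    have hS'i := ha.corootPairing_right hn
    refine act_blockFrom_left_eq_zero hn hd ha hS (zero_of_raise le_rfl ha) fun m hm => ?_
    obtain rfl : m = j := by omega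
    grind
  rw [act_blockFrom_of_ne hn hd φ hSi, hi]
  refine mul_eq_zero_of_right _ ?_
  by_cases hSj : corootPairing j (.inr S) = -1
  · obtain ⟨a, ha⟩ := exists_raise hn hSj
    obtain ⟨S', rfl⟩ := ha.exists_spin
    exact act_blockFrom_left_eq_zero hn hd ha hS (zero_of_raise (by omega) ha) fun m hm => by omega
  · refine act_blockFrom_eq_zero hn hd j.2.le hS fun m hm => ?_
    rwa [show m = j by omega]

theorem act_blockFrom_eq_zero_of_forkHeight_lt {N : ℤ} {i j : ℕ} (hij : i ≤ j) (hj : j + 2 ≤ n)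
    (h : ∀ S : SpinIdx n, forkHeight (.inr S : Idx n) < N → act (blockFrom n d j) φ (.inr S) = 0)
    (S : SpinIdx n) (hS : forkHeight (.inr S : Idx n) < N) :
    act (blockFrom n d i) φ (.inr S) = 0 := by
  induction hij using Nat.decreasingInduction generalizing S with
  | self => exact h S hS
  | of_succ i hi ih =>
    by_cases hpair : corootPairing (⟨i, by omega⟩ : Fin n) (.inr S) = -1
    · obtain ⟨a, ha⟩ := exists_raise hn hpair
      obtain ⟨S', rfl⟩ := ha.exists_spin
      have hheight := ha.forkHeight_eq hn
      rw [if_neg (by simp only; omega), add_zero] at hheight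
      rw [act_blockFrom_left hn hd φ ha, ih S hS, ih S' (hheight ▸ hS), mul_zero, add_zero]
    · rw [act_blockFrom_of_ne hn hd φ hpair, ih S hS, mul_zero]

theorem act_blockFrom_signs_eq_zero {m i : ℕ} {ε : Bool} (hm : m ≤ i) (hi : i + 2 < n)
    (h : φ (.inr (signs n m i ε)) = 0) :
    act (blockFrom n d (i + 1)) φ (.inr (signs n m i ε)) = 0 := by
  refine act_blockFrom_eq_zero hn hd (by omega) h fun q hq => ?_
  obtain ⟨q', hq'⟩ | ⟨hqn, q', hq'⟩ := node_cases hn q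
  · rw [corootPairing_spin_of_succ hn hq']
    grind [signs]
  · rw [corootPairing_spin_of_last hn hqn hq']
    grind [signs]

theorem act_block_signs {m : ℕ} (ε : Bool) (hm : m + 2 ≤ n)
    (h : ∀ i, m ≤ i → i + 2 < n → φ (.inr (signs n m i ε)) = 0) :
    act (blockFrom n d 0) φ (.inr (signs n m m ε)) =
      act (blockFrom n d (n - 2)) φ (.inr (signs n m (n - 2) ε)) := by
  have hskip : act (blockFrom n d 0) φ (.inr (signs n m m ε)) =
      act (blockFrom n d m) φ (.inr (signs n m m ε)) := by
    refine act_blockFrom_skip hn hd φ m.zero_le (by omega) fun q _ hq => ?_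
    rw [corootPairing_spin_of_succ hn (j := ⟨q.val + 1, by omega⟩) rfl]
    grind [signs]
  have hstep {i : ℕ} (hmi : m ≤ i) (hi : i + 2 ≤ n) :
      act (blockFrom n d m) φ (.inr (signs n m m ε)) =
        act (blockFrom n d i) φ (.inr (signs n m i ε)) := by
    induction i, hmi using Nat.le_induction with
    | base => rfl
    | succ i hmi ih =>
      rw [ih (by omega), act_blockFrom_left hn hd φ (raise_signs (i := ⟨i, by omega⟩) ε hmi hi),
        act_blockFrom_signs_eq_zero hn hd hmi hi (h i hmi hi), mul_zero, zero_add]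
  rw [hskip, hstep (by omega : m ≤ n - 2) (by omega)]

theorem act_blockFrom_fork_signs {m : ℕ} (ε : Bool) (hm : m + 2 ≤ n) :
    act (blockFrom n d (n - 2)) φ (.inr (signs n m (n - 2) ε)) =
      (if ε then d (n - 1) else d n) * φ (.inr (signs n m (n - 2) ε)) +
        φ (.inr (signs n m n (!ε))) := by
  obtain ⟨p, rfl⟩ := Nat.exists_eq_add_of_le' (by omega : 2 ≤ n)
  have hpair_fst (T : SpinIdx (p + 2)) := corootPairing_spin_of_succ hn (i := ⟨p, by omega⟩)
    (j := Fin.last _) rfl T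
  have hpair_snd (T : SpinIdx (p + 2)) := corootPairing_spin_of_last hn (i := Fin.last _)
    (j := ⟨p, by omega⟩) rfl rfl T
  rw [show p + 2 - 2 = p by omega, show p + 2 - 1 = p + 1 by omega]
  cases ε
  · have hfst : corootPairing ⟨p, by omega⟩ (.inr (signs (p + 2) m p false)) = 0 := by
      rw [hpair_fst]
      grind [signs]
    have hraise := raise_signs_false (i := Fin.last (p + 1)) (j := ⟨p, by omega⟩) (m := m)
      (by simp only; omega) rfl rfl
    have hsnd := act_blockFrom_left hn hd φ hraise
    rw [act_blockFrom_of_ne hn hd φ (i := ⟨p, by omega⟩) (by rw [hfst]; decide), hfst, zpow_zero,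
      one_mul]
    simpa [blockFrom_self, act_one] using hsnd
  · have hraise := raise_signs_true (n := p + 2) (i := ⟨p, by omega⟩) (m := m)
      (by simp only; omega) rfl
    have hself {T : SpinIdx (p + 2)} (hT : corootPairing (Fin.last (p + 1)) (.inr T) = 0) :
        act (blockFrom (p + 2) d (p + 1)) φ (.inr T) = φ (.inr T) := by
      refine act_blockFrom_eq_self hn hd φ (by omega) fun q hq => ?_
      rwa [show q = Fin.last (p + 1) from Fin.ext (by rw [Fin.val_last]; omega)]
    rw [act_blockFrom_left hn hd φ hraise, hself, hself, if_pos rfl]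
    · rfl
    all_goals
      rw [hpair_snd]
      grind [signs]

theorem act_block_eq_zero_of_forkHeight_lt {N : ℤ} {i : Fin n} (hi : i.val + 2 = n)
    (h : ∀ S : SpinIdx n, forkHeight (.inr S : Idx n) < N → φ (.inr S) = 0)
    (h' : ∀ S : SpinIdx n, S i = true → forkHeight (.inr S : Idx n) < N + 2 → φ (.inr S) = 0)
    (S : SpinIdx n) (hS : forkHeight (.inr S : Idx n) < N) :
    act (blockFrom n d 0) φ (.inr S) = 0 := by
  refine act_blockFrom_eq_zero_of_forkHeight_lt hn hd i.val.zero_le (by omega)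
    (fun S hS => ?_) S hS
  exact act_blockFrom_fork_eq_zero hn hd (j := ⟨i.val + 1, by omega⟩) rfl hi (h S hS)
    fun S' hS' hheight => h' S' hS' (by omega)

end BlockSpin

theorem forkHeight_signs_succ (hn : 3 ≤ n) {m : ℕ} (hm : m + 2 ≤ n) :
    forkHeight (.inr (signs n (m + 1) n true)) + 2 = forkHeight (.inr (signs n m n true)) := by
  rw [← signs_self, forkHeight_signs hn le_rfl hm]

/-- The image under the last blocks, those with index `> t`, of the basis vector of the half-spin
representation that defines the minor of the spin weight. -/
def spinColumn (n : ℕ) (c : ℕ → ℕ → ℂ) (ε : Bool) (t : ℕ) : Idx n → ℂ :=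
  act (thetaTail n c t) (Pi.single (spinTarget ε) 1)

theorem spinColumn_eq_act_block (c : ℕ → ℕ → ℂ) (ε : Bool) {t : ℕ} (ht : t + 1 < n) :
    spinColumn n c ε t = act (blockFrom n (c (t + 1)) 0) (spinColumn n c ε (t + 1)) := by
  rw [spinColumn, thetaTail_eq_mul c ht, act_mul, spinColumn]

theorem spinColumn_pred (c : ℕ → ℕ → ℂ) (ε : Bool) :
    spinColumn n c ε (n - 1) = Pi.single (.inr (signs n 0 (n - 2) (!ε))) 1 := by
  rw [spinColumn, thetaTail_pred, act_one, spinTarget_eq]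

section SpinColumn

variable (hn : 3 ≤ n) {c : ℕ → ℕ → ℂ} (hc : ∀ l i, c l i ≠ 0)

include hn hc

theorem spinColumn_eq_zero (ε : Bool) {m t : ℕ} (hmt : m + 1 + t + 1 = n) (S : SpinIdx n)
    (hS : forkHeight (.inr S : Idx n) < forkHeight (.inr (signs n (m + 1) n true) : Idx n)) :
    spinColumn n c ε t (.inr S) = 0 := by
  induction m generalizing t S with
  | zero =>
    have hheight : forkHeight (.inr (signs n (0 + 1) n true)) =
        forkHeight (.inr (signs n 0 (n - 2) (!ε))) := by
      have h := forkHeight_signs hn (n - 2).zero_le (by omega) (!ε) true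
      have h' := forkHeight_signs_succ hn (m := 0) (by omega)
      omega
    rw [spinColumn_eq_act_block c ε (by omega), show t + 1 = n - 1 by omega, spinColumn_pred]
    refine act_block_eq_zero_of_forkHeight_lt hn (hc _) (i := ⟨n - 2, by omega⟩)
      (by simp only; omega) (fun S hS => ?_) (fun S hS _ => ?_) S hS
    · refine Pi.single_eq_of_ne ?_ _
      rintro ⟨⟩
      exact hS.ne hheight.symm
    · refine Pi.single_eq_of_ne ?_ _
      rintro ⟨⟩
      grind [signs]
  | succ m ih =>
    have hheight := forkHeight_signs_succ hn (m := m + 1) (by omega)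
    rw [spinColumn_eq_act_block c ε (by omega)]
    exact act_block_eq_zero_of_forkHeight_lt hn (hc _) (i := ⟨n - 2, by omega⟩)
      (by simp only; omega) (fun S hS => ih (by omega) S (by omega))
      (fun S _ hS => ih (by omega) S (by omega)) S hS

theorem spinColumn_signs (ε : Bool) {m t : ℕ} (hmt : m + 1 + t + 1 = n) :
    spinColumn n c ε t (.inr (signs n (m + 1) n (if Even (m + 1) then ε else !ε))) =
      if ε then c (n - 1) n else c (n - 1) (n - 1) := by
  induction m generalizing t with
  | zero =>
    have hne {i : ℕ} {ε' : Bool} (h : i + 2 < n ∨ i = n) :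
        (.inr (signs n 0 i ε') : Idx n) ≠ .inr (signs n 0 (n - 2) (!ε)) := by
      intro heq
      have := congrFun (Sum.inr_injective heq) ⟨n - 2, by omega⟩
      grind [signs]
    rw [if_neg (by decide), ← signs_self, spinColumn_eq_act_block c ε (by omega),
      show t + 1 = n - 1 by omega, spinColumn_pred,
      act_block_signs hn (hc _) _ (by omega) fun i _ hi => Pi.single_eq_of_ne (hne (.inl hi)) _,
      act_blockFrom_fork_signs hn (hc _) _ (by omega), Pi.single_eq_same,
      Pi.single_eq_of_ne (hne (.inr rfl)), mul_one, add_zero]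
    cases ε <;> rfl
  | succ m ih =>
    have hzero {i : ℕ} {ε' : Bool} (hmi : m + 1 ≤ i) (hi : i + 2 ≤ n) :
        spinColumn n c ε (t + 1) (.inr (signs n (m + 1) i ε')) = 0 := by
      refine spinColumn_eq_zero hn hc ε (m := m) (by omega) _ ?_
      have := forkHeight_signs hn hmi hi ε' true
      omega
    rw [← ih (t := t + 1) (by omega), ← signs_self, spinColumn_eq_act_block c ε (by omega),
      act_block_signs hn (hc _) _ (by omega) fun i hmi hi => hzero hmi hi.le,
      act_blockFrom_fork_signs hn (hc _) _ (by omega), hzero (i := n - 2) (by omega) (by omega),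
      mul_zero, zero_add]
    grind

theorem generalizedMinor_spin_thetaMinus {w₀ : weylGroup n} (hw₀ : IsLongest w₀) (ε : Bool) :
    generalizedMinor (fundamentalWeight (spinNode hn ε)) w₀ (s (spinNode hn ε))
      (thetaMinus (cyclicWord n) (cyclicParams n c)) =
      if ε then c (n - 1) n else c (n - 1) (n - 1) := by
  have h := spinColumn_signs hn hc ε (m := n - 2) (t := 0) (by omega)
  rwa [show n - 2 + 1 = n - 1 by omega, ← spinVec_false_eq, spinColumn, ← thetaMinus_cyclicWord,
    ← generalizedMinor_spin hn hw₀] at h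

end SpinColumn

/-! ### The minors as functions of the given parameters -/

theorem generalizedMinor_vec_thetaMinus (hn : 3 ≤ n) {c : ℕ → ℕ → ℂ} (hc : ∀ l i, c l i ≠ 0)
    (hc₀ : ∀ l, c l 0 = 1) {w₀ : weylGroup n} (hw₀ : IsLongest w₀) (k : Fin n)
    (hk : k.val + 2 < n) :
    generalizedMinor (fundamentalWeight k) w₀ (s k)
        (thetaMinus (cyclicWord n) (cyclicParams n c)) =
      barCoord (column n c (k.val + 2) k.val) 1 := by
  have h := det_barCoord_column hn hc hc₀ (t := 0) (K := k.val) (by omega)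
  simp only [zero_add, column] at h
  rw [generalizedMinor_vec hn hw₀ k hk, thetaMinus_cyclicWord, h, column]

/-- The parameters `c^{(l)}_i` extended by `1` outside `1 ≤ l ≤ n - 1`, `1 ≤ i ≤ n`, where the
values of `c` are arbitrary. -/
def extendByOne (n : ℕ) (c : ℕ → ℕ → ℂ) (l i : ℕ) : ℂ :=
  if l ∈ Finset.Icc 1 (n - 1) ∧ i ∈ Finset.Icc 1 n then c l i else 1

theorem extendByOne_of_mem (c : ℕ → ℕ → ℂ) {l i : ℕ} (hl : 1 ≤ l ∧ l + 1 ≤ n)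
    (hi : 1 ≤ i ∧ i ≤ n) : extendByOne n c l i = c l i := by
  rw [extendByOne, if_pos]
  simp only [Finset.mem_Icc]
  omega

theorem extendByOne_ne_zero {c : ℕ → ℕ → ℂ}
    (hc : ∀ l ∈ Finset.Icc 1 (n - 1), ∀ i ∈ Finset.Icc 1 n, c l i ≠ 0) (l i : ℕ) :
    extendByOne n c l i ≠ 0 := by
  rw [extendByOne]
  split_ifs with h
  · exact hc l h.1 i h.2
  · exact one_ne_zero

theorem extendByOne_zero_right (c : ℕ → ℕ → ℂ) (l : ℕ) : extendByOne n c l 0 = 1 :=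
  if_neg (by simp)

theorem cyclicParams_extendByOne (c : ℕ → ℕ → ℂ) :
    cyclicParams n (extendByOne n c) = cyclicParams n c := by
  refine List.flatMap_congr fun l hl => List.map_congr_left fun i hi => ?_
  rw [List.mem_range] at hl hi
  exact extendByOne_of_mem c (by omega) (by omega)

section Parameters

variable (hn : 3 ≤ n) {c : ℕ → ℕ → ℂ}
  (hc : ∀ l ∈ Finset.Icc 1 (n - 1), ∀ i ∈ Finset.Icc 1 n, c l i ≠ 0)
  {w₀ : weylGroup n} (hw₀ : IsLongest w₀)

include hn hc hw₀

theorem generalizedMinor_vec_eq {k : ℕ} (hk : 1 ≤ k) (hkn : k + 2 ≤ n) :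
    generalizedMinor (fundamentalWeight ⟨k - 1, by omega⟩) w₀ (s ⟨k - 1, by omega⟩)
        (thetaMinus (cyclicWord n) (cyclicParams n c)) =
      c k 1 + ∑ j ∈ Finset.Icc 2 (n - 2), c k j / c (k + 1) (j - 1)
        + c k (n - 1) * c k n / c (k + 1) (n - 2)
        + c (k + 1) (n - 2) / (c (k + 1) (n - 1) * c (k + 1) n)
        + c k n / c (k + 1) (n - 1)
        + c k (n - 1) / c (k + 1) n
        + ∑ j ∈ Finset.Icc (k + 2) (n - 1), c j (n - 1 + k - j) / c j (n + k - j) := by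
  have h := generalizedMinor_vec_thetaMinus hn (extendByOne_ne_zero hc)
    (extendByOne_zero_right c) hw₀ ⟨k - 1, by omega⟩ (by simp only; omega)
  rw [cyclicParams_extendByOne, show k - 1 + 2 = k + 1 by omega,
    barCoord_column_one hn (extendByOne_ne_zero hc) (extendByOne_zero_right c) hk hkn] at h
  have hval {l i : ℕ} (hl : 1 ≤ l ∧ l + 1 ≤ n) (hi : 1 ≤ i ∧ i ≤ n) := extendByOne_of_mem c hl hi
  have hsum : ∑ j ∈ Finset.Icc 2 (n - 2), extendByOne n c k j / extendByOne n c (k + 1) (j - 1) =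
      ∑ j ∈ Finset.Icc 2 (n - 2), c k j / c (k + 1) (j - 1) := by
    refine Finset.sum_congr rfl fun j hj => ?_
    rw [Finset.mem_Icc] at hj
    rw [hval (by omega) (by omega), hval (by omega) (by omega)]
  have hsum' : ∑ j ∈ Finset.Icc (k + 2) (n - 1),
        extendByOne n c j (n - 1 + k - j) / extendByOne n c j (n + k - j) =
      ∑ j ∈ Finset.Icc (k + 2) (n - 1), c j (n - 1 + k - j) / c j (n + k - j) := by
    refine Finset.sum_congr rfl fun j hj => ?_
    rw [Finset.mem_Icc] at hj
    rw [hval (by omega) (by omega), hval (by omega) (by omega)]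
  rw [h, hsum, hsum']
  iterate 6 rw [hval (by omega) (by omega)]

theorem generalizedMinor_spin_eq (ε : Bool) :
    generalizedMinor (fundamentalWeight (spinNode hn ε)) w₀ (s (spinNode hn ε))
        (thetaMinus (cyclicWord n) (cyclicParams n c)) =
      if ε then c (n - 1) n else c (n - 1) (n - 1) := by
  have h := generalizedMinor_spin_thetaMinus hn (extendByOne_ne_zero hc) hw₀ ε
  rwa [cyclicParams_extendByOne, extendByOne_of_mem c (by omega) (by omega),
    extendByOne_of_mem c (by omega) (by omega)] at h

end Parameters

end TypeD

end

theorem mainTheorem9 (n : ℕ) (hn : 3 ≤ n) (w₀ : TypeD.weylGroup n) (hw₀ : TypeD.IsLongest w₀) :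
    TypeD.IsReducedWord (TypeD.cyclicWord n) w₀ ∧
    (∀ k : Fin n, ∃! F : TypeD.G n → ℂ,
      TypeD.IsPrincipalMinor (TypeD.fundamentalWeight k) F) ∧
    ∀ c : ℕ → ℕ → ℂ,
      (∀ l ∈ Finset.Icc 1 (n - 1), ∀ i ∈ Finset.Icc 1 n, c l i ≠ 0) →
      (∀ (k : ℕ) (hk : 1 ≤ k) (hkn : k ≤ n - 2),
        TypeD.generalizedMinor (TypeD.fundamentalWeight ⟨k - 1, by omega⟩)
            w₀ (TypeD.s ⟨k - 1, by omega⟩)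
            (TypeD.thetaMinus (TypeD.cyclicWord n) (TypeD.cyclicParams n c)) =
          c k 1 + ∑ j ∈ Finset.Icc 2 (n - 2), c k j / c (k + 1) (j - 1)
            + c k (n - 1) * c k n / c (k + 1) (n - 2)
            + c (k + 1) (n - 2) / (c (k + 1) (n - 1) * c (k + 1) n)
            + c k n / c (k + 1) (n - 1)
            + c k (n - 1) / c (k + 1) n
            + ∑ j ∈ Finset.Icc (k + 2) (n - 1), c j (n - 1 + k - j) / c j (n + k - j)) ∧
      TypeD.generalizedMinor (TypeD.fundamentalWeight ⟨n - 2, by omega⟩)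
          w₀ (TypeD.s ⟨n - 2, by omega⟩)
          (TypeD.thetaMinus (TypeD.cyclicWord n) (TypeD.cyclicParams n c)) = c (n - 1) (n - 1) ∧
      TypeD.generalizedMinor (TypeD.fundamentalWeight ⟨n - 1, by omega⟩)
          w₀ (TypeD.s ⟨n - 1, by omega⟩)
          (TypeD.thetaMinus (TypeD.cyclicWord n) (TypeD.cyclicParams n c)) = c (n - 1) n := by
  refine ⟨TypeD.isReducedWord_cyclicWord hn hw₀, fun k => ?_, fun c hc =>
    ⟨fun k hk hkn => TypeD.generalizedMinor_vec_eq hn hc hw₀ hk (by omega),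
      TypeD.generalizedMinor_spin_eq hn hc hw₀ false,
      TypeD.generalizedMinor_spin_eq hn hc hw₀ true⟩⟩
  obtain ⟨F, hF⟩ := TypeD.exists_isPrincipalMinor hn k
  exact ⟨F, hF, fun F' hF' => hF'.unique hn hF⟩
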